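/- **Model.** A slotted network has $N$ nodes, a finite set $\mathcal S\subseteq\{0,1\}^{N\times N}$ of feasible schedules, and a queue for each ordered pair $(i,j)$, $i\ne j$, with length $L_{ij}(t)$ (and $L_{ii}=A_{ii}=0$). It evolves by $L_{ij}(t+1)=L_{ij}(t)-D_{ij}(t)+A_{ij}(t)$, from an arbitrary deterministic $\mathbf L(0)$ and an arbitrary schedule $\mathbf S(-1)\in\mathcal S$. The schedule is reconfigured at time $s$ if $\mathbf S(s)\ne\mathbf S(s-1)$; every reconfiguration at $s$ makes the $\Delta_r$ slots $s,\dots,s+\Delta_r-1$ useless ($\mathbf D=0$), where $\Delta_r\ge1$ is an integer; in all other slots $D_{ij}(t)=S_{ij}(t)$ if $L_{ij}(t)>0$ and $D_{ij}(t)=0$ otherwise. Write $\|\mathbf L\|=\sum_{i,j}L_{ij}$, $W_{\mathbf S}(t)=\sum_{i,j}L_{ij}(t)S_{ij}$ and $W^*(t)=\max_{\mathbf S\in\mathcal S}W_{\mathbf S}(t)$. A scheduling policy chooses $\mathbf S(t)\in\mathcal S$ as a function of $\mathbf A(0),\dots,\mathbf A(t),\mathbf S(0),\dots,\mathbf S(t-1)$;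 it is Markov if the choice depends only on $(\mathbf S(t-1),\mathbf L(t))$. A policy strongly stabilizes the network if $\limsup_{t\to\infty}\frac1t\sum_{\tau<t}\mathbb E\|\mathbf L(\tau)\|<\infty$. **Traffic.** The arrivals $A_{ij}(t)\in\{0,1,2,\dots\}$ are independent over queues and slots and identically distributed over slots, with finite means $\lambda_{ij}$. Traffic is admissible if some scheduling policy strongly stabilizes the network; $\Lambda$ is the set of the rate matrices $\boldsymbol\lambda=[\lambda_{ij}]$ of admissible traffic; the load is $\rho=\inf\{r\in(0,1):\boldsymbol\lambda\in r\bar\Lambda\}$. **Adaptive variant.** A hysteresis function is a nonnegative, continuous, strictly increasing, unbounded function $g$ on $[0,\infty)$ with $g(x)/x\to0$ as $x\to\infty$. Given a policy $\pi$ that proposes $\mathbf\Pi(t)$, of weight $W^\pi(t)=W_{\mathbf\Pi(t)}(t)$, its $g$-adaptive variant $\pi^g$ keeps $\mathbf S(t)=\mathbf S(t-1)$ if $W^\pi(t)-W_{\mathbf S(t-1)}(t)\le g(W^\pi(t))$ and sets $\mathbf S(t)=\mathbf\Pi(t)$ otherwise. **Theorem.** Let $\Delta_r\ge1$, let $g$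 be a hysteresis function, and let $\pi$ be a policy such that, for a constant $G<\infty$, $W^\pi(t)\ge W^*(t)-G$ for all $t$ whenever the network is operated by $\pi^g$ under arrivals bounded by $A_{\max}$. Then $\pi^g$ strongly stabilizes the network under all admissible traffic with $A_{ij}(t)\le A_{\max}$ whose load is less than one (that is, $\boldsymbol\lambda\in r\bar\Lambda$ for some $0<r<1$). Assume moreover that $g$ is concave, that in each feasible schedule every node transmits to at most one node and receives from at most one node, and that some $N$ feasible schedules together serve all queues (as is the case if all permutation matrices are feasible). For $T>\frac{\Delta_r}{1-\rho}$ put $M_T=g^{-1}\big(G+N(A_{\max}+1)T\big)+NT$, where $g^{-1}(y)=0$ for $y<g(0)$. Then for each real $T>\frac{\Delta_r}{1-\rho}$ the equation $$\tilde L=\frac{N}{1-\frac{\Delta_r}{T}-\rho}\Big\{g(\tilde L+NA_{\max}T)+G+N(T+A_{\max}\Delta_r)+M_T(1+NA_{\max})+\frac{N^2A_{\max}^2}{2}\Big\}$$ has exactly one solution $\tilde L=\tilde L_T\ge0$, and under $\pi^g$ $$\limsup_{t\to\infty}\frac1t\sum_{\tau<t}\mathbb E\|\mathbf L(\tau)\|\le\inf_{T>\Delta_r/(1-\rho)}\tilde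 L_T .$$ If $\pi$ is Markov, then $\lim_{t\to\infty}\mathbb E\|\mathbf L(t)\|$ exists and satisfies $$\lim_{t\to\infty}\mathbb E\|\mathbf L(t)\|\le\inf_{T>\Delta_r/(1-\rho)}\tilde L_T .$$ -/

import Mathlib

open MeasureTheory ProbabilityTheory Filter Topology
open scoped ENNReal Pointwise

/-- Integer matrices indexed by (source, destination): queue lengths, numbers of arrivals. -/
abbrev QMat (N : ℕ) := Fin N → Fin N → ℕ

/-- A schedule: `S i j = true` iff the circuit from `i` to `j` is established. -/
abbrev Schedule (N : ℕ) := Fin N → Fin N → Bool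

/-- Total queue length. -/
def totalQueue {N : ℕ} (L : QMat N) : ℕ := ∑ i, ∑ j, L i j

/-- Weight of a schedule for given queue lengths. -/
def weight {N : ℕ} (L : QMat N) (S : Schedule N) : ℕ :=
  ∑ i, ∑ j, if S i j then L i j else 0

/-- A slotted network of `N` nodes: the set of feasible schedules, the reconfiguration delay
(in slots), the queue lengths at time `0` and the schedule in force just before time `0`.
There is no queue from a node to itself. -/
structure Network (N : ℕ) where
  feasible : Finset (Schedule N)
  delay : ℕ
  queue0 : QMat N
  queue0_diag : ∀ i, queue0 i i = 0
  sched0 : Schedule N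
  sched0_mem : sched0 ∈ feasible

namespace Network

variable {N : ℕ} (net : Network N)

/-- Weight of the MaxWeight schedule. -/
def maxWeight (L : QMat N) : ℕ := net.feasible.sup (weight L)

/-- Each node transmits to at most one node and receives from at most one node. -/
def Crossbar : Prop :=
  ∀ S ∈ net.feasible,
    (∀ i j j', S i j = true → S i j' = true → j = j') ∧
    (∀ i i' j, S i j = true → S i' j = true → i = i')

/-- `N` feasible schedules serve, together, every queue. (Non-blocking networks, in which all
permutation matrices are feasible, are of this kind: take the `N` cyclic shifts.) -/
def Covering : Prop :=
  ∃ s : Fin N → Schedule N, (∀ k, s k ∈ net.feasible) ∧ ∀ i j, i ≠ j → ∃ k, s k i j = true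

/-- The schedule `S (t - 1)`. -/
def prevSched (S : ℕ → Schedule N) : ℕ → Schedule N
  | 0 => net.sched0
  | t + 1 => S t

/-- Slot `t` belongs to one of the `delay` slots `s, …, s + delay - 1` that are lost because the
schedule is changed at some time `s`. -/
def InDelay (S : ℕ → Schedule N) (t : ℕ) : Prop :=
  ∃ s, s ≤ t ∧ t < s + net.delay ∧ S s ≠ net.prevSched S s

open Classical in
/-- Departures in slot `t`, if the queue lengths at its beginning are `L`. -/
noncomputable def departures (S : ℕ → Schedule N) (t : ℕ) (L : QMat N) : QMat N := fun i j =>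
  if net.InDelay S t then 0 else if S t i j = true ∧ 0 < L i j then 1 else 0

/-- Queue lengths at the beginning of slot `t`, for arrivals `a` and schedules `S`. -/
noncomputable def queue (a : ℕ → QMat N) (S : ℕ → Schedule N) : ℕ → QMat N
  | 0 => net.queue0
  | t + 1 => fun i j =>
      queue a S t i j - net.departures S t (queue a S t) i j + a t i j

/-- A scheduling policy: the schedule of slot `t` is feasible and is a function of the history
`a 0, …, a t`, `S 0, …, S (t - 1)`. -/
structure Policy where
  next : ℕ → (ℕ → QMat N) → (ℕ → Schedule N) → Schedule N
  mem : ∀ t a S, (∀ τ < t, S τ ∈ net.feasible) → next t a S ∈ net.feasible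
  causal : ∀ t a a' S S', (∀ τ ≤ t, a τ = a' τ) → (∀ τ < t, S τ = S' τ) →
    next t a S = next t a' S'

theorem prevSched_congr {S S' : ℕ → Schedule N} {t : ℕ} (h : ∀ τ < t, S τ = S' τ) :
    net.prevSched S t = net.prevSched S' t := by
  cases t with
  | zero => rfl
  | succ t => exact h t (Nat.lt_succ_self t)

theorem inDelay_congr {S S' : ℕ → Schedule N} {t : ℕ} (h : ∀ τ ≤ t, S τ = S' τ) :
    net.InDelay S t ↔ net.InDelay S' t := by
  unfold InDelay
  refine exists_congr fun s => and_congr_right fun hs => and_congr_right fun _ => ?_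
  rw [h s hs, net.prevSched_congr (t := s) (fun τ hτ => h τ (by omega))]

theorem queue_congr {a a' : ℕ → QMat N} {S S' : ℕ → Schedule N} {t : ℕ}
    (ha : ∀ τ < t, a τ = a' τ) (h : ∀ τ < t, S τ = S' τ) :
    net.queue a S t = net.queue a' S' t := by
  induction t with
  | zero => rfl
  | succ t ih =>
    have e := ih (fun τ hτ => ha τ (by omega)) (fun τ hτ => h τ (by omega))
    have d := net.inDelay_congr (S := S) (S' := S') (t := t) (fun τ hτ => h τ (by omega))
    funext i j
    have hd : net.departures S t = net.departures S' t := by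
      funext L i j
      unfold departures
      rw [h t (Nat.lt_succ_self t)]
      by_cases hS : net.InDelay S t
      · rw [if_pos hS, if_pos (d.1 hS)]
      · rw [if_neg hS, if_neg (fun h' => hS (d.2 h'))]
    simp only [queue, e, ha t (Nat.lt_succ_self t), hd]

namespace Policy

variable {net} (π : net.Policy)

/-- The schedules generated up to time `t - 1` (with arbitrary values afterwards). -/
def runAux (a : ℕ → QMat N) : ℕ → ℕ → Schedule N
  | 0 => fun _ => net.sched0
  | t + 1 => Function.update (runAux a t) t (π.next t a (runAux a t))

/-- The sequence of schedules of the network operated by `π`, for arrivals `a`. -/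
def run (a : ℕ → QMat N) (t : ℕ) : Schedule N := π.runAux a (t + 1) t

theorem runAux_of_lt (a : ℕ → QMat N) {τ t : ℕ} (h : τ < t) : π.runAux a t τ = π.run a τ := by
  induction t with
  | zero => omega
  | succ t ih =>
    rcases Nat.lt_succ_iff_lt_or_eq.1 h with h' | rfl
    · rw [← ih h', runAux, Function.update_of_ne (by omega)]
    · rfl

/-- `run` is the closed loop of the policy. -/
theorem run_eq (a : ℕ → QMat N) (t : ℕ) : π.run a t = π.next t a (π.run a) := by
  rw [run, runAux, Function.update_self]
  exact π.causal t a a _ _ (fun _ _ => rfl) (fun τ hτ => π.runAux_of_lt a hτ)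

/-- The policy only looks at the previous schedule and the current queue lengths. -/
def IsMarkov : Prop :=
  ∃ p : Schedule N → QMat N → Schedule N, ∀ t a S, (∀ τ < t, S τ ∈ net.feasible) →
    π.next t a S = p (net.prevSched S t) (net.queue a S t)

open Classical in
/-- The `g`-adaptive variant of `π`: keep the previous schedule unless the proposal of `π`
improves its weight by more than `g` of the weight of the proposal. -/
noncomputable def adaptive (g : ℝ → ℝ) : net.Policy where
  next t a S :=
    if (weight (net.queue a S t) (π.next t a S) : ℝ)
        - (weight (net.queue a S t) (net.prevSched S t) : ℝ)
        ≤ g (weight (net.queue a S t) (π.next t a S))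
    then net.prevSched S t else π.next t a S
  mem t a S h := by
    split_ifs
    · cases t with
      | zero => exact net.sched0_mem
      | succ t => exact h t (Nat.lt_succ_self t)
    · exact π.mem t a S h
  causal t a a' S S' ha hS := by
    rw [π.causal t a a' S S' ha hS, net.prevSched_congr hS,
      net.queue_congr (fun τ hτ => ha τ hτ.le) hS]

/-- When `σ` operates the network and at most `Amax` packets arrive per queue and slot, the
schedule proposed by `π` always has weight at least the maximum weight minus `G`. -/
def NearMaxWeight (σ : net.Policy) (Amax : ℕ) (G : ℝ) : Prop :=
  ∀ a : ℕ → QMat N, (∀ t i j, a t i j ≤ Amax) → (∀ t i, a t i i = 0) →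
    ∀ t, (net.maxWeight (net.queue a (σ.run a) t) : ℝ) - G
      ≤ weight (net.queue a (σ.run a) t) (π.next t a (σ.run a))

/-- Mean total queue length at time `t` of the network operated by `π` under the arrivals `A`. -/
noncomputable def meanQueue {Ω : Type*} [MeasurableSpace Ω] (μ : Measure Ω)
    (A : ℕ → Ω → QMat N) (t : ℕ) : ℝ≥0∞ :=
  ∫⁻ ω, (totalQueue (net.queue (fun s => A s ω) (π.run fun s => A s ω) t) : ℝ≥0∞) ∂μ

/-- Limit superior of the time averages of the mean total queue length. -/
noncomputable def limsupAverage {Ω : Type*} [MeasurableSpace Ω] (μ : Measure Ω)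
    (A : ℕ → Ω → QMat N) : ℝ≥0∞ :=
  limsup (fun t : ℕ => (∑ τ ∈ Finset.range t, π.meanQueue μ A τ) / (t : ℝ≥0∞)) atTop

/-- Strong stability. -/
def StronglyStabilizes {Ω : Type*} [MeasurableSpace Ω] (μ : Measure Ω)
    (A : ℕ → Ω → QMat N) : Prop :=
  π.limsupAverage μ A < ∞

end Policy

end Network

/-- Arrival traffic: independent over queues and slots, identically distributed over slots,
with finite means. -/
structure IsTraffic {N : ℕ} {Ω : Type*} [MeasurableSpace Ω] (μ : Measure Ω)
    (A : ℕ → Ω → QMat N) : Prop where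
  measurable : ∀ t i j, Measurable fun ω => A t ω i j
  diag : ∀ t ω i, A t ω i i = 0
  indep : iIndepFun (fun (p : ℕ × Fin N × Fin N) ω => A p.1 ω p.2.1 p.2.2) μ
  ident : ∀ t i j, IdentDistrib (fun ω => A t ω i j) (fun ω => A 0 ω i j) μ μ
  integrable : ∀ i j, Integrable (fun ω => (A 0 ω i j : ℝ)) μ

/-- Traffic rate matrix. -/
noncomputable def rate {N : ℕ} {Ω : Type*} [MeasurableSpace Ω] (μ : Measure Ω)
    (A : ℕ → Ω → QMat N) : Fin N → Fin N → ℝ :=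
  fun i j => ∫ ω, (A 0 ω i j : ℝ) ∂μ

namespace Network

variable {N : ℕ} (net : Network N)

/-- The traffic is admissible: some scheduling policy strongly stabilizes the network. -/
def Admissible {Ω : Type*} [MeasurableSpace Ω] (μ : Measure Ω) (A : ℕ → Ω → QMat N) : Prop :=
  ∃ σ : net.Policy, σ.StronglyStabilizes μ A

/-- Capacity region: the rate matrices of admissible traffic. -/
def capacityRegion : Set (Fin N → Fin N → ℝ) :=
  {lam | ∃ (Ω : Type) (_ : MeasurableSpace Ω) (μ : Measure Ω) (A : ℕ → Ω → QMat N),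
    IsProbabilityMeasure μ ∧ IsTraffic μ A ∧ net.Admissible μ A ∧ rate μ A = lam}

/-- The set of which the load is the infimum. -/
def loadSet (lam : Fin N → Fin N → ℝ) : Set ℝ :=
  {r | lam ∈ r • closure net.capacityRegion ∧ 0 < r ∧ r < 1}

/-- The load of a rate matrix (meaningful if `loadSet` is nonempty, and then smaller than 1). -/
noncomputable def load (lam : Fin N → Fin N → ℝ) : ℝ := sInf (net.loadSet lam)

end Network

/-- Hysteresis functions on `[0, ∞)`. -/
structure IsHysteresis (g : ℝ → ℝ) : Prop where
  nonneg : ∀ x, 0 ≤ x → 0 ≤ g x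
  cont : ContinuousOn g (Set.Ici 0)
  mono : StrictMonoOn g (Set.Ici 0)
  sublinear : Tendsto (fun x => g x / x) atTop (𝓝 0)
  unbounded : Tendsto g atTop atTop

/-- The inverse of a hysteresis function `g` on `[0, ∞)`; its value is `0` below `g 0`. -/
noncomputable def hystInv (g : ℝ → ℝ) (y : ℝ) : ℝ := sInf {x | 0 ≤ x ∧ y ≤ g x}

/-- The constant `M`. -/
noncomputable def boundM (N : ℕ) (g : ℝ → ℝ) (Amax : ℕ) (G T : ℝ) : ℝ :=
  hystInv g (G + N * (Amax + 1) * T) + N * T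

/-- The right-hand side of the fixed point equation, at the point `x`. -/
noncomputable def fixRhs (N Δr : ℕ) (g : ℝ → ℝ) (Amax : ℕ) (G ρ T x : ℝ) : ℝ :=
  N / (1 - Δr / T - ρ) *
    (g (x + N * Amax * T) + G + N * (T + Amax * Δr)
      + boundM N g Amax G T * (1 + N * Amax) + (N : ℝ) ^ 2 * (Amax : ℝ) ^ 2 / 2)

/-!
Quadratic Lyapunov function. In one slot, half the sum of the squares of the queue lengths `L` grows
in the mean by at most `∑ λ L - W + const`, where `W` is the weight of the schedule in force, to be
replaced by `0` if the slot is lost. Three facts control the right-hand side.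

* `Network.sum_mul_le_load_mul`: `∑ λ L ≤ ρ W*(L)`. If traffic is stabilized by any policy, then the
  backlog, weighted with any nonnegative integers `w`, grows at least at rate `∑ λ w - W*(w)`, so
  this is not positive; the inequality passes to the closure of the capacity region.
* The hysteresis rule keeps `W` above `W* - G - g(W*)`.
* `Network.sum_weight_inDelay_le`: lost slots cost at most a fraction `Δr / T` of `∑ W*`, up to a
  constant per slot. Two reconfigurations within time `T` can only happen if the weight is at most
  `g⁻¹(G + N (Amax + 1) T)`; otherwise, the weight at a reconfiguration is charged to the `T`
  preceding slots, and these windows are disjoint for different reconfigurations.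

Summation over time gives `(1 - Δr / T - ρ) ∑ E W* ≤ ∑ E g(W*) + const * t`
(`Network.condMean_sqSum_add_le`). As `g` is sublinear, the network is strongly stable. If `g` is
concave and `‖L‖ ≤ N W*`, Jensen's inequality shows that the time average of `E ‖L‖` is
asymptotically a subsolution of the fixed point equation, and a concave function that is positive at
`0` and negative far out has one zero, beyond which it is negative
(`IsHysteresis.exists_fixedPoint`).

For a Markov policy, the previous schedule, the queue lengths and the number of lost slots ahead
form a Markov chain with finitely many transitions from each state, and the Lyapunov inequality from
an arbitrary history on yields a geometric drift of `exp (θ ‖L‖₂)` over a fixed number of slots.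
The chain may have several recurrent classes, but convergence of `E ‖L(t)‖` needs no classification
of states (`IsRandomStep.exists_tendsto_transOp_pow`). A slot without arrivals has positive
probability because `λ < 1` for each queue, and without arrivals each state ends up in a fixed
point. Hence a bounded family `H k`, `k ∈ ℤ`, that satisfies the evolution equation
`P (H k) = H (k + 1)` is constant in `k`: where an increment of `H` is nearly extremal, it stays so
for a long time at a fixed point, and the increments there would add up to more than the bound on
`H`. Applied to limits of the means along an ultrafilter, this shows that the limits are harmonic,
and uniform integrability then gives convergence. The limit equals that of the time averages, which
satisfies the bound.
-/

/-! ### Weights of schedules -/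

/-- Number of circuits of a schedule. -/
def schedSize {N : ℕ} (S : Schedule N) : ℕ := ∑ i, ∑ j, if S i j then 1 else 0

namespace Network

variable {N : ℕ} {net : Network N}

theorem weight_le_maxWeight {S : Schedule N} (hS : S ∈ net.feasible) (L : QMat N) :
    weight L S ≤ net.maxWeight L :=
  Finset.le_sup (f := weight L) hS

theorem weight_le_totalQueue (L : QMat N) (S : Schedule N) : weight L S ≤ totalQueue L := by
  unfold weight totalQueue
  gcongr with i _ j _
  split_ifs <;> simp

theorem maxWeight_le_totalQueue (net : Network N) (L : QMat N) :
    net.maxWeight L ≤ totalQueue L :=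
  Finset.sup_le fun S _ => weight_le_totalQueue L S

theorem le_weight {L : QMat N} {S : Schedule N} {i j : Fin N} (h : S i j = true) :
    L i j ≤ weight L S := by
  unfold weight
  calc L i j = if S i j then L i j else 0 := by simp [h]
    _ ≤ ∑ j, if S i j then L i j else 0 :=
        Finset.single_le_sum (f := fun j => if S i j then L i j else 0)
          (fun _ _ => Nat.zero_le _) (Finset.mem_univ j)
    _ ≤ _ := Finset.single_le_sum (f := fun i => ∑ j, if S i j then L i j else 0)
          (fun _ _ => Nat.zero_le _) (Finset.mem_univ i)

theorem le_totalQueue (L : QMat N) (i j : Fin N) : L i j ≤ totalQueue L :=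
  (le_weight (S := fun _ _ => true) rfl).trans (weight_le_totalQueue L _)

theorem weight_le_add {L L' : QMat N} {c : ℕ} (h : ∀ i j, L' i j ≤ L i j + c) (S : Schedule N) :
    weight L' S ≤ weight L S + schedSize S * c := by
  unfold weight schedSize
  simp only [Finset.sum_mul, ← Finset.sum_add_distrib]
  gcongr with i _ j _
  split_ifs
  · simpa using h i j
  · simp

theorem maxWeight_le_add {K : ℕ} (hK : ∀ S ∈ net.feasible, schedSize S ≤ K) {L L' : QMat N}
    {c : ℕ} (h : ∀ i j, L' i j ≤ L i j + c) : net.maxWeight L' ≤ net.maxWeight L + K * c := by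
  refine Finset.sup_le fun S hS => (weight_le_add h S).trans ?_
  gcongr
  · exact weight_le_maxWeight hS L
  · exact hK S hS

theorem schedSize_le_sq (S : Schedule N) : schedSize S ≤ N ^ 2 := by
  calc schedSize S ≤ ∑ _i : Fin N, ∑ _j : Fin N, 1 := by
        unfold schedSize
        gcongr with i _ j _
        split_ifs <;> simp
    _ = N ^ 2 := by simp [sq]

theorem Crossbar.schedSize_le (h : net.Crossbar) {S : Schedule N} (hS : S ∈ net.feasible) :
    schedSize S ≤ N := by
  calc schedSize S ≤ ∑ _i : Fin N, 1 := by
        unfold schedSize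
        refine Finset.sum_le_sum fun i _ => ?_
        rw [Finset.sum_ite, Finset.sum_const_zero, add_zero, Finset.sum_const, smul_eq_mul,
          mul_one, Finset.card_le_one]
        intro j hj j' hj'
        exact (h S hS).1 i j j' (by simpa using hj) (by simpa using hj')
    _ = N := by simp

theorem Covering.totalQueue_le (h : net.Covering) {L : QMat N} (hL : ∀ i, L i i = 0) :
    totalQueue L ≤ N * net.maxWeight L := by
  obtain ⟨s, hs, hcov⟩ := h
  calc totalQueue L ≤ ∑ i, ∑ j, ∑ k, if s k i j then L i j else 0 := by
        unfold totalQueue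
        refine Finset.sum_le_sum fun i _ => Finset.sum_le_sum fun j _ => ?_
        rcases eq_or_ne i j with rfl | hij
        · simp [hL]
        · obtain ⟨k, hk⟩ := hcov i j hij
          calc L i j = if s k i j then L i j else 0 := by simp [hk]
            _ ≤ _ := Finset.single_le_sum (f := fun k => if s k i j then L i j else 0)
              (fun _ _ => Nat.zero_le _) (Finset.mem_univ k)
    _ = ∑ k, weight L (s k) := by
        unfold weight
        rw [Finset.sum_comm]
        conv_rhs => rw [Finset.sum_comm]
        rw [Finset.sum_comm]
        exact Finset.sum_congr rfl fun i _ => Finset.sum_comm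
    _ ≤ ∑ _k : Fin N, net.maxWeight L :=
        Finset.sum_le_sum fun k _ => weight_le_maxWeight (hs k) L
    _ = N * net.maxWeight L := by simp

/-! ### Evolution of the queues along one sample path -/

theorem departures_le_one (S : ℕ → Schedule N) (t : ℕ) (L : QMat N) (i j : Fin N) :
    net.departures S t L i j ≤ 1 := by
  unfold departures
  split_ifs <;> simp

theorem departures_le (S : ℕ → Schedule N) (t : ℕ) (L : QMat N) (i j : Fin N) :
    net.departures S t L i j ≤ L i j := by
  unfold departures
  split_ifs with h1 h2
  · simp
  · exact h2.2
  · simp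

theorem departures_le_ite (S : ℕ → Schedule N) (t : ℕ) (L : QMat N) (i j : Fin N) :
    net.departures S t L i j ≤ if S t i j then 1 else 0 := by
  unfold departures
  split_ifs with h1 h2 <;> simp_all

theorem sum_departures_le (S : ℕ → Schedule N) (t : ℕ) (L : QMat N) :
    ∑ i, ∑ j, net.departures S t L i j ≤ schedSize (S t) :=
  Finset.sum_le_sum fun _ _ => Finset.sum_le_sum fun _ _ => departures_le_ite ..

theorem mul_departures {S : ℕ → Schedule N} {t : ℕ} (h : ¬ net.InDelay S t) (L : QMat N)
    (i j : Fin N) : L i j * net.departures S t L i j = if S t i j then L i j else 0 := by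
  unfold departures
  rw [if_neg h]
  rcases Nat.eq_zero_or_pos (L i j) with h0 | h0
  · simp [h0]
  · by_cases hS : S t i j = true <;> simp [hS, h0]

variable {a : ℕ → QMat N} {S : ℕ → Schedule N} {Amax : ℕ}

theorem queue_diag (ha : ∀ t i, a t i i = 0) (t : ℕ) (i : Fin N) : net.queue a S t i i = 0 := by
  induction t with
  | zero => exact net.queue0_diag i
  | succ t ih => simp [queue, ih, ha]

theorem queue_le_add (ha : ∀ t i j, a t i j ≤ Amax) {s t : ℕ} (hst : s ≤ t) (i j : Fin N) :
    net.queue a S t i j ≤ net.queue a S s i j + Amax * (t - s) := by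
  induction t, hst using Nat.le_induction with
  | base => simp
  | succ t hst ih =>
    have h1 : net.queue a S (t + 1) i j ≤ net.queue a S t i j + a t i j := by
      simp only [queue]; omega
    have h2 := ha t i j
    rw [Nat.succ_sub hst, Nat.mul_succ]
    omega

theorem le_queue_add {s t : ℕ} (hst : s ≤ t) (i j : Fin N) :
    net.queue a S s i j ≤ net.queue a S t i j + (t - s) := by
  induction t, hst using Nat.le_induction with
  | base => simp
  | succ t hst ih =>
    have h1 : net.queue a S t i j ≤ net.queue a S (t + 1) i j + 1 := by
      have := departures_le_one (net := net) S t (net.queue a S t) i j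
      simp only [queue]; omega
    omega

namespace Policy

variable {π : net.Policy} {g : ℝ → ℝ} {G : ℝ}

theorem run_mem (π : net.Policy) (a : ℕ → QMat N) (t : ℕ) : π.run a t ∈ net.feasible := by
  induction t using Nat.strong_induction_on with
  | _ t ih =>
    rw [run_eq]
    exact π.mem t a _ ih

theorem next_run_mem (π σ : net.Policy) (a : ℕ → QMat N) (t : ℕ) :
    π.next t a (σ.run a) ∈ net.feasible :=
  π.mem t a _ fun τ _ => run_mem σ a τ

theorem run_congr (π : net.Policy) {a a' : ℕ → QMat N} {t : ℕ} (h : ∀ τ ≤ t, a τ = a' τ) :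
    π.run a t = π.run a' t := by
  induction t using Nat.strong_induction_on with
  | _ t ih =>
    rw [run_eq, run_eq]
    exact π.causal t a a' _ _ h fun τ hτ => ih τ hτ fun τ' hτ' => h τ' (by omega)

theorem queue_run_congr (π : net.Policy) {a a' : ℕ → QMat N} {t : ℕ} (h : ∀ τ < t, a τ = a' τ) :
    net.queue a (π.run a) t = net.queue a' (π.run a') t :=
  net.queue_congr h fun τ hτ => run_congr π fun τ' hτ' => h τ' (by omega)

theorem NearMaxWeight.nonneg {σ : net.Policy} (h : π.NearMaxWeight σ Amax G) : 0 ≤ G := by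
  have h1 := h (fun _ _ _ => 0) (by simp) (by simp) 0
  have h2 : (weight (net.queue (fun _ _ _ => 0) (σ.run fun _ _ _ => 0) 0)
      (π.next 0 (fun _ _ _ => 0) (σ.run fun _ _ _ => 0)) : ℝ) ≤
      net.maxWeight (net.queue (fun _ _ _ => 0) (σ.run fun _ _ _ => 0) 0) := by
    exact_mod_cast weight_le_maxWeight (next_run_mem π σ _ 0) _
  linarith

open Classical in
theorem adaptive_run (π : net.Policy) (g : ℝ → ℝ) (a : ℕ → QMat N) (t : ℕ) :
    (π.adaptive g).run a t =
      if (weight (net.queue a ((π.adaptive g).run a) t)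
            (π.next t a ((π.adaptive g).run a)) : ℝ)
          - weight (net.queue a ((π.adaptive g).run a) t)
            (net.prevSched ((π.adaptive g).run a) t)
          ≤ g (weight (net.queue a ((π.adaptive g).run a) t)
            (π.next t a ((π.adaptive g).run a)))
      then net.prevSched ((π.adaptive g).run a) t
      else π.next t a ((π.adaptive g).run a) := by
  conv_lhs => rw [run_eq]
  rfl

/-- The adaptive variant loses at most `G + g (W*)` of the maximum weight. -/
theorem maxWeight_le_weight_adaptive_run (hg : IsHysteresis g)
    (hπ : π.NearMaxWeight (π.adaptive g) Amax G)
    (ha : ∀ t i j, a t i j ≤ Amax) (hd : ∀ t i, a t i i = 0) (t : ℕ) :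
    (net.maxWeight (net.queue a ((π.adaptive g).run a) t) : ℝ) ≤
      weight (net.queue a ((π.adaptive g).run a) t) ((π.adaptive g).run a t) + G +
        g (net.maxWeight (net.queue a ((π.adaptive g).run a) t)) := by
  have h1 := hπ a ha hd t
  have h2 := adaptive_run π g a t
  set S := (π.adaptive g).run a
  set L := net.queue a S t
  have h3 : (weight L (π.next t a S) : ℝ) ≤ net.maxWeight L := by
    exact_mod_cast weight_le_maxWeight (next_run_mem π _ a t) L
  have h4 : g (weight L (π.next t a S)) ≤ g (net.maxWeight L) :=
    hg.mono.monotoneOn (Set.mem_Ici.2 (Nat.cast_nonneg _)) (Set.mem_Ici.2 (Nat.cast_nonneg _)) h3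
  have h5 := hg.nonneg (weight L (π.next t a S)) (Nat.cast_nonneg _)
  split_ifs at h2 with h
  · rw [h2]; linarith
  · rw [h2]; linarith

/-- A reconfiguration adopts the proposed schedule, whose weight beats that of the old one by more
than the hysteresis. -/
theorem adaptive_run_of_ne (h : (π.adaptive g).run a t ≠ net.prevSched ((π.adaptive g).run a) t) :
    (π.adaptive g).run a t = π.next t a ((π.adaptive g).run a) ∧
    g (weight (net.queue a ((π.adaptive g).run a) t) ((π.adaptive g).run a t)) <
      weight (net.queue a ((π.adaptive g).run a) t) ((π.adaptive g).run a t) -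
      (weight (net.queue a ((π.adaptive g).run a) t)
        (net.prevSched ((π.adaptive g).run a) t) : ℝ) := by
  have h2 := adaptive_run π g a t
  split_ifs at h2 with h3
  · exact absurd h2 h
  · rw [h2]
    exact ⟨rfl, not_le.1 h3⟩

end Policy

end Network

theorem IsHysteresis.le_hystInv {g : ℝ → ℝ} (hg : IsHysteresis g) {x y : ℝ} (hx : 0 ≤ x)
    (h : g x ≤ y) : x ≤ hystInv g y := by
  refine le_csInf ?_ fun z hz => ?_
  · obtain ⟨z, hz⟩ := ((hg.unbounded.eventually_ge_atTop y).and (eventually_ge_atTop 0)).exists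
    exact ⟨z, hz.2, hz.1⟩
  · by_contra! hlt
    exact absurd (hg.mono hz.1 hx hlt) (not_lt.2 (h.trans hz.2))

theorem hystInv_nonneg (g : ℝ → ℝ) (y : ℝ) : 0 ≤ hystInv g y :=
  Real.sInf_nonneg fun _ hx => hx.1

/-- A hysteresis function is bounded by an affine function of arbitrarily small slope. -/
theorem IsHysteresis.exists_le_affine {g : ℝ → ℝ} (hg : IsHysteresis g) {ε : ℝ} (hε : 0 < ε) :
    ∃ C, 0 ≤ C ∧ ∀ x, 0 ≤ x → g x ≤ ε * x + C := by
  obtain ⟨b, hb⟩ := eventually_atTop.1 (hg.sublinear.eventually_lt_const hε)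
  have hb0 : (0 : ℝ) ≤ max b 1 := le_max_of_le_right zero_le_one
  refine ⟨g (max b 1), hg.nonneg _ hb0, fun x hx => ?_⟩
  rcases le_total (max b 1) x with h | h
  · have h1 := hb x ((le_max_left _ _).trans h)
    have hx : 0 < x := lt_of_lt_of_le one_pos ((le_max_right _ _).trans h)
    rw [div_lt_iff₀ hx] at h1
    linarith [hg.nonneg _ hb0]
  · have := hg.mono.monotoneOn (Set.mem_Ici.2 hx) (Set.mem_Ici.2 hb0) h
    nlinarith

/-! ### The price of reconfigurations -/

namespace Network

variable {N : ℕ} {net : Network N} {S : ℕ → Schedule N}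

open Classical in
/-- The last reconfiguration up to time `t` (`0` if there is none). -/
noncomputable def lastReconf (net : Network N) (S : ℕ → Schedule N) (t : ℕ) : ℕ :=
  Nat.findGreatest (fun s => S s ≠ net.prevSched S s) t

theorem lastReconf_le (S : ℕ → Schedule N) (t : ℕ) : net.lastReconf S t ≤ t :=
  Nat.findGreatest_le _

theorem InDelay.lastReconf_ne {t : ℕ} (h : net.InDelay S t) :
    S (net.lastReconf S t) ≠ net.prevSched S (net.lastReconf S t) := by
  classical
  obtain ⟨s, hs, -, hne⟩ := h
  exact Nat.findGreatest_spec (P := fun s => S s ≠ net.prevSched S s) hs hne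

theorem InDelay.lt_lastReconf_add {t : ℕ} (h : net.InDelay S t) :
    t < net.lastReconf S t + net.delay := by
  classical
  obtain ⟨s, hs, hlt, hne⟩ := h
  have : s ≤ net.lastReconf S t :=
    Nat.le_findGreatest (P := fun s => S s ≠ net.prevSched S s) hs hne
  omega

theorem sched_eq_of_no_reconf {s t : ℕ} (hst : s ≤ t)
    (h : ∀ r, s < r → r ≤ t → S r = net.prevSched S r) : S t = S s := by
  induction t, hst using Nat.le_induction with
  | base => rfl
  | succ t hst ih =>
    rw [h (t + 1) (by omega) le_rfl]
    exact ih fun r hr hrt => h r hr (by omega)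

theorem sched_lastReconf (S : ℕ → Schedule N) (t : ℕ) : S t = S (net.lastReconf S t) := by
  classical
  refine sched_eq_of_no_reconf (net := net) (lastReconf_le S t) fun r hr hrt => ?_
  by_contra hne
  exact absurd (Nat.le_findGreatest (P := fun s => S s ≠ net.prevSched S s) hrt hne)
    (not_le.2 hr)

/-- Slot `t` is lost through a reconfiguration, at time `s` say, that none precedes in the `n - 1`
slots before `s`, and `r` is one of the slots `s - n + 1, …, s`. -/
def InWindow (net : Network N) (S : ℕ → Schedule N) (n t r : ℕ) : Prop :=
  net.InDelay S t ∧ net.lastReconf S t < r + n ∧ r ≤ net.lastReconf S t ∧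
    ∀ s, net.lastReconf S t < s + n → s < net.lastReconf S t → S s = net.prevSched S s

/-- A slot lies in the windows of at most `delay` lost slots, because it is in the window of at
most one reconfiguration. -/
theorem card_inWindow_le (S : ℕ → Schedule N) (n r : ℕ) (I : Finset ℕ)
    [DecidablePred fun t => net.InWindow S n t r] :
    (I.filter fun t => net.InWindow S n t r).card ≤ net.delay := by
  rcases (I.filter fun t => net.InWindow S n t r).eq_empty_or_nonempty with h0 | ⟨t₀, ht₀⟩
  · simp [h0]
  · obtain ⟨hd₀, h1₀, h2₀, h3₀⟩ := (Finset.mem_filter.1 ht₀).2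
    have : (I.filter fun t => net.InWindow S n t r) ⊆
        Finset.Ico (net.lastReconf S t₀) (net.lastReconf S t₀ + net.delay) := by
      intro t ht
      obtain ⟨hd, h1, h2, h3⟩ := (Finset.mem_filter.1 ht).2
      have heq : net.lastReconf S t = net.lastReconf S t₀ := by
        rcases lt_trichotomy (net.lastReconf S t) (net.lastReconf S t₀) with hlt | heq | hlt
        · exact absurd (h3₀ _ (by omega) hlt) hd.lastReconf_ne
        · exact heq
        · exact absurd (h3 _ (by omega) hlt) hd₀.lastReconf_ne
      rw [Finset.mem_Ico, ← heq]
      exact ⟨lastReconf_le S t, hd.lt_lastReconf_add⟩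
    simpa using Finset.card_le_card this

variable {a : ℕ → QMat N} {π : net.Policy} {g : ℝ → ℝ} {Amax K : ℕ} {G : ℝ}

/-- Two reconfigurations in quick succession are only possible if the weights are small, since the
hysteresis has to be overcome by what arrived and departed in between. -/
theorem weight_le_of_reconf_twice (hg : IsHysteresis g)
    (hπ : π.NearMaxWeight (π.adaptive g) Amax G)
    (ha : ∀ t i j, a t i j ≤ Amax) (hd : ∀ t i, a t i i = 0)
    (hK : ∀ S ∈ net.feasible, schedSize S ≤ K) {T : ℝ} {r s : ℕ} (hrs : r < s)
    (hT : (s : ℝ) - r ≤ T)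
    (hr : (π.adaptive g).run a r ≠ net.prevSched ((π.adaptive g).run a) r)
    (hs : (π.adaptive g).run a s ≠ net.prevSched ((π.adaptive g).run a) s) :
    (weight (net.queue a ((π.adaptive g).run a) s) ((π.adaptive g).run a s) : ℝ) ≤
      hystInv g (G + K * (Amax + 1) * T) := by
  classical
  -- Replace `r` by the last reconfiguration before `s`.
  obtain ⟨r, hrs, hT, hr, hno⟩ : ∃ r, r < s ∧ (s : ℝ) - r ≤ T ∧
      (π.adaptive g).run a r ≠ net.prevSched ((π.adaptive g).run a) r ∧
      ∀ q, r < q → q < s → (π.adaptive g).run a q = net.prevSched ((π.adaptive g).run a) q := by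
    set P := fun q => (π.adaptive g).run a q ≠ net.prevSched ((π.adaptive g).run a) q
    have h1 : r ≤ Nat.findGreatest P (s - 1) := Nat.le_findGreatest (by omega) hr
    have h2 : Nat.findGreatest P (s - 1) ≤ s - 1 := Nat.findGreatest_le _
    refine ⟨Nat.findGreatest P (s - 1), by omega, ?_,
      Nat.findGreatest_spec (P := P) (m := r) (by omega) hr, fun q hq hqs => ?_⟩
    · have : (r : ℝ) ≤ Nat.findGreatest P (s - 1) := by exact_mod_cast h1
      linarith
    · by_contra hne
      exact absurd (Nat.le_findGreatest (P := P) (show q ≤ s - 1 by omega) hne) (not_le.2 hq)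
  have hSr := Policy.adaptive_run_of_ne hr
  have hSs := (Policy.adaptive_run_of_ne hs).2
  have hnear := hπ a ha hd r
  rw [← hSr.1] at hnear
  set S := (π.adaptive g).run a with hSdef
  obtain ⟨u, rfl⟩ : ∃ u, s = u + 1 := ⟨s - 1, by omega⟩
  have hprev : net.prevSched S (u + 1) = S r :=
    sched_eq_of_no_reconf (net := net) (S := S) (show r ≤ u by omega)
      fun q hq hqu => hno q hq (by omega)
  rw [hprev] at hSs
  have hmem := Policy.run_mem (π.adaptive g) a
  have hup : (net.maxWeight (net.queue a S (u + 1)) : ℝ) ≤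
      net.maxWeight (net.queue a S r) + K * (Amax * ((u + 1 : ℕ) - r : ℝ)) := by
    have := maxWeight_le_add (net := net) hK (queue_le_add (S := S) (net := net) ha hrs.le)
    have h2 : ((u + 1 - r : ℕ) : ℝ) = ((u + 1 : ℕ) : ℝ) - r := by
      rw [Nat.cast_sub hrs.le]
    rw [← h2]
    exact_mod_cast this
  have hlow : (weight (net.queue a S r) (S r) : ℝ) ≤
      weight (net.queue a S (u + 1)) (S r) + K * ((u + 1 : ℕ) - r : ℝ) := by
    have := weight_le_add (le_queue_add (net := net) (a := a) (S := S) hrs.le) (S r)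
    have h2 : ((u + 1 - r : ℕ) : ℝ) = ((u + 1 : ℕ) : ℝ) - r := by
      rw [Nat.cast_sub hrs.le]
    rw [← h2]
    exact_mod_cast this.trans (by gcongr; exact hK _ (hmem r))
  have hle : (weight (net.queue a S (u + 1)) (S (u + 1)) : ℝ) ≤
      net.maxWeight (net.queue a S (u + 1)) := by
    exact_mod_cast weight_le_maxWeight (hmem (u + 1)) _
  refine hg.le_hystInv (Nat.cast_nonneg _) (hSs.le.trans ?_)
  have : (K : ℝ) * (Amax + 1) * ((u + 1 : ℕ) - r : ℝ) ≤ K * (Amax + 1) * T := by gcongr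
  nlinarith

open Classical in
/-- Backlog that cannot be served in a lost slot: bounded, up to a constant, by the average of the
maximum weights over the window of the reconfiguration. -/
theorem weight_le_of_inDelay (hg : IsHysteresis g)
    (hπ : π.NearMaxWeight (π.adaptive g) Amax G)
    (ha : ∀ t i j, a t i j ≤ Amax) (hd : ∀ t i, a t i i = 0)
    (hK : ∀ S ∈ net.feasible, schedSize S ≤ K) {T : ℝ} {n : ℕ} (hT : 0 ≤ T)
    (hnT : (n : ℝ) - 1 ≤ T) {k m t : ℕ} (hkt : k + n + net.delay ≤ t) (htm : t < m)
    (ht : net.InDelay ((π.adaptive g).run a) t) :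
    (n : ℝ) * weight (net.queue a ((π.adaptive g).run a) t) ((π.adaptive g).run a t) ≤
      n * (hystInv g (G + K * (Amax + 1) * T) + K * Amax * T + K * Amax * net.delay) +
      ∑ r ∈ Finset.Ico k m, if net.InWindow ((π.adaptive g).run a) n t r
        then (net.maxWeight (net.queue a ((π.adaptive g).run a) r) : ℝ) else 0 := by
  have hne := ht.lastReconf_ne
  have hlt := ht.lt_lastReconf_add
  have hle := lastReconf_le (net := net) ((π.adaptive g).run a) t
  have htwice := fun r hrs hT => weight_le_of_reconf_twice (r := r)
    (s := net.lastReconf ((π.adaptive g).run a) t) hg hπ ha hd hK (T := T) hrs hT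
  set S := (π.adaptive g).run a with hSdef
  have hs : S t = S (net.lastReconf S t) := sched_lastReconf (net := net) S t
  have hsum0 : ∀ r ∈ Finset.Ico k m, (0 : ℝ) ≤ if net.InWindow S n t r
      then (net.maxWeight (net.queue a S r) : ℝ) else 0 := fun r _ => by positivity
  have hI : ∀ r, net.InWindow S n t r ↔ net.lastReconf S t < r + n ∧ r ≤ net.lastReconf S t ∧
    ∀ s, net.lastReconf S t < s + n → s < net.lastReconf S t → S s = net.prevSched S s :=
    fun r => ⟨fun h => h.2, fun h => ⟨ht, h⟩⟩
  set s := net.lastReconf S t with hsdef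
  have hmem := Policy.run_mem (π.adaptive g) a s
  have hinv := hystInv_nonneg g (G + K * (Amax + 1) * T)
  have h1 : (weight (net.queue a S t) (S t) : ℝ) ≤
      weight (net.queue a S s) (S s) + K * Amax * net.delay := by
    have h := weight_le_add (queue_le_add (net := net) (S := S) ha hle) (S s)
    have h2 : schedSize (S s) * (Amax * (t - s)) ≤ K * (Amax * net.delay) := by
      gcongr
      · exact hK _ hmem
      · omega
    rw [hs, mul_assoc]
    exact_mod_cast h.trans (by omega)
  have hKT : 0 ≤ (K : ℝ) * Amax * T := by positivity
  by_cases hshort : ∃ r, s < r + n ∧ r < s ∧ S r ≠ net.prevSched S r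
  · obtain ⟨r, hrn, hrs, hr⟩ := hshort
    have h2 := htwice r hrs (by
      have : (s : ℝ) + 1 ≤ r + n := by exact_mod_cast hrn
      linarith) hr hne
    have h3 := Finset.sum_nonneg hsum0
    have : (n : ℝ) * weight (net.queue a S t) (S t) ≤ n *
        (hystInv g (G + K * (Amax + 1) * T) + K * Amax * T + K * Amax * net.delay) := by
      gcongr
      linarith
    linarith
  · have hlong : ∀ r, s < r + n → r < s → S r = net.prevSched S r := fun r h h' => by
      by_contra hc
      exact hshort ⟨r, h, h', hc⟩
    -- The window consists of the `n` slots `s + 1 - n, …, s`.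
    have hwin : ∀ r ∈ Finset.Ico (s + 1 - n) (s + 1),
        (weight (net.queue a S s) (S s) : ℝ) - K * Amax * T ≤
          if net.InWindow S n t r then (net.maxWeight (net.queue a S r) : ℝ) else 0 := by
      intro r hr
      rw [Finset.mem_Ico] at hr
      rw [if_pos ((hI r).2 ⟨by omega, by omega, hlong⟩)]
      have h := maxWeight_le_add (net := net) hK
        (queue_le_add (net := net) (S := S) ha (show r ≤ s by omega))
      have h' := (weight_le_maxWeight hmem (net.queue a S s)).trans h
      have h2 : ((s - r : ℕ) : ℝ) ≤ T := by
        have : s - r + 1 ≤ n := by omega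
        have : ((s - r : ℕ) : ℝ) + 1 ≤ n := by exact_mod_cast this
        linarith
      have h3 : (weight (net.queue a S s) (S s) : ℝ) ≤
          net.maxWeight (net.queue a S r) + K * Amax * (s - r : ℕ) := by
        rw [mul_assoc]; exact_mod_cast h'
      have h4 : (K : ℝ) * Amax * (s - r : ℕ) ≤ K * Amax * T := by gcongr
      linarith
    have h5 := Finset.card_nsmul_le_sum _ _ _ hwin
    have h6 := Finset.sum_le_sum_of_subset_of_nonneg
      (show Finset.Ico (s + 1 - n) (s + 1) ⊆ Finset.Ico k m from
        Finset.Ico_subset_Ico (by omega) (by omega)) fun r hr _ => hsum0 r hr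
    rw [Nat.card_Ico, nsmul_eq_mul, show s + 1 - (s + 1 - n) = n by omega] at h5
    have h7 : (n : ℝ) * weight (net.queue a S t) (S t) ≤
        n * (weight (net.queue a S s) (S s) + K * Amax * net.delay) := by gcongr
    have h8 : 0 ≤ (n : ℝ) * hystInv g (G + K * (Amax + 1) * T) := by positivity
    nlinarith

open Classical in
/-- Over a long time, the lost slots cost at most a fraction `delay / n` of the maximum weights,
up to terms that do not grow with the weights. -/
theorem sum_weight_inDelay_le (hg : IsHysteresis g)
    (hπ : π.NearMaxWeight (π.adaptive g) Amax G)
    (ha : ∀ t i j, a t i j ≤ Amax) (hd : ∀ t i, a t i i = 0)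
    (hK : ∀ S ∈ net.feasible, schedSize S ≤ K) {T : ℝ} {n : ℕ} (hT : 0 ≤ T) (hn : 0 < n)
    (hnT : (n : ℝ) - 1 ≤ T) (k t : ℕ) :
    ∑ τ ∈ Finset.Ico k (k + t), (if net.InDelay ((π.adaptive g).run a) τ then
        (weight (net.queue a ((π.adaptive g).run a) τ) ((π.adaptive g).run a τ) : ℝ) else 0) ≤
      t * (hystInv g (G + K * (Amax + 1) * T) + K * Amax * T + K * Amax * net.delay) +
      net.delay / n * ∑ τ ∈ Finset.Ico k (k + t),
        (net.maxWeight (net.queue a ((π.adaptive g).run a) τ) : ℝ) +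
      (n + net.delay) * (net.maxWeight (net.queue a ((π.adaptive g).run a) k) +
        K * Amax * (n + net.delay)) := by
  have hcost := fun τ => weight_le_of_inDelay (k := k) (m := k + t) (t := τ) hg hπ ha hd hK hT hnT
  have hmem := Policy.run_mem (π.adaptive g) a
  set S := (π.adaptive g).run a with hSdef
  set C := hystInv g (G + K * (Amax + 1) * T) + K * Amax * T + K * Amax * net.delay with hC
  have hC0 : 0 ≤ C := by
    have := hystInv_nonneg g (G + K * (Amax + 1) * T)
    positivity
  set W : ℕ → ℝ := fun τ => net.maxWeight (net.queue a S τ) with hW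
  have hW0 : ∀ τ, 0 ≤ W τ := fun τ => Nat.cast_nonneg _
  set B : ℝ := W k + K * Amax * (n + net.delay) with hB
  have hB0 : 0 ≤ B := by have := hW0 k; positivity
  have hn' : (0 : ℝ) < n := by exact_mod_cast hn
  have hpt : ∀ τ ∈ Finset.Ico k (k + t), (if net.InDelay S τ then
      (weight (net.queue a S τ) (S τ) : ℝ) else 0) ≤
      C + (if τ < k + (n + net.delay) then B else 0) +
      (∑ r ∈ Finset.Ico k (k + t), if net.InWindow S n τ r then W r else 0) / n := by
    intro τ hτ
    rw [Finset.mem_Ico] at hτ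
    have hs0 : 0 ≤ (∑ r ∈ Finset.Ico k (k + t), if net.InWindow S n τ r then W r else 0) / n :=
      div_nonneg (Finset.sum_nonneg fun r _ => by split_ifs <;> simp [hW0]) hn'.le
    by_cases hdel : net.InDelay S τ
    · rw [if_pos hdel]
      split_ifs with hτk
      · have h1 := (weight_le_maxWeight (hmem τ) (net.queue a S τ)).trans
          (maxWeight_le_add (net := net) hK (queue_le_add (net := net) (S := S) ha hτ.1))
        have h2 : (weight (net.queue a S τ) (S τ) : ℝ) ≤ W k + K * Amax * (τ - k : ℕ) := by
          rw [mul_assoc]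
          simp only [hW]
          exact_mod_cast h1
        have h3 : ((τ - k : ℕ) : ℝ) ≤ n + net.delay := by
          exact_mod_cast (show τ - k ≤ n + net.delay by omega)
        have h4 : (K : ℝ) * Amax * (τ - k : ℕ) ≤ K * Amax * (n + net.delay) := by gcongr
        linarith
      · have h1 := hcost τ (by omega) hτ.2 hdel
        rw [add_zero, ← sub_le_iff_le_add', le_div_iff₀ hn']
        linarith
    · rw [if_neg hdel]
      have : (0 : ℝ) ≤ if τ < k + (n + net.delay) then B else 0 := by split_ifs <;> simp [hB0]
      linarith
  refine (Finset.sum_le_sum hpt).trans ?_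
  rw [Finset.sum_add_distrib, Finset.sum_add_distrib, Finset.sum_const, Nat.card_Ico,
    nsmul_eq_mul, add_tsub_cancel_left]
  have h1 : ∑ τ ∈ Finset.Ico k (k + t), (if τ < k + (n + net.delay) then B else 0) ≤
      (n + net.delay) * B := by
    rw [← Finset.sum_filter, Finset.sum_const, nsmul_eq_mul]
    gcongr
    have : (Finset.Ico k (k + t)).filter (fun τ => τ < k + (n + net.delay)) ⊆
        Finset.Ico k (k + (n + net.delay)) := fun τ hτ => by
      simp only [Finset.mem_filter, Finset.mem_Ico] at hτ ⊢; omega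
    have := Finset.card_le_card this
    rw [Nat.card_Ico, add_tsub_cancel_left] at this
    exact_mod_cast this
  have h2 : ∑ τ ∈ Finset.Ico k (k + t),
      (∑ r ∈ Finset.Ico k (k + t), if net.InWindow S n τ r then W r else 0) / n ≤
      net.delay / n * ∑ τ ∈ Finset.Ico k (k + t), W τ := by
    rw [← Finset.sum_div, Finset.sum_comm, div_mul_eq_mul_div, Finset.mul_sum]
    gcongr with r _
    rw [← Finset.sum_filter, Finset.sum_const, nsmul_eq_mul]
    exact mul_le_mul_of_nonneg_right (by exact_mod_cast card_inWindow_le S n r _) (hW0 r)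
  linarith

/-! ### Drift of the sum of squares -/

/-- Sum of the squares of the queue lengths. -/
noncomputable def sqSum (L : QMat N) : ℝ := ∑ i, ∑ j, (L i j : ℝ) ^ 2

theorem sqSum_nonneg (L : QMat N) : 0 ≤ sqSum L :=
  Finset.sum_nonneg fun _ _ => Finset.sum_nonneg fun _ _ => sq_nonneg _

open Classical in
theorem sqSum_queue_succ_le (ha : ∀ t i j, a t i j ≤ Amax) (hS : ∀ t, S t ∈ net.feasible)
    (hK : ∀ S ∈ net.feasible, schedSize S ≤ K) (t : ℕ) :
    sqSum (net.queue a S (t + 1)) ≤ sqSum (net.queue a S t) +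
      2 * ∑ i, ∑ j, (net.queue a S t i j * a t i j : ℝ) -
      2 * (weight (net.queue a S t) (S t) -
        if net.InDelay S t then (weight (net.queue a S t) (S t) : ℝ) else 0) +
      (N ^ 2 * Amax ^ 2 + K) := by
  set L := net.queue a S t with hL
  set D := net.departures S t L with hD
  have h1 : ∀ i j, ((net.queue a S (t + 1) i j : ℕ) : ℝ) = L i j - D i j + a t i j := by
    intro i j
    have := departures_le (net := net) S t L i j
    rw [← Nat.cast_sub this]
    norm_cast
  have h2 : ∀ i j, ((net.queue a S (t + 1) i j : ℕ) : ℝ) ^ 2 ≤ (L i j : ℝ) ^ 2 +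
      2 * (L i j * a t i j) - 2 * (L i j * D i j) + ((Amax : ℝ) ^ 2 + D i j) := by
    intro i j
    rw [h1]
    have hA : (a t i j : ℝ) ≤ Amax := by exact_mod_cast ha t i j
    have hA0 : (0 : ℝ) ≤ a t i j := Nat.cast_nonneg _
    have hAA : (a t i j : ℝ) ^ 2 ≤ (Amax : ℝ) ^ 2 := by gcongr
    have hDD : (D i j : ℝ) = 0 ∨ (D i j : ℝ) = 1 := by
      have := departures_le_one (net := net) S t L i j
      rw [← hD] at this
      rcases Nat.le_one_iff_eq_zero_or_eq_one.1 this with h | h <;> simp [h]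
    rcases hDD with h | h <;> rw [h] <;> nlinarith
  have h3 : ∑ i, ∑ j, (L i j * D i j : ℝ) = weight L (S t) -
      if net.InDelay S t then (weight L (S t) : ℝ) else 0 := by
    split_ifs with hdel
    · rw [sub_self]
      refine Finset.sum_eq_zero fun i _ => Finset.sum_eq_zero fun j _ => ?_
      simp [hD, departures, hdel]
    · have := fun i j => mul_departures hdel L i j
      rw [sub_zero]
      unfold weight
      push_cast
      refine Finset.sum_congr rfl fun i _ => Finset.sum_congr rfl fun j _ => ?_
      exact_mod_cast this i j
  have h4 : ∑ i, ∑ j, (D i j : ℝ) ≤ K := by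
    exact_mod_cast (sum_departures_le (net := net) S t L).trans (hK _ (hS t))
  calc sqSum (net.queue a S (t + 1)) ≤ ∑ i, ∑ j, ((L i j : ℝ) ^ 2 +
      2 * (L i j * a t i j) - 2 * (L i j * D i j) + ((Amax : ℝ) ^ 2 + D i j)) :=
        Finset.sum_le_sum fun i _ => Finset.sum_le_sum fun j _ => h2 i j
    _ = sqSum L + 2 * ∑ i, ∑ j, (L i j * a t i j : ℝ) - 2 * ∑ i, ∑ j, (L i j * D i j : ℝ) +
        (N ^ 2 * Amax ^ 2 + ∑ i, ∑ j, (D i j : ℝ)) := by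
        simp only [Finset.sum_add_distrib, Finset.sum_sub_distrib, Finset.mul_sum, sqSum]
        simp
        ring
    _ ≤ _ := by rw [h3]; linarith

/-- Lyapunov inequality along one sample path, from time `k` on. -/
theorem sqSum_queue_add_le (hg : IsHysteresis g)
    (hπ : π.NearMaxWeight (π.adaptive g) Amax G)
    (ha : ∀ t i j, a t i j ≤ Amax) (hd : ∀ t i, a t i i = 0)
    (hK : ∀ S ∈ net.feasible, schedSize S ≤ K) {T : ℝ} {n : ℕ} (hT : 0 ≤ T) (hn : 0 < n)
    (hnT : (n : ℝ) - 1 ≤ T) (k t : ℕ) :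
    sqSum (net.queue a ((π.adaptive g).run a) (k + t)) / 2 +
      (1 - net.delay / n) * ∑ τ ∈ Finset.Ico k (k + t),
        (net.maxWeight (net.queue a ((π.adaptive g).run a) τ) : ℝ) ≤
      sqSum (net.queue a ((π.adaptive g).run a) k) / 2 +
      ∑ τ ∈ Finset.Ico k (k + t), ∑ i, ∑ j,
        (net.queue a ((π.adaptive g).run a) τ i j * a τ i j : ℝ) +
      ∑ τ ∈ Finset.Ico k (k + t), g (net.maxWeight (net.queue a ((π.adaptive g).run a) τ)) +
      t * (G + hystInv g (G + K * (Amax + 1) * T) + K * Amax * T + K * Amax * net.delay +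
        (N ^ 2 * Amax ^ 2 + K) / 2) +
      (n + net.delay) * (net.maxWeight (net.queue a ((π.adaptive g).run a) k) +
        K * Amax * (n + net.delay)) := by
  classical
  have hcost := sum_weight_inDelay_le (n := n) hg hπ ha hd hK hT hn hnT k t
  have hW := Policy.maxWeight_le_weight_adaptive_run hg hπ ha hd
  have hmem := Policy.run_mem (π.adaptive g) a
  set S := (π.adaptive g).run a with hSdef
  have hsum : ∀ t : ℕ, sqSum (net.queue a S (k + t)) / 2 ≤ sqSum (net.queue a S k) / 2 +
      ∑ τ ∈ Finset.Ico k (k + t), (∑ i, ∑ j, (net.queue a S τ i j * a τ i j : ℝ) -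
        net.maxWeight (net.queue a S τ) + G + g (net.maxWeight (net.queue a S τ)) +
        (if net.InDelay S τ then (weight (net.queue a S τ) (S τ) : ℝ) else 0) +
        (N ^ 2 * Amax ^ 2 + K) / 2) := by
    intro t
    induction t with
    | zero => simp
    | succ t ih =>
      have h1 := sqSum_queue_succ_le ha hmem hK (k + t)
      rw [← add_assoc, Finset.sum_Ico_succ_top (by omega)]
      have h2 := hW (k + t)
      linarith
  have h := hsum t
  simp only [Finset.sum_add_distrib, Finset.sum_sub_distrib, Finset.sum_const, Nat.card_Ico,
    add_tsub_cancel_left, nsmul_eq_mul] at h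
  linarith

end Network

/-! ### Functions of the first arrivals -/

section Traffic

variable {N : ℕ} {Ω : Type*} [MeasurableSpace Ω] {μ : Measure Ω} {A : ℕ → Ω → QMat N} {Amax : ℕ}

theorem IsTraffic.measurable_apply (hA : IsTraffic μ A) (t : ℕ) : Measurable (A t) :=
  measurable_pi_lambda _ fun i => measurable_pi_lambda _ fun j => hA.measurable t i j

theorem IsTraffic.measurable_of_dependsOn (hA : IsTraffic μ A) {β : Type*} [MeasurableSpace β]
    {f : (ℕ → QMat N) → β} {t : ℕ} (hf : DependsOn f (Set.Iio t)) :
    Measurable fun ω => f fun s => A s ω := by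
  have : Nonempty β := ⟨f 0⟩
  obtain ⟨h, rfl⟩ := dependsOn_iff_exists_comp.1 hf
  exact (Measurable.of_discrete (f := h)).comp
    (measurable_pi_lambda _ fun s => hA.measurable_apply s)

theorem exists_abs_le_of_dependsOn {f : (ℕ → QMat N) → ℝ} {t : ℕ}
    (hf : DependsOn f (Set.Iio t)) (Amax : ℕ) :
    ∃ C, ∀ a : ℕ → QMat N, (∀ s i j, a s i j ≤ Amax) → |f a| ≤ C := by
  obtain ⟨h, rfl⟩ := dependsOn_iff_exists_comp.1 hf
  have hfin : {x : Set.Iio t → QMat N | ∀ s, x s ∈ {y | ∀ i, y i ∈ {z | ∀ j, z j ∈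
      Set.Iic Amax}}}.Finite :=
    Set.Finite.pi' fun _ => Set.Finite.pi' fun _ => Set.Finite.pi' fun _ => Set.finite_Iic Amax
  obtain ⟨C, hC⟩ := (hfin.image fun x => |h x|).bddAbove
  exact ⟨C, fun a ha => hC ⟨_, fun s i j => ha s i j, rfl⟩⟩

theorem IsTraffic.integrable_of_dependsOn [IsProbabilityMeasure μ] (hA : IsTraffic μ A)
    (hbdd : ∀ᵐ ω ∂μ, ∀ t i j, A t ω i j ≤ Amax) {f : (ℕ → QMat N) → ℝ} {t : ℕ}
    (hf : DependsOn f (Set.Iio t)) : Integrable (fun ω => f fun s => A s ω) μ := by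
  obtain ⟨C, hC⟩ := exists_abs_le_of_dependsOn hf Amax
  refine Integrable.of_bound (hA.measurable_of_dependsOn hf).aestronglyMeasurable C ?_
  filter_upwards [hbdd] with ω hω
  exact hC _ hω

/-- The arrivals in slot `t` are independent of everything that earlier arrivals determine. -/
theorem IsTraffic.indepFun_of_dependsOn (hA : IsTraffic μ A) {β : Type*} [MeasurableSpace β]
    {f : (ℕ → QMat N) → β} {t : ℕ} (hf : DependsOn f (Set.Iio t)) :
    IndepFun (fun ω => f fun s => A s ω) (A t) μ := by
  have : Nonempty β := ⟨f 0⟩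
  obtain ⟨h, rfl⟩ := dependsOn_iff_exists_comp.1 hf
  have hind := hA.indep.indepFun_finset (Finset.range t ×ˢ Finset.univ) ({t} ×ˢ Finset.univ)
    (Finset.disjoint_left.2 fun p hp hp' => by
      simp only [Finset.mem_product, Finset.mem_range, Finset.mem_singleton] at hp hp'
      omega)
    fun p => hA.measurable p.1 p.2.1 p.2.2
  refine hind.comp
    (φ := fun x => h fun s i j => x ⟨(s, i, j), by simpa using Set.mem_Iio.1 s.2⟩)
    (ψ := fun x i j => x ⟨(t, i, j), by simp⟩) Measurable.of_discrete Measurable.of_discrete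

theorem IsTraffic.integral_arrival (hA : IsTraffic μ A) (t : ℕ) (i j : Fin N) :
    ∫ ω, (A t ω i j : ℝ) ∂μ = rate μ A i j :=
  ((hA.ident t i j).comp (u := fun n : ℕ => (n : ℝ)) Measurable.of_discrete).integral_eq

theorem IsTraffic.integral_mul_arrival (hA : IsTraffic μ A)
    {f : (ℕ → QMat N) → ℝ} {t : ℕ} (hf : DependsOn f (Set.Iio t)) (i j : Fin N) :
    ∫ ω, f (fun s => A s ω) * (A t ω i j : ℝ) ∂μ =
      (∫ ω, f (fun s => A s ω) ∂μ) * rate μ A i j := by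
  rw [← hA.integral_arrival t i j]
  have h := (hA.indepFun_of_dependsOn hf).comp (φ := id) (ψ := fun x : QMat N => (x i j : ℝ))
    measurable_id Measurable.of_discrete
  exact h.integral_fun_mul_eq_mul_integral (hA.measurable_of_dependsOn hf).aestronglyMeasurable
    (Measurable.of_discrete.comp (hA.measurable_apply t)).aestronglyMeasurable

end Traffic

/-- The arrivals `a` before time `k` and `b` from then on. -/
def splice {N : ℕ} (k : ℕ) (a b : ℕ → QMat N) : ℕ → QMat N := fun s => if s < k then a s else b s

theorem splice_zero {N : ℕ} (a b : ℕ → QMat N) : splice 0 a b = b := by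
  funext s; simp [splice]

theorem DependsOn.comp_splice {N : ℕ} {β : Type*} {f : (ℕ → QMat N) → β} {t : ℕ}
    (hf : DependsOn f (Set.Iio t)) (k : ℕ) (a : ℕ → QMat N) :
    DependsOn (fun b => f (splice k a b)) (Set.Iio t) := by
  intro b b' h
  refine hf fun s hs => ?_
  simp only [splice]
  split_ifs
  · rfl
  · exact h s hs

namespace Network

variable {N : ℕ} {net : Network N}

theorem dependsOn_comp_queue {β : Type*} (σ : net.Policy) (t : ℕ) (f : QMat N → β) :
    DependsOn (fun a => f (net.queue a (σ.run a) t)) (Set.Iio t) :=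
  fun _ _ h => congrArg f (Policy.queue_run_congr σ h)

/-! ### Capacity region and load -/

section Capacity

variable {Ω : Type*} [MeasurableSpace Ω] {μ : Measure Ω} {A : ℕ → Ω → QMat N}

theorem le_weighted_queue (w : QMat N) (a : ℕ → QMat N) {S : ℕ → Schedule N}
    (hS : ∀ t, S t ∈ net.feasible) (t : ℕ) :
    ∑ τ ∈ Finset.range t, ∑ i, ∑ j, w i j * a τ i j ≤
      ∑ i, ∑ j, w i j * net.queue a S t i j + t * net.maxWeight w := by
  induction t with
  | zero => simp
  | succ t ih =>
    rw [Finset.sum_range_succ]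
    have h1 : ∑ i, ∑ j, w i j * net.queue a S t i j + ∑ i, ∑ j, w i j * a t i j ≤
        ∑ i, ∑ j, w i j * net.queue a S (t + 1) i j + net.maxWeight w := by
      calc _ = ∑ i, ∑ j, (w i j * net.queue a S t i j + w i j * a t i j) := by
            simp only [Finset.sum_add_distrib]
        _ ≤ ∑ i, ∑ j, (w i j * net.queue a S (t + 1) i j + if S t i j then w i j else 0) := by
            refine Finset.sum_le_sum fun i _ => Finset.sum_le_sum fun j _ => ?_
            have h2 := departures_le_ite (net := net) S t (net.queue a S t) i j
            have h3 : net.queue a S t i j + a t i j ≤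
                net.queue a S (t + 1) i j + if S t i j then 1 else 0 := by
              simp only [queue]; omega
            have h4 := Nat.mul_le_mul_left (w i j) h3
            split_ifs at h4 ⊢ <;> nlinarith
        _ = ∑ i, ∑ j, w i j * net.queue a S (t + 1) i j + weight w (S t) := by
            simp only [Finset.sum_add_distrib, weight]
        _ ≤ _ := by gcongr; exact weight_le_maxWeight (hS t) w
    rw [Nat.succ_mul]
    omega

/-- Traffic that can be stabilized does not exceed the capacity available in any nonnegative
direction: the weighted backlog grows at least at the rate by which traffic exceeds capacity. -/
theorem Admissible.sum_rate_mul_le [IsProbabilityMeasure μ] (hA : IsTraffic μ A)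
    (h : net.Admissible μ A) (w : QMat N) :
    ∑ i, ∑ j, rate μ A i j * w i j ≤ net.maxWeight w := by
  obtain ⟨σ, hσ⟩ := h
  set c : ℝ := ∑ i, ∑ j, rate μ A i j * w i j with hc
  by_contra! hlt
  obtain ⟨W, hW⟩ : ∃ W : ℕ, ∀ i j, w i j ≤ W := ⟨totalQueue w, le_totalQueue w⟩
  -- The mean total queue length at time `t` is, up to a factor, at least `t * (c - W*)`.
  have hlow : ∀ t : ℕ, ENNReal.ofReal (t * (c - net.maxWeight w)) ≤ W * σ.meanQueue μ A t := by
    intro t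
    have hint : ∀ τ i j, Integrable (fun ω => (w i j * A τ ω i j : ℝ)) μ := fun τ i j =>
      Integrable.const_mul (((hA.ident τ i j).comp (u := fun n : ℕ => (n : ℝ))
        Measurable.of_discrete).integrable_iff.2 (hA.integrable i j)) _
    have hint' : Integrable (fun ω => ∑ τ ∈ Finset.range t,
        ∑ i, ∑ j, (w i j * A τ ω i j : ℝ)) μ :=
      integrable_finsetSum _ fun τ _ => integrable_finsetSum _ fun i _ =>
        integrable_finsetSum _ fun j _ => hint τ i j
    have hexp : ∫ ω, ((∑ τ ∈ Finset.range t, ∑ i, ∑ j, (w i j * A τ ω i j : ℝ)) -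
        t * net.maxWeight w) ∂μ = t * (c - net.maxWeight w) := by
      rw [integral_sub hint' (integrable_const _), integral_finsetSum _ fun τ _ =>
        integrable_finsetSum _ fun i _ => integrable_finsetSum _ fun j _ => hint τ i j]
      have : ∀ τ, ∫ ω, ∑ i, ∑ j, (w i j * A τ ω i j : ℝ) ∂μ = c := by
        intro τ
        rw [integral_finsetSum _ fun i _ => integrable_finsetSum _ fun j _ => hint τ i j, hc]
        refine Finset.sum_congr rfl fun i _ => ?_
        rw [integral_finsetSum _ fun j _ => hint τ i j]
        refine Finset.sum_congr rfl fun j _ => ?_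
        rw [integral_const_mul, hA.integral_arrival, mul_comm]
      simp only [this]
      simp
      ring
    rw [← hexp]
    refine (ENNReal.ofReal_le_ofReal (integral_mono_ae (hint'.sub (integrable_const _))
      (hint'.sub (integrable_const _)).pos_part
      (ae_of_all _ fun ω => le_max_left _ 0))).trans ?_
    rw [ofReal_integral_eq_lintegral_ofReal (hint'.sub (integrable_const _)).pos_part
      (ae_of_all _ fun ω => le_max_right _ _)]
    unfold Policy.meanQueue
    rw [← lintegral_const_mul' _ _ (by simp)]
    refine lintegral_mono fun ω => ?_
    set a : ℕ → QMat N := fun s => A s ω with ha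
    have h1 := le_weighted_queue w a (Policy.run_mem σ a) t
    have h2 : ∑ i, ∑ j, w i j * net.queue a (σ.run a) t i j ≤
        W * totalQueue (net.queue a (σ.run a) t) := by
      unfold totalQueue
      simp only [Finset.mul_sum]
      gcongr with i _ j _
      exact hW i j
    have h3 : (∑ τ ∈ Finset.range t, ∑ i, ∑ j, (w i j * A τ ω i j : ℝ)) -
        t * net.maxWeight w ≤ ((W * totalQueue (net.queue a (σ.run a) t) : ℕ) : ℝ) := by
      rw [sub_le_iff_le_add]
      have := h1.trans (Nat.add_le_add_right h2 _)
      exact_mod_cast this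
    calc ENNReal.ofReal (max _ 0) ≤
          ENNReal.ofReal ((W * totalQueue (net.queue a (σ.run a) t) : ℕ) : ℝ) :=
        ENNReal.ofReal_le_ofReal (max_le h3 (Nat.cast_nonneg _))
      _ = _ := by rw [ENNReal.ofReal_natCast]; push_cast; rfl
  -- The time averages are bounded, so the mean total queue length is bounded infinitely often.
  have hσ' : limsup (fun t : ℕ => (∑ τ ∈ Finset.range t, σ.meanQueue μ A τ) / (t : ℝ≥0∞)) atTop
    < ∞ := hσ
  obtain ⟨C, hC1, hC2⟩ := exists_between hσ'
  obtain ⟨t₀, ht₀⟩ := eventually_atTop.1 (eventually_lt_of_limsup_lt hC1)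
  have hδ : 0 < c - net.maxWeight w := sub_pos.2 hlt
  obtain ⟨t, ht⟩ := exists_nat_gt (2 * (W * C.toReal) / (c - net.maxWeight w) + 1 + t₀)
  have hC0 : 0 ≤ 2 * (W * C.toReal) / (c - net.maxWeight w) := by positivity
  have htpos : (0 : ℝ) < t := by have : (0 : ℝ) ≤ t₀ := Nat.cast_nonneg _; linarith
  have ht1 : t₀ ≤ t := by
    have : (t₀ : ℝ) ≤ t := by linarith
    exact_mod_cast this
  have hsum := ht₀ t ht1
  have htE : (t : ℝ≥0∞) ≠ 0 := by
    have : t ≠ 0 := fun h0 => by simp [h0] at htpos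
    exact_mod_cast this
  rw [ENNReal.div_lt_iff (Or.inl htE) (Or.inl (by simp))] at hsum
  have h1 : ENNReal.ofReal (∑ τ ∈ Finset.range t, (τ : ℝ) * (c - net.maxWeight w)) ≤
      ENNReal.ofReal (W * (C.toReal * t)) := by
    rw [ENNReal.ofReal_sum_of_nonneg fun τ _ => by positivity]
    refine (Finset.sum_le_sum fun τ _ => hlow τ).trans ?_
    rw [← Finset.mul_sum, ENNReal.ofReal_mul (Nat.cast_nonneg _),
      ENNReal.ofReal_mul ENNReal.toReal_nonneg, ENNReal.ofReal_toReal hC2.ne,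
      ENNReal.ofReal_natCast, ENNReal.ofReal_natCast]
    gcongr
  rw [ENNReal.ofReal_le_ofReal_iff (by positivity), ← Finset.sum_mul] at h1
  have h2 : (∑ τ ∈ Finset.range t, (τ : ℝ)) * 2 = t * (t - 1) := by
    have h3 := Finset.sum_range_id_mul_two t
    have h4 : 1 ≤ t := by exact_mod_cast (show (0 : ℝ) < t from htpos)
    have h5 : ((t - 1 : ℕ) : ℝ) = (t : ℝ) - 1 := by rw [Nat.cast_sub h4]; simp
    rw [← h5, ← Nat.cast_sum]
    exact_mod_cast h3
  have h6 : 2 * (W * C.toReal) < (t - 1) * (c - net.maxWeight w) := by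
    rw [← div_lt_iff₀ hδ]
    have : (0 : ℝ) ≤ t₀ := Nat.cast_nonneg _
    linarith
  nlinarith

theorem sum_mul_le_of_mem_closure {lam : Fin N → Fin N → ℝ}
    (h : lam ∈ closure net.capacityRegion) (w : QMat N) :
    ∑ i, ∑ j, lam i j * w i j ≤ net.maxWeight w := by
  have hcl : IsClosed {l : Fin N → Fin N → ℝ | ∑ i, ∑ j, l i j * w i j ≤ net.maxWeight w} :=
    isClosed_le (by fun_prop) continuous_const
  refine closure_minimal (fun l hl => ?_) hcl h
  obtain ⟨Ω, _, μ, A, _, hA, hadm, rfl⟩ := hl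
  exact hadm.sum_rate_mul_le hA w

variable {lam : Fin N → Fin N → ℝ}

theorem load_nonneg (net : Network N) (lam : Fin N → Fin N → ℝ) : 0 ≤ net.load lam :=
  Real.sInf_nonneg fun _ hr => hr.2.1.le

theorem load_lt_one (h : (net.loadSet lam).Nonempty) : net.load lam < 1 := by
  obtain ⟨r, hr⟩ := h
  exact (csInf_le ⟨0, fun _ hr => hr.2.1.le⟩ hr).trans_lt hr.2.2

theorem sum_mul_le_load_mul (h : (net.loadSet lam).Nonempty) (w : QMat N) :
    ∑ i, ∑ j, lam i j * w i j ≤ net.load lam * net.maxWeight w := by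
  have key : ∀ r ∈ net.loadSet lam, ∑ i, ∑ j, lam i j * w i j ≤ r * net.maxWeight w := by
    rintro r ⟨⟨l, hl, rfl⟩, hr, -⟩
    have := mul_le_mul_of_nonneg_left (sum_mul_le_of_mem_closure hl w) hr.le
    simpa [Finset.mul_sum, mul_assoc] using this
  rcases Nat.eq_zero_or_pos (net.maxWeight w) with h0 | h0
  · obtain ⟨r, hr⟩ := h
    simpa [h0] using key r hr
  · have h0' : (0 : ℝ) < net.maxWeight w := by exact_mod_cast h0
    rw [← div_le_iff₀ h0']
    exact le_csInf h fun r hr => (div_le_iff₀ h0').2 (key r hr)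

theorem rate_le_load_mul (h : (net.loadSet lam).Nonempty) (i j : Fin N) :
    lam i j ≤ net.load lam * net.maxWeight (fun i' j' => if i' = i ∧ j' = j then 1 else 0) := by
  have := sum_mul_le_load_mul h (fun i' j' => if i' = i ∧ j' = j then 1 else 0)
  refine le_trans (le_of_eq ?_) this
  rw [Finset.sum_eq_single i, Finset.sum_eq_single j] <;> simp +contextual

theorem maxWeight_single_le (net : Network N) (i j : Fin N) :
    net.maxWeight (fun i' j' => if i' = i ∧ j' = j then 1 else 0) ≤ 1 := by
  refine (maxWeight_le_totalQueue net _).trans (le_of_eq ?_)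
  unfold totalQueue
  rw [Finset.sum_eq_single i, Finset.sum_eq_single j] <;> simp +contextual

theorem rate_lt_one (h : (net.loadSet lam).Nonempty) (i j : Fin N) : lam i j < 1 := by
  refine (rate_le_load_mul h i j).trans_lt ?_
  have h1 : (net.maxWeight (fun i' j' => if i' = i ∧ j' = j then 1 else 0) : ℝ) ≤ 1 := by
    exact_mod_cast maxWeight_single_le net i j
  have h2 := load_lt_one h
  have h3 := load_nonneg net lam
  nlinarith

/-- A queue that no feasible schedule serves has no arrivals. -/
theorem rate_nonpos_of_not_served (h : (net.loadSet lam).Nonempty) {i j : Fin N}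
    (hij : ∀ S ∈ net.feasible, S i j = false) : lam i j ≤ 0 := by
  have h1 := rate_le_load_mul h i j
  have h2 : net.maxWeight (fun i' j' => if i' = i ∧ j' = j then 1 else 0) = 0 := by
    refine Nat.le_zero.1 (Finset.sup_le fun S hS => le_of_eq ?_)
    unfold weight
    refine Finset.sum_eq_zero fun i' _ => Finset.sum_eq_zero fun j' _ => ?_
    by_cases h4 : i' = i ∧ j' = j
    · simp [h4.1, h4.2, hij S hS]
    · simp [h4]
  simpa [h2] using h1


end Capacity

end Network

/-! ### Expected drift -/

/-- Mean of a function of the arrivals, given that those before time `k` are `a`. -/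
noncomputable def condMean {N : ℕ} {Ω : Type*} [MeasurableSpace Ω] (μ : Measure Ω)
    (A : ℕ → Ω → QMat N) (k : ℕ) (a : ℕ → QMat N) (f : (ℕ → QMat N) → ℝ) : ℝ :=
  ∫ ω, f (splice k a fun s => A s ω) ∂μ

theorem splice_of_le {N : ℕ} {k s : ℕ} (h : k ≤ s) (a b : ℕ → QMat N) : splice k a b s = b s := by
  simp [splice, not_lt.2 h]

theorem splice_of_lt {N : ℕ} {k s : ℕ} (h : s < k) (a b : ℕ → QMat N) : splice k a b s = a s := by
  simp [splice, h]

section CondMean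

variable {N : ℕ} {Ω : Type*} [MeasurableSpace Ω] {μ : Measure Ω} {A : ℕ → Ω → QMat N}
  {Amax : ℕ} {k : ℕ} {a : ℕ → QMat N}

theorem condMean_zero (f : (ℕ → QMat N) → ℝ) :
    condMean μ A 0 a f = ∫ ω, f (fun s => A s ω) ∂μ := by
  simp [condMean, splice_zero]

theorem ae_splice_le (hbdd : ∀ᵐ ω ∂μ, ∀ t i j, A t ω i j ≤ Amax)
    (ha : ∀ t i j, a t i j ≤ Amax) :
    ∀ᵐ ω ∂μ, ∀ t i j, splice k a (fun s => A s ω) t i j ≤ Amax := by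
  filter_upwards [hbdd] with ω hω t i j
  unfold splice
  split_ifs
  · exact ha t i j
  · exact hω t i j

theorem IsTraffic.splice_diag (hA : IsTraffic μ A) (hd : ∀ t i, a t i i = 0) (ω : Ω) (t : ℕ)
    (i : Fin N) : splice k a (fun s => A s ω) t i i = 0 := by
  unfold splice
  split_ifs
  · exact hd t i
  · exact hA.diag t ω i

variable [IsProbabilityMeasure μ]

theorem IsTraffic.integrable_splice (hA : IsTraffic μ A)
    (hbdd : ∀ᵐ ω ∂μ, ∀ t i j, A t ω i j ≤ Amax) {f : (ℕ → QMat N) → ℝ} {t : ℕ}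
    (hf : DependsOn f (Set.Iio t)) (k : ℕ) (a : ℕ → QMat N) :
    Integrable (fun ω => f (splice k a fun s => A s ω)) μ :=
  hA.integrable_of_dependsOn hbdd (hf.comp_splice k a)

theorem condMean_of_dependsOn {f : (ℕ → QMat N) → ℝ} (hf : DependsOn f (Set.Iio k)) :
    condMean μ A k a f = f a := by
  have : ∀ ω, f (splice k a fun s => A s ω) = f a := fun ω => hf fun s hs => splice_of_lt hs _ _
  simp [condMean, this]

end CondMean

namespace Network

variable {N : ℕ} {net : Network N} {Ω : Type*} [MeasurableSpace Ω] {μ : Measure Ω}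
  [IsProbabilityMeasure μ] {A : ℕ → Ω → QMat N} {Amax K : ℕ} {π : net.Policy} {g : ℝ → ℝ}
  {G : ℝ} {k : ℕ} {a : ℕ → QMat N}

/-- Mean work that arrives, weighted with the queue lengths. -/
theorem condMean_sum_queue_mul_le (hA : IsTraffic μ A)
    (hbdd : ∀ᵐ ω ∂μ, ∀ t i j, A t ω i j ≤ Amax) (hload : (net.loadSet (rate μ A)).Nonempty)
    (σ : net.Policy) {τ : ℕ} (hkτ : k ≤ τ) :
    condMean μ A k a (fun b => ∑ i, ∑ j, (net.queue b (σ.run b) τ i j * b τ i j : ℝ)) ≤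
      net.load (rate μ A) * condMean μ A k a
        fun b => (net.maxWeight (net.queue b (σ.run b) τ) : ℝ) := by
  have hdep : ∀ i j, DependsOn (fun b : ℕ → QMat N => (net.queue b (σ.run b) τ i j : ℝ))
      (Set.Iio τ) := fun i j => dependsOn_comp_queue σ τ fun L : QMat N => (L i j : ℝ)
  have hint : ∀ i j, Integrable
      (fun ω => (net.queue (splice k a fun s => A s ω)
        (σ.run (splice k a fun s => A s ω)) τ i j : ℝ)) μ := fun i j =>
    hA.integrable_splice hbdd (hdep i j) k a
  have hint2 : ∀ i j, Integrable
      (fun ω => (net.queue (splice k a fun s => A s ω)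
        (σ.run (splice k a fun s => A s ω)) τ i j * A τ ω i j : ℝ)) μ := by
    intro i j
    refine hA.integrable_of_dependsOn (t := τ + 1) hbdd (f := fun b => ((net.queue (splice k a b)
      (σ.run (splice k a b)) τ i j : ℕ) * b τ i j : ℝ)) fun b b' hb => ?_
    have h1 := (hdep i j).comp_splice k a (x := b) (y := b') fun s hs =>
      hb s (Set.mem_Iio.2 ((Set.mem_Iio.1 hs).trans (Nat.lt_succ_self τ)))
    simp only at h1 ⊢
    rw [h1, hb τ (Set.mem_Iio.2 (Nat.lt_succ_self τ))]
  have hmul : ∀ i j, ∫ ω, (net.queue (splice k a fun s => A s ω)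
        (σ.run (splice k a fun s => A s ω)) τ i j * A τ ω i j : ℝ) ∂μ =
      (∫ ω, (net.queue (splice k a fun s => A s ω)
        (σ.run (splice k a fun s => A s ω)) τ i j : ℝ) ∂μ) * rate μ A i j := fun i j =>
    hA.integral_mul_arrival ((hdep i j).comp_splice k a) i j
  unfold condMean
  simp only [splice_of_le hkτ]
  rw [integral_finsetSum _ fun i _ => integrable_finsetSum _ fun j _ => hint2 i j,
    ← integral_const_mul]
  calc _ = ∫ ω, ∑ i, ∑ j, rate μ A i j * (net.queue (splice k a fun s => A s ω)
        (σ.run (splice k a fun s => A s ω)) τ i j : ℝ) ∂μ := by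
        rw [integral_finsetSum _ fun i _ => integrable_finsetSum _ fun j _ =>
          (hint i j).const_mul _]
        refine Finset.sum_congr rfl fun i _ => ?_
        rw [integral_finsetSum _ fun j _ => hint2 i j,
          integral_finsetSum _ fun j _ => (hint i j).const_mul _]
        refine Finset.sum_congr rfl fun j _ => ?_
        rw [hmul, integral_const_mul, mul_comm]
    _ ≤ _ := by
        refine integral_mono (integrable_finsetSum _ fun i _ => integrable_finsetSum _ fun j _ =>
          (hint i j).const_mul _) ((hA.integrable_splice hbdd
            (dependsOn_comp_queue σ τ fun L => (net.maxWeight L : ℝ)) k a).const_mul _) fun ω => ?_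
        exact sum_mul_le_load_mul hload _

/-- Lyapunov inequality in the mean, given the arrivals before time `k`. -/
theorem condMean_sqSum_add_le (hg : IsHysteresis g)
    (hπ : π.NearMaxWeight (π.adaptive g) Amax G) (hA : IsTraffic μ A)
    (hbdd : ∀ᵐ ω ∂μ, ∀ t i j, A t ω i j ≤ Amax) (hload : (net.loadSet (rate μ A)).Nonempty)
    (hK : ∀ S ∈ net.feasible, schedSize S ≤ K) {T : ℝ} {n : ℕ} (hT : 0 ≤ T) (hn : 0 < n)
    (hnT : (n : ℝ) - 1 ≤ T) (ha : ∀ t i j, a t i j ≤ Amax) (hd : ∀ t i, a t i i = 0) (t : ℕ) :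
    condMean μ A k a (fun b => sqSum (net.queue b ((π.adaptive g).run b) (k + t))) / 2 +
      (1 - net.delay / n - net.load (rate μ A)) * ∑ τ ∈ Finset.Ico k (k + t),
        condMean μ A k a (fun b => (net.maxWeight (net.queue b ((π.adaptive g).run b) τ) : ℝ)) ≤
      sqSum (net.queue a ((π.adaptive g).run a) k) / 2 +
      ∑ τ ∈ Finset.Ico k (k + t), condMean μ A k a
        (fun b => g (net.maxWeight (net.queue b ((π.adaptive g).run b) τ))) +
      t * (G + hystInv g (G + K * (Amax + 1) * T) + K * Amax * T + K * Amax * net.delay +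
        (N ^ 2 * Amax ^ 2 + K) / 2) +
      (n + net.delay) * (net.maxWeight (net.queue a ((π.adaptive g).run a) k) +
        K * Amax * (n + net.delay)) := by
  set σ := π.adaptive g with hσ
  set C := G + hystInv g (G + K * (Amax + 1) * T) + K * Amax * T + K * Amax * net.delay +
        (N ^ 2 * Amax ^ 2 + K) / 2 with hC
  set B := (n + net.delay) * (net.maxWeight (net.queue a (σ.run a) k) +
        K * Amax * (n + net.delay) : ℝ) with hB
  set b : Ω → ℕ → QMat N := fun ω => splice k a fun s => A s ω with hb
  have hdiag := hA.splice_diag (k := k) hd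
  have hk : ∀ ω, net.queue (b ω) (σ.run (b ω)) k = net.queue a (σ.run a) k := fun ω =>
    Policy.queue_run_congr σ fun s hs => splice_of_lt hs _ _
  have hpath : ∀ᵐ ω ∂μ, sqSum (net.queue (b ω) (σ.run (b ω)) (k + t)) / 2 +
      (1 - net.delay / n) * ∑ τ ∈ Finset.Ico k (k + t),
        (net.maxWeight (net.queue (b ω) (σ.run (b ω)) τ) : ℝ) ≤
      ∑ τ ∈ Finset.Ico k (k + t), ∑ i, ∑ j,
        (net.queue (b ω) (σ.run (b ω)) τ i j * b ω τ i j : ℝ) +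
      ∑ τ ∈ Finset.Ico k (k + t), g (net.maxWeight (net.queue (b ω) (σ.run (b ω)) τ)) +
      (sqSum (net.queue a (σ.run a) k) / 2 + t * C + B) := by
    filter_upwards [ae_splice_le (k := k) hbdd ha] with ω hω
    have h := sqSum_queue_add_le (a := b ω) hg hπ hω (hdiag ω) hK hT hn hnT k t
    rw [← hσ, hk ω, ← hC, ← hB] at h
    linarith
  have hdep : ∀ (τ : ℕ) (f : QMat N → ℝ), Integrable
      (fun ω => f (net.queue (b ω) (σ.run (b ω)) τ)) μ := fun τ f =>
    hA.integrable_splice hbdd (dependsOn_comp_queue σ τ f) k a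
  have hdep2 : ∀ τ, Integrable (fun ω => ∑ i, ∑ j,
        (net.queue (b ω) (σ.run (b ω)) τ i j * b ω τ i j : ℝ)) μ := fun τ =>
    hA.integrable_splice (t := τ + 1) hbdd (f := fun b => ∑ i, ∑ j,
        (net.queue b (σ.run b) τ i j * b τ i j : ℝ)) (fun b b' h => by
      have h1 := Policy.queue_run_congr σ (t := τ) fun s hs => h s (Set.mem_Iio.2 (by omega))
      simp only at h1 ⊢
      rw [h1, h τ (Set.mem_Iio.2 (Nat.lt_succ_self τ))]) k a
  have hI1 := (hdep (k + t) sqSum).div_const 2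
  have hI2 := (integrable_finsetSum (Finset.Ico k (k + t)) fun τ _ =>
    hdep τ fun L => (net.maxWeight L : ℝ)).const_mul (1 - net.delay / n : ℝ)
  have hI3 := integrable_finsetSum (Finset.Ico k (k + t)) fun τ _ => hdep2 τ
  have hI4 := integrable_finsetSum (Finset.Ico k (k + t)) fun τ _ =>
    hdep τ fun L => g (net.maxWeight L)
  have hI5 := integrable_const (μ := μ) (sqSum (net.queue a (σ.run a) k) / 2 + t * C + B)
  have h := integral_mono_ae (hI1.add hI2) ((hI3.add hI4).add hI5) hpath
  simp only [Pi.add_apply] at h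
  rw [integral_add hI1 hI2, integral_add (hI3.fun_add hI4) hI5, integral_add hI3 hI4, integral_div,
    integral_const_mul, integral_finsetSum _ fun τ _ => hdep τ fun L => (net.maxWeight L : ℝ),
    integral_finsetSum _ fun τ _ => hdep2 τ,
    integral_finsetSum _ fun τ _ => hdep τ fun L => g (net.maxWeight L), integral_const] at h
  have hlam : ∑ τ ∈ Finset.Ico k (k + t), ∫ ω, (∑ i, ∑ j,
        (net.queue (b ω) (σ.run (b ω)) τ i j * b ω τ i j : ℝ)) ∂μ ≤
      net.load (rate μ A) * ∑ τ ∈ Finset.Ico k (k + t), ∫ ω,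
        (net.maxWeight (net.queue (b ω) (σ.run (b ω)) τ) : ℝ) ∂μ := by
    rw [Finset.mul_sum]
    exact Finset.sum_le_sum fun τ hτ =>
      condMean_sum_queue_mul_le hA hbdd hload σ (Finset.mem_Ico.1 hτ).1
  simp only [probReal_univ, smul_eq_mul, one_mul] at h
  unfold condMean
  linarith

end Network

/-! ### The fixed point equation -/

/-- For concave `g`, the equation `x = c * (g (x + s) + d)` has exactly one nonnegative solution,
and it bounds all approximate subsolutions: `c * (g (x + s) + d) - x` is concave, positive at `0`,
and negative for large `x`. -/
theorem IsHysteresis.exists_fixedPoint {g : ℝ → ℝ} (hg : IsHysteresis g)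
    (hconc : ConcaveOn ℝ (Set.Ici 0) g) {c s d : ℝ} (hc : 0 ≤ c) (hs : 0 ≤ s)
    (hd : 0 < c → 0 < d) :
    ∃ x, 0 ≤ x ∧ x = c * (g (x + s) + d) ∧ (∀ y, 0 ≤ y → y = c * (g (y + s) + d) → y = x) ∧
      ∀ ε > 0, ∃ δ > 0, ∀ y, 0 ≤ y → y ≤ c * (g (y + s) + d) + δ → y ≤ x + ε := by
  rcases hc.eq_or_lt with rfl | hc
  · exact ⟨0, le_rfl, by simp, fun y _ hy => by simpa using hy,
      fun ε hε => ⟨ε, hε, fun y _ hy => by simpa using hy⟩⟩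
  have hd := hd hc
  set φ : ℝ → ℝ := fun x => c * (g (x + s) + d) - x with hφ
  have hφ0 : 0 < φ 0 := by
    have := hg.nonneg (0 + s) (by simpa using hs)
    simp only [hφ, sub_zero]
    positivity
  have hcont : ContinuousOn φ (Set.Ici 0) := by
    refine ContinuousOn.sub (continuousOn_const.mul (ContinuousOn.add ?_ continuousOn_const))
      continuousOn_id
    refine hg.cont.comp (by fun_prop) fun x hx => ?_
    simp only [Set.mem_Ici] at hx ⊢
    linarith
  have hcv : ∀ u v, 0 ≤ u → u ≤ v → 0 < v → (1 - u / v) * φ 0 + u / v * φ v ≤ φ u := by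
    intro u v hu huv hv
    have h1 : 0 ≤ u / v := by positivity
    have h2 : 0 ≤ 1 - u / v := by rw [sub_nonneg]; exact (div_le_one hv).2 huv
    have h := hconc.2 (show s ∈ Set.Ici (0 : ℝ) from hs)
      (show v + s ∈ Set.Ici (0 : ℝ) from by simp only [Set.mem_Ici]; linarith) h2 h1 (by ring)
    simp only [smul_eq_mul] at h
    have h3 : (1 - u / v) * s + u / v * (v + s) = u + s := by field_simp; ring
    have h4 : u / v * v = u := by field_simp
    rw [h3] at h
    simp only [hφ, zero_add, sub_zero]
    nlinarith
  obtain ⟨M, hM0, hM⟩ : ∃ M, 0 < M ∧ φ M < 0 := by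
    obtain ⟨C, hC, hle⟩ := hg.exists_le_affine (show 0 < 1 / (2 * c) by positivity)
    refine ⟨2 * (s / 2 + c * (C + d)) + 1, by positivity, ?_⟩
    have h := hle (2 * (s / 2 + c * (C + d)) + 1 + s) (by positivity)
    have h2 := mul_le_mul_of_nonneg_left h hc.le
    have h3 : c * (1 / (2 * c) * (2 * (s / 2 + c * (C + d)) + 1 + s) + C) =
      (2 * (s / 2 + c * (C + d)) + 1 + s) / 2 + c * C := by field_simp
    rw [h3] at h2
    simp only [hφ]
    linarith
  obtain ⟨x, hx, hxφ⟩ := intermediate_value_Icc' hM0.le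
    (hcont.mono fun x hx => hx.1) (show (0 : ℝ) ∈ Set.Icc (φ M) (φ 0) from ⟨hM.le, hφ0.le⟩)
  have hx0 : 0 < x := by
    rcases hx.1.eq_or_lt with h | h
    · rw [← h] at hxφ; exact absurd hxφ hφ0.ne'
    · exact h
  have hright : ∀ y, x < y → x * φ y ≤ -((y - x) * φ 0) := by
    intro y hy
    have hy0 : 0 < y := hx0.trans hy
    have h := hcv x y hx0.le hy.le hy0
    rw [hxφ] at h
    have h2 := mul_le_mul_of_nonneg_left h hy0.le
    have h3 : y * ((1 - x / y) * φ 0 + x / y * φ y) = (y - x) * φ 0 + x * φ y := by field_simp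
    rw [h3] at h2
    linarith
  refine ⟨x, hx0.le, ?_, fun y hy hyeq => ?_, fun ε hε => ?_⟩
  · simp only [hφ] at hxφ
    linarith
  · have hyφ : φ y = 0 := by simp only [hφ]; linarith
    rcases lt_trichotomy y x with h | h | h
    · have h1 := hcv y x hy h.le hx0
      rw [hxφ, hyφ] at h1
      have : y / x < 1 := (div_lt_one hx0).2 h
      nlinarith
    · exact h
    · have h1 := hright y h
      rw [hyφ] at h1
      nlinarith
  · refine ⟨ε * φ 0 / x / 2, by positivity, fun y hy hle => ?_⟩
    by_contra! hlt
    have h1 := hright y (by linarith)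
    have h2 : -φ y ≤ ε * φ 0 / x / 2 := by simp only [hφ]; linarith
    have h3 := mul_le_mul_of_nonneg_left h2 hx0.le
    have h4 : x * (ε * φ 0 / x / 2) = ε * φ 0 / 2 := by field_simp
    have h5 : ε * φ 0 < (y - x) * φ 0 := by gcongr; linarith
    have : 0 < ε * φ 0 := by positivity
    linarith

namespace Network

variable {N : ℕ} {net : Network N} {Ω : Type*} [MeasurableSpace Ω] {μ : Measure Ω}
  {A : ℕ → Ω → QMat N} {Amax K : ℕ} {π : net.Policy} {g : ℝ → ℝ} {G : ℝ}

/-! ### Time averages -/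

/-- Mean of a function of the queue lengths at time `t`. -/
noncomputable def Policy.mean (σ : net.Policy) (μ : Measure Ω) (A : ℕ → Ω → QMat N) (t : ℕ)
    (f : QMat N → ℝ) : ℝ :=
  ∫ ω, f (net.queue (fun s => A s ω) (σ.run fun s => A s ω) t) ∂μ

theorem mean_totalQueue_nonneg (σ : net.Policy) (t : ℕ) :
    0 ≤ σ.mean μ A t fun L => totalQueue L :=
  integral_nonneg fun _ => Nat.cast_nonneg _

/-- Queues that no feasible schedule serves stay constant, all others are bounded by the maximum
weight. -/
theorem ae_totalQueue_le (hA : IsTraffic μ A) (hload : (net.loadSet (rate μ A)).Nonempty)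
    (σ : net.Policy) :
    ∀ᵐ ω ∂μ, ∀ t, totalQueue (net.queue (fun s => A s ω) (σ.run fun s => A s ω) t) ≤
      N ^ 2 * net.maxWeight (net.queue (fun s => A s ω) (σ.run fun s => A s ω) t) +
        totalQueue net.queue0 := by
  have h0 : ∀ᵐ ω ∂μ, ∀ t i j, (∀ S ∈ net.feasible, S i j = false) → A t ω i j = 0 := by
    refine ae_all_iff.2 fun t => ae_all_iff.2 fun i => ae_all_iff.2 fun j => ?_
    by_cases hij : ∀ S ∈ net.feasible, S i j = false
    · have hint : Integrable (fun ω => (A t ω i j : ℝ)) μ :=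
        ((hA.ident t i j).comp (u := fun n : ℕ => (n : ℝ))
          Measurable.of_discrete).integrable_iff.2 (hA.integrable i j)
      have h1 : ∫ ω, (A t ω i j : ℝ) ∂μ = 0 := by
        refine le_antisymm ?_ (integral_nonneg fun _ => Nat.cast_nonneg _)
        rw [hA.integral_arrival]
        exact rate_nonpos_of_not_served hload hij
      rw [integral_eq_zero_iff_of_nonneg (fun _ => Nat.cast_nonneg _) hint] at h1
      filter_upwards [h1] with ω hω _
      simpa using hω
    · exact ae_of_all _ fun ω h => absurd h hij
  filter_upwards [h0] with ω hω t
  set a : ℕ → QMat N := fun s => A s ω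
  have hle : ∀ i j, net.queue a (σ.run a) t i j ≤
      net.maxWeight (net.queue a (σ.run a) t) + net.queue0 i j := by
    intro i j
    by_cases hij : ∀ S ∈ net.feasible, S i j = false
    · have : ∀ t, net.queue a (σ.run a) t i j = net.queue0 i j := by
        intro t
        induction t with
        | zero => rfl
        | succ t ih =>
          have h1 := departures_le_ite (net := net) (σ.run a) t (net.queue a (σ.run a) t) i j
          rw [hij _ (Policy.run_mem σ a t)] at h1
          have h2 : a t i j = 0 := hω t i j hij
          have h3 : net.departures (σ.run a) t (net.queue a (σ.run a) t) i j = 0 := by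
            simpa using h1
          simp only [queue, h2, h3, ih]
          omega
      rw [this]
      exact Nat.le_add_left _ _
    · push Not at hij
      obtain ⟨S, hS, hSij⟩ := hij
      have h1 := (le_weight (L := net.queue a (σ.run a) t)
        (Bool.eq_true_of_not_eq_false hSij)).trans (weight_le_maxWeight hS _)
      omega
  calc totalQueue (net.queue a (σ.run a) t) ≤ ∑ i, ∑ j,
      (net.maxWeight (net.queue a (σ.run a) t) + net.queue0 i j) :=
        Finset.sum_le_sum fun i _ => Finset.sum_le_sum fun j _ => hle i j
    _ = _ := by
        simp only [Finset.sum_add_distrib, totalQueue]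
        simp [sq, mul_assoc]

theorem one_sub_sub_load_pos (hload : (net.loadSet (rate μ A)).Nonempty) {T : ℝ}
    (hT : net.delay / (1 - net.load (rate μ A)) < T) :
    0 < T ∧ 0 < 1 - net.delay / T - net.load (rate μ A) := by
  have h1 := load_lt_one hload
  have hT0 : 0 < T := lt_of_le_of_lt (div_nonneg (Nat.cast_nonneg _) (by linarith)) hT
  refine ⟨hT0, ?_⟩
  rw [div_lt_iff₀ (by linarith)] at hT
  have : net.delay / T < 1 - net.load (rate μ A) := by
    rw [div_lt_iff₀ hT0]; linarith
  linarith

variable [IsProbabilityMeasure μ]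

theorem integrable_queue (hA : IsTraffic μ A) (hbdd : ∀ᵐ ω ∂μ, ∀ t i j, A t ω i j ≤ Amax)
    (σ : net.Policy) (t : ℕ) (f : QMat N → ℝ) :
    Integrable (fun ω => f (net.queue (fun s => A s ω) (σ.run fun s => A s ω) t)) μ :=
  hA.integrable_of_dependsOn hbdd (dependsOn_comp_queue σ t f)

theorem mean_mono (hA : IsTraffic μ A) (hbdd : ∀ᵐ ω ∂μ, ∀ t i j, A t ω i j ≤ Amax)
    (σ : net.Policy) (t : ℕ) {f h : QMat N → ℝ}
    (hle : ∀ᵐ ω ∂μ, f (net.queue (fun s => A s ω) (σ.run fun s => A s ω) t) ≤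
      h (net.queue (fun s => A s ω) (σ.run fun s => A s ω) t)) :
    σ.mean μ A t f ≤ σ.mean μ A t h :=
  integral_mono_ae (integrable_queue hA hbdd σ t f) (integrable_queue hA hbdd σ t h) hle

theorem mean_mul_add (hA : IsTraffic μ A) (hbdd : ∀ᵐ ω ∂μ, ∀ t i j, A t ω i j ≤ Amax)
    (σ : net.Policy) (t : ℕ) (f : QMat N → ℝ) (c d : ℝ) :
    σ.mean μ A t (fun L => c * f L + d) = c * σ.mean μ A t f + d := by
  unfold Policy.mean
  rw [integral_add ((integrable_queue hA hbdd σ t f).const_mul c) (integrable_const d),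
    integral_const_mul]
  simp

theorem meanQueue_eq_ofReal (hA : IsTraffic μ A)
    (hbdd : ∀ᵐ ω ∂μ, ∀ t i j, A t ω i j ≤ Amax) (σ : net.Policy) (t : ℕ) :
    σ.meanQueue μ A t = ENNReal.ofReal (σ.mean μ A t fun L => totalQueue L) := by
  unfold Policy.mean Policy.meanQueue
  rw [ofReal_integral_eq_lintegral_ofReal
    (integrable_queue hA hbdd σ t fun L => (totalQueue L : ℝ))
    (ae_of_all _ fun ω => Nat.cast_nonneg _)]
  simp

theorem average_meanQueue_eq (hA : IsTraffic μ A)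
    (hbdd : ∀ᵐ ω ∂μ, ∀ t i j, A t ω i j ≤ Amax) (σ : net.Policy) {t : ℕ} (ht : 0 < t) :
    (∑ τ ∈ Finset.range t, σ.meanQueue μ A τ) / (t : ℝ≥0∞) =
      ENNReal.ofReal ((∑ τ ∈ Finset.range t, σ.mean μ A τ fun L => totalQueue L) / t) := by
  rw [ENNReal.ofReal_div_of_pos (by exact_mod_cast ht), ENNReal.ofReal_natCast,
    ENNReal.ofReal_sum_of_nonneg fun τ _ => mean_totalQueue_nonneg σ τ]
  simp_rw [meanQueue_eq_ofReal hA hbdd]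

theorem limsupAverage_le (hA : IsTraffic μ A)
    (hbdd : ∀ᵐ ω ∂μ, ∀ t i j, A t ω i j ≤ Amax) (σ : net.Policy) {x : ℝ}
    (h : ∀ᶠ t : ℕ in atTop, (∑ τ ∈ Finset.range t, σ.mean μ A τ fun L => totalQueue L) / t ≤ x) :
    σ.limsupAverage μ A ≤ ENNReal.ofReal x := by
  refine limsup_le_of_le (by isBoundedDefault) ?_
  filter_upwards [h, eventually_gt_atTop 0] with t ht ht0
  rw [average_meanQueue_eq hA hbdd σ ht0]
  exact ENNReal.ofReal_le_ofReal ht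

/-- Lyapunov inequality from time `0` on. -/
theorem sum_mean_maxWeight_le (hg : IsHysteresis g)
    (hπ : π.NearMaxWeight (π.adaptive g) Amax G) (hA : IsTraffic μ A)
    (hbdd : ∀ᵐ ω ∂μ, ∀ t i j, A t ω i j ≤ Amax) (hload : (net.loadSet (rate μ A)).Nonempty)
    (hK : ∀ S ∈ net.feasible, schedSize S ≤ K) {T : ℝ} (hT : 0 < T) :
    ∃ B, ∀ t : ℕ, (1 - net.delay / T - net.load (rate μ A)) * ∑ τ ∈ Finset.range t,
        (π.adaptive g).mean μ A τ (fun L => (net.maxWeight L : ℝ)) ≤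
      ∑ τ ∈ Finset.range t, (π.adaptive g).mean μ A τ (fun L => g (net.maxWeight L)) +
      t * (G + hystInv g (G + K * (Amax + 1) * T) + K * Amax * T + K * Amax * net.delay +
        (N ^ 2 * Amax ^ 2 + K) / 2) + B := by
  refine ⟨sqSum (net.queue 0 ((π.adaptive g).run 0) 0) / 2 +
    (⌈T⌉₊ + net.delay) * (net.maxWeight (net.queue 0 ((π.adaptive g).run 0) 0) +
        K * Amax * (⌈T⌉₊ + net.delay)), fun t => ?_⟩
  have h := condMean_sqSum_add_le (k := 0) (a := 0) (n := ⌈T⌉₊) hg hπ hA hbdd hload hK hT.le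
    (Nat.ceil_pos.2 hT) (by have := Nat.ceil_lt_add_one hT.le; linarith) (by simp) (by simp) t
  simp only [zero_add, condMean_zero, Nat.Ico_zero_eq_range] at h
  have h1 : 0 ≤ ∫ ω, sqSum (net.queue (fun s => A s ω)
      ((π.adaptive g).run fun s => A s ω) t) ∂μ := integral_nonneg fun _ => sqSum_nonneg _
  have h2 : (1 - net.delay / T - net.load (rate μ A)) * ∑ τ ∈ Finset.range t,
        (π.adaptive g).mean μ A τ (fun L => (net.maxWeight L : ℝ)) ≤
      (1 - net.delay / (⌈T⌉₊ : ℝ) - net.load (rate μ A)) * ∑ τ ∈ Finset.range t,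
        (π.adaptive g).mean μ A τ (fun L => (net.maxWeight L : ℝ)) := by
    refine mul_le_mul_of_nonneg_right ?_
      (Finset.sum_nonneg fun τ _ => integral_nonneg fun _ => Nat.cast_nonneg _)
    have := Nat.le_ceil T
    gcongr
  refine h2.trans ?_
  unfold Policy.mean
  linarith

theorem stronglyStabilizes_adaptive (hg : IsHysteresis g)
    (hπ : π.NearMaxWeight (π.adaptive g) Amax G) (hA : IsTraffic μ A)
    (hbdd : ∀ᵐ ω ∂μ, ∀ t i j, A t ω i j ≤ Amax) (hload : (net.loadSet (rate μ A)).Nonempty) :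
    (π.adaptive g).StronglyStabilizes μ A := by
  set T : ℝ := net.delay / (1 - net.load (rate μ A)) + 1 with hTdef
  obtain ⟨hT, hc⟩ := one_sub_sub_load_pos hload (show _ < T from lt_add_one _)
  obtain ⟨B, hB⟩ := sum_mean_maxWeight_le (K := N ^ 2) hg hπ hA hbdd hload
    (fun S _ => schedSize_le_sq S) hT
  set c := 1 - net.delay / T - net.load (rate μ A)
  set C := G + hystInv g (G + (N ^ 2 : ℕ) * (Amax + 1) * T) + (N ^ 2 : ℕ) * Amax * T +
    (N ^ 2 : ℕ) * Amax * net.delay + (N ^ 2 * Amax ^ 2 + (N ^ 2 : ℕ)) / 2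
  -- Sublinearity of `g` lets the drift absorb the hysteresis.
  obtain ⟨Cg, hCg, hgle⟩ := hg.exists_le_affine (half_pos hc)
  set q := totalQueue net.queue0
  refine lt_of_le_of_lt (limsupAverage_le (x := N ^ 2 * (2 / c * (Cg + C + |B|)) + q)
    hA hbdd _ ?_) ENNReal.ofReal_lt_top
  filter_upwards [eventually_gt_atTop 0] with t ht
  have ht' : (0 : ℝ) < t := by exact_mod_cast ht
  have ht1 : (1 : ℝ) ≤ t := by exact_mod_cast ht
  rw [div_le_iff₀ ht']
  set W := ∑ τ ∈ Finset.range t, (π.adaptive g).mean μ A τ (fun L => (net.maxWeight L : ℝ))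
    with hW
  have h1 : ∑ τ ∈ Finset.range t, (π.adaptive g).mean μ A τ (fun L => g (net.maxWeight L)) ≤
      c / 2 * W + t * Cg := by
    have : ∀ τ ∈ Finset.range t, (π.adaptive g).mean μ A τ (fun L => g (net.maxWeight L)) ≤
        c / 2 * (π.adaptive g).mean μ A τ (fun L => (net.maxWeight L : ℝ)) + Cg := by
      intro τ _
      rw [← mean_mul_add hA hbdd]
      exact mean_mono hA hbdd _ τ (ae_of_all _ fun ω => hgle _ (Nat.cast_nonneg _))
    refine (Finset.sum_le_sum this).trans (le_of_eq ?_)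
    rw [Finset.sum_add_distrib, ← Finset.mul_sum, Finset.sum_const, Finset.card_range,
      nsmul_eq_mul]
  have h2 : ∑ τ ∈ Finset.range t, (π.adaptive g).mean μ A τ (fun L => (totalQueue L : ℝ)) ≤
      N ^ 2 * W + t * q := by
    have : ∀ τ ∈ Finset.range t, (π.adaptive g).mean μ A τ (fun L => (totalQueue L : ℝ)) ≤
        N ^ 2 * (π.adaptive g).mean μ A τ (fun L => (net.maxWeight L : ℝ)) + q := by
      intro τ _
      rw [← mean_mul_add hA hbdd]
      refine mean_mono hA hbdd _ τ ?_
      filter_upwards [ae_totalQueue_le hA hload (π.adaptive g)] with ω hω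
      exact_mod_cast hω τ
    refine (Finset.sum_le_sum this).trans (le_of_eq ?_)
    rw [Finset.sum_add_distrib, ← Finset.mul_sum, Finset.sum_const, Finset.card_range,
      nsmul_eq_mul]
  have h3 : c / 2 * W ≤ t * (Cg + C + |B|) := by
    have := hB t
    have hB1 : B ≤ t * |B| := by
      nlinarith [le_abs_self B, abs_nonneg B]
    linarith
  have h4 : W ≤ 2 / c * (Cg + C + |B|) * t := by
    have h5 := mul_le_mul_of_nonneg_left h3 (show 0 ≤ 2 / c by positivity)
    have h6 : 2 / c * (c / 2 * W) = W := by field_simp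
    rw [h6] at h5
    linarith
  have h7 : (N : ℝ) ^ 2 * W ≤ N ^ 2 * (2 / c * (Cg + C + |B|) * t) := by gcongr
  linarith

/-! ### The bound on the mean total queue length -/

/-- Jensen's inequality, in space and in time. -/
theorem sum_mean_concave_le (hg : IsHysteresis g) (hconc : ConcaveOn ℝ (Set.Ici 0) g)
    (hA : IsTraffic μ A) (hbdd : ∀ᵐ ω ∂μ, ∀ t i j, A t ω i j ≤ Amax) (σ : net.Policy)
    {t : ℕ} (ht : 0 < t) :
    ∑ τ ∈ Finset.range t, σ.mean μ A τ (fun L => g (totalQueue L)) ≤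
      t * g ((∑ τ ∈ Finset.range t, σ.mean μ A τ fun L => totalQueue L) / t) := by
  have ht' : (0 : ℝ) < t := by exact_mod_cast ht
  have h1 : ∀ τ, σ.mean μ A τ (fun L => g (totalQueue L)) ≤
      g (σ.mean μ A τ fun L => totalQueue L) := fun τ =>
    hconc.le_map_integral hg.cont isClosed_Ici
      (ae_of_all _ fun ω => Set.mem_Ici.2 (Nat.cast_nonneg _))
      (integrable_queue hA hbdd σ τ fun L => (totalQueue L : ℝ))
      (integrable_queue hA hbdd σ τ fun L => g (totalQueue L : ℝ))
  have h2 := hconc.le_map_sum (t := Finset.range t) (w := fun _ => (1 / t : ℝ))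
    (p := fun τ => σ.mean μ A τ fun L => totalQueue L) (fun _ _ => by positivity)
    (by simp [ht'.ne']) (fun τ _ => mean_totalQueue_nonneg σ τ)
  simp only [smul_eq_mul, ← Finset.mul_sum] at h2
  rw [one_div, inv_mul_le_iff₀ ht', inv_mul_eq_div] at h2
  exact (Finset.sum_le_sum fun τ _ => h1 τ).trans h2

theorem exists_fixRhs_fixedPoint (hdelay : 0 < net.delay) (hg : IsHysteresis g)
    (hconc : ConcaveOn ℝ (Set.Ici 0) g) (hcross : net.Crossbar) (hcov : net.Covering)
    (hπ : π.NearMaxWeight (π.adaptive g) Amax G) (hA : IsTraffic μ A)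
    (hbdd : ∀ᵐ ω ∂μ, ∀ t i j, A t ω i j ≤ Amax) (hload : (net.loadSet (rate μ A)).Nonempty)
    {T : ℝ} (hT : net.delay / (1 - net.load (rate μ A)) < T) :
    ∃ x, 0 ≤ x ∧ x = fixRhs N net.delay g Amax G (net.load (rate μ A)) T x ∧
      (∀ y, 0 ≤ y → y = fixRhs N net.delay g Amax G (net.load (rate μ A)) T y → y = x) ∧
      (π.adaptive g).limsupAverage μ A ≤ ENNReal.ofReal x := by
  obtain ⟨hT0, hc⟩ := one_sub_sub_load_pos hload hT
  have hT1 : 1 ≤ T := by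
    have h1 := load_lt_one hload
    have h2 := load_nonneg net (rate μ A)
    rw [div_lt_iff₀ (by linarith)] at hT
    have : (1 : ℝ) ≤ net.delay := by exact_mod_cast hdelay
    nlinarith
  obtain ⟨B, hB⟩ := sum_mean_maxWeight_le (K := N) hg hπ hA hbdd hload
    (fun S hS => hcross.schedSize_le hS) hT0
  have hG := hπ.nonneg
  have hinv := hystInv_nonneg g (G + N * (Amax + 1) * T)
  set ρ := net.load (rate μ A)
  set c := 1 - net.delay / T - ρ with hcdef
  set s : ℝ := N * Amax * T with hs
  set d : ℝ := G + N * (T + Amax * net.delay) + boundM N g Amax G T * (1 + N * Amax) +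
    (N : ℝ) ^ 2 * (Amax : ℝ) ^ 2 / 2 with hd
  have hM0 : 0 ≤ boundM N g Amax G T := by unfold boundM; positivity
  have hfix : ∀ x, fixRhs N net.delay g Amax G ρ T x = N / c * (g (x + s) + d) := by
    intro x
    simp only [fixRhs, hs, hd, hcdef]
    ring
  have hdC : G + hystInv g (G + N * (Amax + 1) * T) + N * Amax * T + N * Amax * net.delay +
        ((N : ℝ) ^ 2 * Amax ^ 2 + N) / 2 ≤ d := by
    have hNN : (N : ℝ) ≤ (N : ℝ) ^ 2 := by exact_mod_cast Nat.le_self_pow two_ne_zero N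
    have h1 : (N : ℝ) * (Amax * T) ≤ N ^ 2 * (Amax * T) := by gcongr
    have h2 : (N : ℝ) * 1 ≤ N * T := by gcongr
    have h3 : (0 : ℝ) ≤ N := Nat.cast_nonneg _
    have h4 : 0 ≤ hystInv g (G + N * (Amax + 1) * T) * (N * Amax) := by positivity
    simp only [hd, boundM]
    linarith
  have hd0 : 0 < (N : ℝ) / c → 0 < d := by
    intro hpos
    have hN : 0 < (N : ℝ) := by
      by_contra! h
      have : (N : ℝ) / c ≤ 0 := div_nonpos_of_nonpos_of_nonneg h hc.le
      linarith
    refine lt_of_lt_of_le ?_ hdC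
    positivity
  obtain ⟨x, hx0, hx, huniq, hstab⟩ := hg.exists_fixedPoint hconc
    (show 0 ≤ (N : ℝ) / c by positivity) (show 0 ≤ s by positivity) hd0
  refine ⟨x, hx0, by rw [hfix]; exact hx, fun y hy hyx => huniq y hy (by rwa [hfix] at hyx), ?_⟩
  refine ENNReal.le_of_forall_pos_le_add fun ε hε _ => ?_
  rw [← ENNReal.ofReal_coe_nnreal, ← ENNReal.ofReal_add hx0 (by positivity)]
  obtain ⟨δ, hδ, hle⟩ := hstab ε (by exact_mod_cast hε)
  refine limsupAverage_le hA hbdd _ ?_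
  obtain ⟨t₀, ht₀⟩ := exists_nat_gt (N / c * |B| / δ)
  filter_upwards [eventually_gt_atTop 0, eventually_ge_atTop t₀] with t ht htt₀
  have ht' : (0 : ℝ) < t := by exact_mod_cast ht
  set Q := ∑ τ ∈ Finset.range t, (π.adaptive g).mean μ A τ fun L => (totalQueue L : ℝ) with hQ
  have hQ0 : 0 ≤ Q := Finset.sum_nonneg fun τ _ => mean_totalQueue_nonneg _ τ
  refine hle _ (by positivity) ?_
  have h1 : ∑ τ ∈ Finset.range t, (π.adaptive g).mean μ A τ (fun L => g (net.maxWeight L)) ≤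
      t * g (Q / t + s) := by
    calc _ ≤ ∑ τ ∈ Finset.range t, (π.adaptive g).mean μ A τ (fun L => g (totalQueue L)) := by
          refine Finset.sum_le_sum fun τ _ => mean_mono hA hbdd _ τ (ae_of_all _ fun ω => ?_)
          refine hg.mono.monotoneOn (Set.mem_Ici.2 (Nat.cast_nonneg _))
            (Set.mem_Ici.2 (Nat.cast_nonneg _)) ?_
          exact_mod_cast maxWeight_le_totalQueue net _
      _ ≤ t * g (Q / t) := sum_mean_concave_le hg hconc hA hbdd _ ht
      _ ≤ t * g (Q / t + s) := by
          have hs0 : 0 ≤ s := by positivity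
          have hQt : 0 ≤ Q / t := by positivity
          gcongr
          exact hg.mono.monotoneOn (Set.mem_Ici.2 hQt) (Set.mem_Ici.2 (by linarith)) (by linarith)
  have h2 : Q ≤ N * ∑ τ ∈ Finset.range t,
      (π.adaptive g).mean μ A τ (fun L => (net.maxWeight L : ℝ)) := by
    rw [Finset.mul_sum]
    refine Finset.sum_le_sum fun τ _ => ?_
    have := mean_mul_add hA hbdd (π.adaptive g) τ (fun L => (net.maxWeight L : ℝ)) N 0
    rw [add_zero] at this
    rw [← this]
    refine mean_mono hA hbdd _ τ (ae_of_all _ fun ω => ?_)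
    rw [add_zero]
    exact_mod_cast hcov.totalQueue_le (queue_diag (fun t i => hA.diag t ω i) τ)
  have h3 := hB t
  have h4 : c * ∑ τ ∈ Finset.range t,
      (π.adaptive g).mean μ A τ (fun L => (net.maxWeight L : ℝ)) ≤
      t * (g (Q / t + s) + d) + |B| := by
    have := mul_le_mul_of_nonneg_left hdC ht'.le
    linarith [le_abs_self B]
  have h5 : Q ≤ N / c * (t * (g (Q / t + s) + d) + |B|) := by
    refine h2.trans ?_
    rw [div_mul_eq_mul_div, mul_div_assoc]
    gcongr
    rw [le_div_iff₀ hc]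
    linarith
  have h6 : N / c * |B| ≤ δ * t := by
    have h7 : (t₀ : ℝ) ≤ t := by exact_mod_cast htt₀
    rw [div_lt_iff₀ hδ] at ht₀
    nlinarith
  rw [div_le_iff₀ ht']
  linarith

end Network

/-! ### Convergence of means of finitely branching Markov chains -/

section MarkovChain

variable {X ι : Type*} {B : Finset ι} {p : ι → ℝ} {F : X → ι → X} {R : Set X}

/-- Transition operator of the Markov chain that jumps from `x` to `F x b` with probability `p b`,
for `b ∈ B`. -/
noncomputable def transOp (B : Finset ι) (p : ι → ℝ) (F : X → ι → X) : Module.End ℝ (X → ℝ) where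
  toFun h x := ∑ b ∈ B, p b * h (F x b)
  map_add' h h' := by
    funext x
    simp [mul_add, Finset.sum_add_distrib]
  map_smul' c h := by
    funext x
    simp only [Pi.smul_apply, smul_eq_mul, RingHom.id_apply, Finset.mul_sum]
    exact Finset.sum_congr rfl fun b _ => by ring

theorem transOp_apply (h : X → ℝ) (x : X) : transOp B p F h x = ∑ b ∈ B, p b * h (F x b) := rfl

/-- `p` is a probability on `B`, and the chain does not leave `R`. -/
structure IsRandomStep (B : Finset ι) (p : ι → ℝ) (F : X → ι → X) (R : Set X) : Prop where
  nonneg : ∀ b ∈ B, 0 ≤ p b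
  sum_eq_one : ∑ b ∈ B, p b = 1
  mem : ∀ x ∈ R, ∀ b ∈ B, F x b ∈ R

namespace IsRandomStep

theorem transOp_pow_mono (hc : IsRandomStep B p F R) {u v : X → ℝ}
    (h : ∀ x ∈ R, u x ≤ v x) (n : ℕ) :
    ∀ x ∈ R, (transOp B p F ^ n) u x ≤ (transOp B p F ^ n) v x := by
  induction n with
  | zero => simpa using h
  | succ n ih =>
    intro x hx
    simp only [pow_succ', Module.End.mul_apply, transOp_apply]
    exact Finset.sum_le_sum fun b hb =>
      mul_le_mul_of_nonneg_left (ih _ (hc.mem x hx b hb)) (hc.nonneg b hb)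

theorem transOp_pow_congr (hc : IsRandomStep B p F R) {u v : X → ℝ}
    (h : ∀ x ∈ R, u x = v x) (n : ℕ) :
    ∀ x ∈ R, (transOp B p F ^ n) u x = (transOp B p F ^ n) v x := fun x hx =>
  le_antisymm (hc.transOp_pow_mono (fun y hy => (h y hy).le) n x hx)
    (hc.transOp_pow_mono (fun y hy => (h y hy).ge) n x hx)

theorem transOp_mono (hc : IsRandomStep B p F R) {u v : X → ℝ} (h : ∀ x ∈ R, u x ≤ v x) :
    ∀ x ∈ R, transOp B p F u x ≤ transOp B p F v x := by
  simpa using hc.transOp_pow_mono h 1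

theorem transOp_congr (hc : IsRandomStep B p F R) {u v : X → ℝ} (h : ∀ x ∈ R, u x = v x) :
    ∀ x ∈ R, transOp B p F u x = transOp B p F v x := by
  simpa using hc.transOp_pow_congr h 1

theorem transOp_pow_const (hc : IsRandomStep B p F R) (c : ℝ) (n : ℕ) :
    (transOp B p F ^ n) (fun _ => c) = fun _ => c := by
  induction n with
  | zero => simp
  | succ n ih =>
    rw [pow_succ', Module.End.mul_apply, ih]
    funext x
    rw [transOp_apply, ← Finset.sum_mul, hc.sum_eq_one, one_mul]

theorem abs_transOp_pow_le (hc : IsRandomStep B p F R) {u v : X → ℝ} (h : ∀ x ∈ R, |u x| ≤ v x)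
    (n : ℕ) : ∀ x ∈ R, |(transOp B p F ^ n) u x| ≤ (transOp B p F ^ n) v x := by
  intro x hx
  rw [abs_le]
  constructor
  · have := hc.transOp_pow_mono (u := -v) (v := u) (fun y hy => (abs_le.1 (h y hy)).1) n x hx
    rwa [map_neg, Pi.neg_apply] at this
  · exact hc.transOp_pow_mono (fun y hy => (abs_le.1 (h y hy)).2) n x hx

theorem transOp_pow_affine (hc : IsRandomStep B p F R) (u : X → ℝ) (c d : ℝ) (n : ℕ) (x : X) :
    (transOp B p F ^ n) (fun y => c * u y + d) x = c * (transOp B p F ^ n) u x + d := by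
  have : (fun y => c * u y + d) = c • u + fun _ => d := by funext y; simp
  rw [this, map_add, map_smul, hc.transOp_pow_const]
  simp

theorem transOp_le (hc : IsRandomStep B p F R) {u : X → ℝ} {M : ℝ} (h : ∀ x ∈ R, u x ≤ M) {b₀ : ι}
    (hb₀ : b₀ ∈ B) {x : X} (hx : x ∈ R) :
    transOp B p F u x ≤ p b₀ * u (F x b₀) + (1 - p b₀) * M := by
  classical
  rw [transOp_apply, ← Finset.add_sum_erase _ _ hb₀, ← hc.sum_eq_one,
    ← Finset.add_sum_erase _ _ hb₀, add_sub_cancel_left, Finset.sum_mul]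
  gcongr with b hb
  · exact hc.nonneg b (Finset.mem_of_mem_erase hb)
  · exact h _ (hc.mem x hx b (Finset.mem_of_mem_erase hb))

variable {Ψ : X → ℝ} {β : ℝ} {b₀ : ι}

/-- A bounded solution `H` of `H (k + 1) = P (H k)`, `k ∈ ℤ`, is nonincreasing in `k`. The
increments solve the same equation. If their supremum were positive, it would be nearly attained
in a finite set, hence (going back in time along `b₀`) for a long time at one fixed point of `b₀`;
but there the increments add up to a bounded quantity. -/
theorem entire_antitone (hc : IsRandomStep B p F R) (hb₀ : b₀ ∈ B) (hp : 0 < p b₀)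
    (hfix : ∀ x ∈ R, ∃ m, F ((fun y => F y b₀)^[m] x) b₀ = (fun y => F y b₀)^[m] x)
    (hΨ : ∀ x ∈ R, 0 ≤ Ψ x) (hfin : ∀ c, {x ∈ R | Ψ x ≤ c}.Finite) (hβ : 0 < β)
    (hret : ∀ x ∈ R, ∀ᶠ n in atTop, (transOp B p F ^ n) Ψ x ≤ β)
    {H : ℤ → X → ℝ} {b : ℝ} (hH : ∀ k, ∀ x ∈ R, transOp B p F (H k) x = H (k + 1) x)
    (hb : ∀ k, ∀ x ∈ R, |H k x| ≤ b) (k : ℤ) {x : X} (hx : x ∈ R) : H (k + 1) x ≤ H k x := by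
  by_contra! hlt
  set D : ℤ → X → ℝ := fun k => H (k + 1) - H k with hD
  have hDapp : ∀ k x, D k x = H (k + 1) x - H k x := fun _ _ => rfl
  have hDP : ∀ (t : ℕ) k, ∀ x ∈ R, (transOp B p F ^ t) (D k) x = D (k + t) x := by
    intro t
    induction t with
    | zero => simp
    | succ t ih =>
      intro k x hx
      rw [pow_succ', Module.End.mul_apply, hc.transOp_congr (ih k) x hx]
      simp only [hD, map_sub, Pi.sub_apply]
      rw [hH _ x hx, hH _ x hx]
      push_cast
      rw [show k + t + 1 + 1 = k + (t + 1) + 1 by ring, show k + t + 1 = k + (t + 1) by ring]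
  have hbd : BddAbove {d | ∃ k, ∃ x ∈ R, d = D k x} := by
    refine ⟨2 * b, ?_⟩
    rintro _ ⟨k, x, hx, rfl⟩
    have h1 := abs_le.1 (hb (k + 1) x hx)
    have h2 := abs_le.1 (hb k x hx)
    rw [hDapp]
    linarith
  set M := sSup {d | ∃ k, ∃ x ∈ R, d = D k x} with hM
  have hDM : ∀ k, ∀ x ∈ R, D k x ≤ M := fun k x hx => le_csSup hbd ⟨k, x, hx, rfl⟩
  have hM0 : 0 < M := lt_of_lt_of_le (sub_pos.2 hlt) (hDM k x hx)
  have hp1 : p b₀ ≤ 1 := by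
    rw [← hc.sum_eq_one]
    exact Finset.single_le_sum hc.nonneg hb₀
  -- One number of steps along `b₀` takes all states of the finite set to fixed points.
  obtain ⟨m, hm⟩ : ∃ m, ∀ y ∈ {y ∈ R | Ψ y ≤ 2 * β}, ∀ i,
      (fun y => F y b₀)^[m + i] y = (fun y => F y b₀)^[m] y := by
    choose! m hm using hfix
    obtain ⟨m', hm'⟩ := ((hfin (2 * β)).image m).bddAbove
    have hconst : ∀ y ∈ R, ∀ i, (fun y => F y b₀)^[m y + i] y = (fun y => F y b₀)^[m y] y := by
      intro y hy i
      induction i with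
      | zero => rfl
      | succ i ih => rw [← add_assoc, Function.iterate_succ_apply', ih]; exact hm y hy
    refine ⟨m', fun y hy i => ?_⟩
    have hle : m y ≤ m' := hm' ⟨y, hy, rfl⟩
    obtain ⟨j, rfl⟩ := Nat.exists_eq_add_of_le hle
    rw [add_assoc, hconst y hy.1, hconst y hy.1]
  obtain ⟨r, hr⟩ := exists_nat_gt (2 * b / (M / 2))
  rw [div_lt_iff₀ (by positivity)] at hr
  set ε := M / 4 * p b₀ ^ (m + r) with hε
  have hε0 : 0 < ε := by positivity
  obtain ⟨_, ⟨k₁, x₁, hx₁, rfl⟩, h₁⟩ := exists_lt_of_lt_csSup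
    (s := {d | ∃ k, ∃ x ∈ R, d = D k x}) ⟨_, k, x, hx, rfl⟩ (show M - ε < M by linarith)
  obtain ⟨t, ht⟩ := (hret x₁ hx₁).exists
  -- The supremum is nearly attained in the finite set.
  obtain ⟨y, hy, k₂, h₂⟩ : ∃ y ∈ {y ∈ R | Ψ y ≤ 2 * β}, ∃ k₂, M - 2 * ε < D k₂ y := by
    by_contra! hno
    have hle : ∀ y ∈ R, D (k₁ - t) y ≤ ε / β * Ψ y + (M - 2 * ε) := by
      intro y hy
      by_cases hyΨ : Ψ y ≤ 2 * β
      · have h3 := hno y ⟨hy, hyΨ⟩ (k₁ - t)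
        have h4 : 0 ≤ ε / β * Ψ y := mul_nonneg (by positivity) (hΨ y hy)
        linarith
      · have h3 := hDM (k₁ - t) y hy
        have h4 : ε / β * (2 * β) ≤ ε / β * Ψ y := by
          push Not at hyΨ
          gcongr
        have h5 : ε / β * (2 * β) = 2 * ε := by field_simp
        linarith
    have h3 := hc.transOp_pow_mono hle t x₁ hx₁
    rw [hDP t _ x₁ hx₁, sub_add_cancel, hc.transOp_pow_affine] at h3
    have h4 : ε / β * (transOp B p F ^ t) Ψ x₁ ≤ ε / β * β := by gcongr
    rw [div_mul_cancel₀ _ hβ.ne'] at h4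
    linarith
  -- Follow `b₀` from there.
  have hmemR : ∀ j, (fun y => F y b₀)^[j] y ∈ R := by
    intro j
    induction j with
    | zero => exact hy.1
    | succ j ih => rw [Function.iterate_succ_apply']; exact hc.mem _ ih b₀ hb₀
  have hchain : ∀ j : ℕ, M - 2 * ε / p b₀ ^ j < D (k₂ - j) ((fun y => F y b₀)^[j] y) := by
    intro j
    induction j with
    | zero => simpa using h₂
    | succ j ih =>
      have h3 := hc.transOp_le (u := D (k₂ - (j + 1 : ℕ))) (hDM _) hb₀ (hmemR j)
      have h4 := hDP 1 (k₂ - (j + 1 : ℕ)) _ (hmemR j)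
      rw [pow_one] at h4
      rw [h4, ← Function.iterate_succ_apply' (fun y => F y b₀)] at h3
      rw [show k₂ - ((j + 1 : ℕ) : ℤ) + ((1 : ℕ) : ℤ) = k₂ - j by push_cast; ring] at h3
      have h5 : p b₀ * (2 * ε / p b₀ ^ (j + 1)) = 2 * ε / p b₀ ^ j := by
        rw [pow_succ]; field_simp
      have h6 : p b₀ * (M - 2 * ε / p b₀ ^ (j + 1)) <
          p b₀ * D (k₂ - (j + 1 : ℕ)) ((fun y => F y b₀)^[j + 1] y) := by
        rw [mul_sub, h5]
        linarith
      exact lt_of_mul_lt_mul_left h6 hp.le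
  set z := (fun y => F y b₀)^[m] y with hz
  have hzD : ∀ i ∈ Finset.range r,
      M / 2 ≤ H (k₂ - m - i + 1) z - H (k₂ - m - (i + 1 : ℕ) + 1) z := by
    intro i hi
    have h3 := hchain (m + i)
    rw [hm y hy i, hDapp] at h3
    have h4 : 2 * ε / p b₀ ^ (m + i) ≤ M / 2 := by
      rw [div_le_iff₀ (by positivity), hε]
      have : p b₀ ^ (m + r) ≤ p b₀ ^ (m + i) :=
        pow_le_pow_of_le_one hp.le hp1 (by have := Finset.mem_range.1 hi; omega)
      nlinarith
    have e1 : k₂ - (m + i : ℕ) + 1 = k₂ - m - i + 1 := by push_cast; ring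
    have e2 : k₂ - m - (i + 1 : ℕ) + 1 = k₂ - (m + i : ℕ) := by push_cast; ring
    rw [e2, ← e1]
    linarith
  have hsum := Finset.card_nsmul_le_sum _ _ _ hzD
  rw [Finset.sum_range_sub' (fun i : ℕ => H (k₂ - m - i + 1) z), Finset.card_range,
    nsmul_eq_mul] at hsum
  have h3 := abs_le.1 (hb (k₂ - m - (0 : ℕ) + 1) z (hmemR m))
  have h4 := abs_le.1 (hb (k₂ - m - r + 1) z (hmemR m))
  have h5 := hsum.trans (sub_le_sub h3.2 h4.1)
  linarith

/-- Means of a function along the chain converge if some input `b₀` of positive probability takes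
every state to a fixed point, and moments are under control. Bounded solutions on `ℤ` of the
evolution equation being constant in time, limit points of the means are harmonic; uniform
integrability of `Ψ` makes the limit point unique. -/
theorem exists_tendsto_transOp_pow (hc : IsRandomStep B p F R) (hb₀ : b₀ ∈ B) (hp : 0 < p b₀)
    (hfix : ∀ x ∈ R, ∃ m, F ((fun y => F y b₀)^[m] x) b₀ = (fun y => F y b₀)^[m] x)
    (hΨ : ∀ x ∈ R, 1 ≤ Ψ x) (hfin : ∀ c, {x ∈ R | Ψ x ≤ c}.Finite) (hβ : 0 < β)
    (hret : ∀ x ∈ R, ∀ᶠ n in atTop, (transOp B p F ^ n) Ψ x ≤ β)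
    {γ : ℝ} (hgrow : ∀ x ∈ R, ∀ n, (transOp B p F ^ n) Ψ x ≤ γ * Ψ x)
    (hsq : ∀ x ∈ R, ∃ M, ∀ n, (transOp B p F ^ n) (fun y => Ψ y ^ 2) x ≤ M)
    {f : X → ℝ} {c : ℝ} (hf : ∀ x ∈ R, |f x| ≤ c * Ψ x) {x : X} (hx : x ∈ R) :
    ∃ ℓ, Tendsto (fun n => (transOp B p F ^ n) f x) atTop (𝓝 ℓ) := by
  have hc0 : 0 ≤ c := by
    by_contra! h
    have h1 := hf x hx
    have h2 := hΨ x hx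
    have h3 := abs_nonneg (f x)
    nlinarith
  have hpow : ∀ n, ∀ y ∈ R, |(transOp B p F ^ n) f y| ≤ c * (transOp B p F ^ n) Ψ y := by
    intro n y hy
    have := hc.abs_transOp_pow_le hf n y hy
    have h2 : (fun y => c * Ψ y) = c • Ψ := rfl
    rwa [h2, map_smul] at this
  have hto : ∀ k : ℤ, Tendsto (fun n : ℕ => ((n : ℤ) + k).toNat) (hyperfilter ℕ) atTop := by
    intro k
    refine Tendsto.mono_left ?_ Nat.hyperfilter_le_atTop
    refine tendsto_atTop.2 fun m => ?_
    filter_upwards [eventually_ge_atTop (m + k.natAbs)] with n hn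
    omega
  have hlim : ∀ (k : ℤ) y, ∃ l, y ∈ R → Tendsto
      (fun n : ℕ => (transOp B p F ^ ((n : ℤ) + k).toNat) f y) (hyperfilter ℕ) (𝓝 l) := by
    intro k y
    by_cases hy : y ∈ R
    · obtain ⟨l, -, hl⟩ :=
        (isCompact_Icc (a := -(c * (γ * Ψ y))) (b := c * (γ * Ψ y))).ultrafilter_le_nhds'
        ((hyperfilter ℕ).map fun n : ℕ => (transOp B p F ^ ((n : ℤ) + k).toNat) f y)
        (Ultrafilter.mem_map.2 (Filter.univ_mem' fun n => abs_le.1 ((hpow _ y hy).trans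
          (mul_le_mul_of_nonneg_left (hgrow y hy _) hc0))))
      exact ⟨l, fun _ => hl⟩
    · exact ⟨0, fun h => absurd h hy⟩
  choose H hH using hlim
  have hHb : ∀ k, ∀ y ∈ R, |H k y| ≤ c * β := by
    intro k y hy
    refine le_of_tendsto (hH k y hy).abs ?_
    filter_upwards [(hto k).eventually (hret y hy)] with n hn
    exact (hpow _ y hy).trans (mul_le_mul_of_nonneg_left hn hc0)
  have hHP : ∀ k, ∀ y ∈ R, transOp B p F (H k) y = H (k + 1) y := by
    intro k y hy
    have h1 : Tendsto (fun n : ℕ => transOp B p F ((transOp B p F ^ ((n : ℤ) + k).toNat) f) y)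
        (hyperfilter ℕ) (𝓝 (transOp B p F (H k) y)) := by
      simp only [transOp_apply]
      exact tendsto_finsetSum _ fun b hb => (hH k _ (hc.mem y hy b hb)).const_mul _
    refine tendsto_nhds_unique h1 ((hH (k + 1) y hy).congr' ?_)
    have : ∀ᶠ n : ℕ in atTop, 0 ≤ (n : ℤ) + k := by
      filter_upwards [eventually_ge_atTop k.natAbs] with n hn
      omega
    filter_upwards [Nat.hyperfilter_le_atTop this] with n hn
    rw [← Module.End.mul_apply, ← pow_succ',
      show ((n : ℤ) + (k + 1)).toNat = ((n : ℤ) + k).toNat + 1 by omega]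
  have hΨ0 : ∀ y ∈ R, 0 ≤ Ψ y := fun y hy => zero_le_one.trans (hΨ y hy)
  -- The limit along the ultrafilter is harmonic.
  have hharm : ∀ s : ℕ, ∀ y ∈ R, (transOp B p F ^ s) (H 0) y = H 0 y := by
    have h1 : ∀ y ∈ R, transOp B p F (H 0) y = H 0 y := by
      intro y hy
      rw [hHP 0 y hy]
      refine le_antisymm
        (hc.entire_antitone hb₀ hp hfix hΨ0 hfin hβ hret hHP hHb 0 hy) ?_
      have := hc.entire_antitone (H := fun k => -H k) hb₀ hp hfix hΨ0 hfin hβ hret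
        (fun k y hy => by simp [map_neg, hHP k y hy]) (fun k y hy => by simpa using hHb k y hy) 0 hy
      simpa using this
    intro s
    induction s with
    | zero => simp
    | succ s ih =>
      intro y hy
      rw [pow_succ', Module.End.mul_apply, hc.transOp_congr ih y hy, h1 y hy]
  refine ⟨H 0 x, Metric.tendsto_atTop.2 fun ε hε => ?_⟩
  obtain ⟨M, hM⟩ := hsq x hx
  have hM0 : 0 ≤ M := le_trans (by simpa using sq_nonneg (Ψ x)) (hM 0)
  set C := c * |γ| + c * β with hC
  have hC0 : 0 ≤ C := by positivity
  obtain ⟨r, hr0, hr⟩ : ∃ r : ℝ, 0 < r ∧ C * M / r < ε / 2 := by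
    refine ⟨C * M / (ε / 2) + 1, by positivity, ?_⟩
    rw [div_lt_iff₀ (by positivity)]
    have : ε / 2 * (C * M / (ε / 2) + 1) = C * M + ε / 2 := by field_simp
    linarith
  -- On a large finite set, one of the means is close to the limit.
  obtain ⟨n, hn⟩ : ∃ n : ℕ, ∀ y ∈ {y ∈ R | Ψ y ≤ r},
      |(transOp B p F ^ n) f y - H 0 y| ≤ ε / 2 := by
    have : ∀ᶠ n : ℕ in hyperfilter ℕ, ∀ y ∈ {y ∈ R | Ψ y ≤ r},
        |(transOp B p F ^ ((n : ℤ) + 0).toNat) f y - H 0 y| ≤ ε / 2 := by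
      refine (eventually_all_finite (hfin r)).2 fun y hy => ?_
      filter_upwards [Metric.tendsto_nhds.1 (hH 0 y hy.1) (ε / 2) (by positivity)] with n hn
      exact hn.le
    obtain ⟨n, hn⟩ := this.exists
    exact ⟨_, hn⟩
  refine ⟨n, fun s hs => ?_⟩
  obtain ⟨s, rfl⟩ := Nat.exists_eq_add_of_le hs
  have hbound : ∀ y ∈ R, |((transOp B p F ^ n) f - H 0) y| ≤ C / r * Ψ y ^ 2 + ε / 2 := by
    intro y hy
    rw [Pi.sub_apply]
    by_cases hyr : Ψ y ≤ r
    · have := hn y ⟨hy, hyr⟩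
      have h2 : 0 ≤ C / r * Ψ y ^ 2 := by positivity
      linarith
    · push Not at hyr
      have h1 : |(transOp B p F ^ n) f y| ≤ c * (|γ| * Ψ y) :=
        (hpow n y hy).trans (mul_le_mul_of_nonneg_left ((hgrow y hy n).trans
          (mul_le_mul_of_nonneg_right (le_abs_self γ) (hΨ0 y hy))) hc0)
      have h2 := hHb 0 y hy
      have h3 : |(transOp B p F ^ n) f y - H 0 y| ≤ C * Ψ y := by
        have h4 := abs_sub (((transOp B p F ^ n) f) y) (H 0 y)
        have h5 : c * β * 1 ≤ c * β * Ψ y := by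
          gcongr
          exact hΨ y hy
        rw [hC]
        linarith
      have h6 : C * Ψ y ≤ C / r * Ψ y ^ 2 := by
        have h7 : C / r * (r * Ψ y) ≤ C / r * (Ψ y * Ψ y) := by
          have := hΨ0 y hy
          gcongr
        have h8 : C / r * (r * Ψ y) = C * Ψ y := by field_simp
        rw [sq]
        linarith
      linarith
  have h1 := hc.abs_transOp_pow_le hbound s x hx
  rw [hc.transOp_pow_affine, map_sub, Pi.sub_apply, hharm s x hx, ← Module.End.mul_apply,
    ← pow_add, add_comm s n] at h1
  rw [Real.dist_eq]
  have h2 : C / r * (transOp B p F ^ s) (fun y => Ψ y ^ 2) x ≤ C / r * M := by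
    gcongr
    exact hM s
  have h3 : C / r * M = C * M / r := by ring
  linarith

/-- Iteration of a geometric drift condition for `n₀` steps. -/
theorem transOp_pow_le_of_drift (hc : IsRandomStep B p F R) (hΨ : ∀ x ∈ R, 0 ≤ Ψ x) {n₀ : ℕ}
    (hn₀ : 0 < n₀) {κ b γ : ℝ} (hκ0 : 0 ≤ κ) (hκ1 : κ < 1) (hγ : 1 ≤ γ)
    (hdrift : ∀ x ∈ R, (transOp B p F ^ n₀) Ψ x ≤ κ * Ψ x + b) (hb : 0 ≤ b)
    (hstep : ∀ x ∈ R, transOp B p F Ψ x ≤ γ * Ψ x) (n : ℕ) {x : X} (hx : x ∈ R) :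
    (transOp B p F ^ n) Ψ x ≤ γ ^ n₀ * (κ ^ (n / n₀) * Ψ x + b / (1 - κ)) := by
  have h1 : ∀ r, ∀ x ∈ R, (transOp B p F ^ r) Ψ x ≤ γ ^ r * Ψ x := by
    intro r
    induction r with
    | zero => simp
    | succ r ih =>
      intro x hx
      rw [pow_succ', Module.End.mul_apply]
      refine (hc.transOp_mono (v := γ ^ r • Ψ) ih x hx).trans ?_
      rw [map_smul, Pi.smul_apply, smul_eq_mul, pow_succ, mul_assoc]
      gcongr
      exact hstep x hx
  have h2 : ∀ j, ∀ x ∈ R, (transOp B p F ^ (n₀ * j)) Ψ x ≤ κ ^ j * Ψ x + b / (1 - κ) := by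
    have hb' : 0 ≤ b / (1 - κ) := div_nonneg hb (by linarith)
    intro j
    induction j with
    | zero => intro x _; simpa using hb'
    | succ j ih =>
      intro x hx
      rw [Nat.mul_succ, pow_add, Module.End.mul_apply]
      have h3 := hc.transOp_pow_mono hdrift (n₀ * j) x hx
      rw [hc.transOp_pow_affine] at h3
      have h4 := mul_le_mul_of_nonneg_left (ih x hx) hκ0
      have h5 : κ * (b / (1 - κ)) + b = b / (1 - κ) := by
        have : 1 - κ ≠ 0 := by linarith
        field_simp
        ring
      rw [pow_succ]
      linarith
  have h3 := hc.transOp_pow_mono (v := γ ^ (n % n₀) • Ψ) (h1 (n % n₀)) (n₀ * (n / n₀)) x hx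
  rw [map_smul, Pi.smul_apply, smul_eq_mul, ← Module.End.mul_apply, ← pow_add,
    Nat.div_add_mod] at h3
  have h4 : 0 ≤ (transOp B p F ^ (n₀ * (n / n₀))) Ψ x := by
    have := hc.transOp_pow_mono (u := fun _ => 0) hΨ (n₀ * (n / n₀)) x hx
    rwa [hc.transOp_pow_const] at this
  have h5 : γ ^ (n % n₀) ≤ γ ^ n₀ := pow_le_pow_right₀ hγ (Nat.mod_lt n hn₀).le
  refine h3.trans ((mul_le_mul_of_nonneg_right h5 h4).trans ?_)
  gcongr
  exact h2 _ x hx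

end IsRandomStep

end MarkovChain

namespace Network

variable {N : ℕ} {net : Network N}

/-! ### The network under a Markov policy as a Markov chain -/

/-- Number of lost slots still ahead at the beginning of slot `t`, not counting those that a
reconfiguration in slot `t` will cause. -/
def remaining (net : Network N) (S : ℕ → Schedule N) : ℕ → ℕ
  | 0 => 0
  | t + 1 => (if S t = net.prevSched S t then remaining net S t else net.delay) - 1

theorem lt_remaining_iff (S : ℕ → Schedule N) (t m : ℕ) :
    m < (if S t = net.prevSched S t then net.remaining S t else net.delay) ↔
      ∃ s, s ≤ t ∧ t + m < s + net.delay ∧ S s ≠ net.prevSched S s := by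
  induction t generalizing m with
  | zero =>
    split_ifs with h
    · simp only [remaining, not_lt_zero, false_iff, not_exists, not_and]
      intro s hs _ hne
      rw [Nat.le_zero.1 hs] at hne
      exact hne h
    · refine ⟨fun hm => ⟨0, le_rfl, by omega, h⟩, ?_⟩
      rintro ⟨s, hs, hlt, -⟩
      omega
  | succ t ih =>
    split_ifs with h
    · rw [remaining, Nat.lt_sub_iff_add_lt, ih (m + 1)]
      constructor
      · rintro ⟨s, hs, hlt, hne⟩
        exact ⟨s, by omega, by omega, hne⟩
      · rintro ⟨s, hs, hlt, hne⟩
        rcases Nat.lt_or_eq_of_le hs with hs | rfl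
        · exact ⟨s, by omega, by omega, hne⟩
        · exact absurd h hne
    · refine ⟨fun hm => ⟨t + 1, le_rfl, by omega, h⟩, ?_⟩
      rintro ⟨s, hs, hlt, -⟩
      omega

theorem inDelay_iff (S : ℕ → Schedule N) (t : ℕ) : net.InDelay S t ↔
    0 < if S t = net.prevSched S t then net.remaining S t else net.delay :=
  (lt_remaining_iff S t 0).symm

theorem remaining_le (S : ℕ → Schedule N) (t : ℕ) : net.remaining S t ≤ net.delay := by
  induction t with
  | zero => exact Nat.zero_le _
  | succ t ih => rw [remaining]; split_ifs <;> omega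

/-- Previous schedule, queue lengths, and remaining number of lost slots. -/
abbrev State (N : ℕ) := Schedule N × QMat N × ℕ

/-- One slot of the network with reconfiguration delay `Δ`, if the new schedule is `u S L` and the
arrivals are `b`. -/
def stateStep (Δ : ℕ) (u : Schedule N → QMat N → Schedule N) (x : State N) (b : QMat N) :
    State N :=
  (u x.1 x.2.1,
    fun i j => x.2.1 i j - (if 0 < (if u x.1 x.2.1 = x.1 then x.2.2 else Δ) then 0 else
      if u x.1 x.2.1 i j = true ∧ 0 < x.2.1 i j then 1 else 0) + b i j,
    (if u x.1 x.2.1 = x.1 then x.2.2 else Δ) - 1)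

/-- State at the beginning of slot `t`. -/
noncomputable def Policy.state (σ : net.Policy) (a : ℕ → QMat N) (t : ℕ) : State N :=
  (net.prevSched (σ.run a) t, net.queue a (σ.run a) t, net.remaining (σ.run a) t)

/-- The schedules of the policy are `u` of the previous schedule and the queue lengths. -/
def Policy.IsFeedback (σ : net.Policy) (u : Schedule N → QMat N → Schedule N) : Prop :=
  ∀ a t, σ.run a t = u (net.prevSched (σ.run a) t) (net.queue a (σ.run a) t)

variable {σ : net.Policy} {u : Schedule N → QMat N → Schedule N}

theorem Policy.IsFeedback.state_succ (hu : σ.IsFeedback u) (a : ℕ → QMat N) (t : ℕ) :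
    σ.state a (t + 1) = stateStep net.delay u (σ.state a t) (a t) := by
  have h := hu a t
  simp only [state, stateStep, ← h]
  refine Prod.ext rfl (Prod.ext ?_ ?_)
  · funext i j
    have := inDelay_iff (net := net) (σ.run a) t
    simp only [queue, departures]
    by_cases hd : net.InDelay (σ.run a) t
    · rw [if_pos hd, if_pos (this.1 hd)]
    · rw [if_neg hd, if_neg fun h => hd (this.2 h)]
  · rfl

theorem Policy.IsFeedback.dependsOn_state (hu : σ.IsFeedback u) (t : ℕ) :
    DependsOn (fun a => σ.state a t) (Set.Iio t) := by
  induction t with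
  | zero => intro a a' _; rfl
  | succ t ih =>
    intro a a' h
    have h1 : σ.state a t = σ.state a' t :=
      ih fun s hs => h s (Set.mem_Iio.2 ((Set.mem_Iio.1 hs).trans (Nat.lt_succ_self t)))
    simp only [hu.state_succ, h1, h t (Set.mem_Iio.2 (Nat.lt_succ_self t))]

theorem Policy.IsFeedback.dependsOn_comp_state {β : Type*} (hu : σ.IsFeedback u) (t : ℕ)
    (f : State N → β) : DependsOn (fun a => f (σ.state a t)) (Set.Iio t) :=
  fun _ _ h => congrArg f (hu.dependsOn_state t h)

open Classical in
/-- The feedback of the adaptive variant of a Markov policy with feedback `p`. -/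
noncomputable def adaptiveFeedback (g : ℝ → ℝ) (p : Schedule N → QMat N → Schedule N)
    (S : Schedule N) (L : QMat N) : Schedule N :=
  if (weight L (p S L) : ℝ) - weight L S ≤ g (weight L (p S L)) then S else p S L

theorem Policy.IsMarkov.exists_isFeedback {π : net.Policy} (h : π.IsMarkov) (g : ℝ → ℝ) :
    ∃ p, (π.adaptive g).IsFeedback (adaptiveFeedback g p) := by
  obtain ⟨p, hp⟩ := h
  refine ⟨p, fun a t => ?_⟩
  rw [adaptive_run, hp t a _ fun τ _ => run_mem _ a τ]
  rfl

theorem weight_lt_of_adaptiveFeedback_ne {g : ℝ → ℝ} (hg : IsHysteresis g)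
    {p : Schedule N → QMat N → Schedule N} {S : Schedule N} {L : QMat N}
    (h : adaptiveFeedback g p S L ≠ S) : weight L S < weight L (adaptiveFeedback g p S L) := by
  unfold adaptiveFeedback at h ⊢
  split_ifs at h ⊢ with h1
  · exact absurd rfl h
  · have h2 := hg.nonneg (weight L (p S L)) (Nat.cast_nonneg _)
    have : (weight L S : ℝ) < weight L (p S L) := by linarith
    exact_mod_cast this

/-- Without arrivals, every state ends up in a fixed point: total queue length, weight that the
schedule lacks, and remaining lost slots decrease lexicographically. -/
theorem exists_iterate_stateStep_fixed {Δ : ℕ} (hΔ : 0 < Δ)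
    (hu : ∀ S L, u S L ≠ S → weight L S < weight L (u S L)) (x : State N) :
    ∃ m, stateStep Δ u ((fun y => stateStep Δ u y 0)^[m] x) 0 =
      (fun y => stateStep Δ u y 0)^[m] x := by
  suffices H : ∀ (z : ℕ ×ₗ ℕ ×ₗ ℕ) (x : State N),
      toLex (totalQueue x.2.1, toLex (totalQueue x.2.1 - weight x.2.1 x.1, x.2.2)) = z →
      ∃ m, stateStep Δ u ((fun y => stateStep Δ u y 0)^[m] x) 0 =
        (fun y => stateStep Δ u y 0)^[m] x from H _ x rfl
  intro z
  induction z using WellFoundedLT.induction with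
  | _ z ih =>
    rintro x rfl
    by_cases hx : stateStep Δ u x 0 = x
    · exact ⟨0, hx⟩
    obtain ⟨m, hm⟩ := ih _ (by
      obtain ⟨S, L, r⟩ := x
      by_cases hS : u S L = S
      · rcases Nat.eq_zero_or_pos r with rfl | hr
        · refine Prod.Lex.toLex_lt_toLex.2 (Or.inl ?_)
          have hle : ∀ i j, (stateStep Δ u (S, L, 0) 0).2.1 i j ≤ L i j := fun i j => by
            simp [stateStep]
          have hne : ∃ i j, (stateStep Δ u (S, L, 0) 0).2.1 i j ≠ L i j := by
            by_contra! h
            refine hx (Prod.ext hS (Prod.ext (funext fun i => funext fun j => h i j) ?_))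
            simp [stateStep, hS]
          obtain ⟨i, j, hij⟩ := hne
          exact Finset.sum_lt_sum (fun i _ => Finset.sum_le_sum fun j _ => hle i j)
            ⟨i, Finset.mem_univ i, Finset.sum_lt_sum (fun j _ => hle i j)
              ⟨j, Finset.mem_univ j, lt_of_le_of_ne (hle i j) hij⟩⟩
        · have h1 : stateStep Δ u (S, L, r) 0 = (S, L, r - 1) := by
            simp [stateStep, hS, hr]
          rw [h1]
          exact Prod.Lex.toLex_lt_toLex.2 (Or.inr ⟨rfl, Prod.Lex.toLex_lt_toLex.2
            (Or.inr ⟨rfl, by simp only; omega⟩)⟩)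
      · have h1 : stateStep Δ u (S, L, r) 0 = (u S L, L, Δ - 1) := by
          simp [stateStep, hS, hΔ]
        rw [h1]
        refine Prod.Lex.toLex_lt_toLex.2 (Or.inr ⟨rfl, Prod.Lex.toLex_lt_toLex.2 (Or.inl ?_)⟩)
        have h2 := hu S L hS
        have h3 := weight_le_totalQueue L (u S L)
        simp only
        omega) (stateStep Δ u x 0) rfl
    exact ⟨m + 1, hm⟩

/-- States that are reached under arrivals bounded by `Amax`. -/
def Policy.reachable (σ : net.Policy) (Amax : ℕ) : Set (State N) :=
  {x | ∃ k a, (∀ t i j, a t i j ≤ Amax) ∧ (∀ t i, a t i i = 0) ∧ x = σ.state a k}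

/-- Possible arrivals of one slot. -/
def arrivalBox (N Amax : ℕ) : Finset (QMat N) :=
  (Fintype.piFinset fun _ => Fintype.piFinset fun _ => Finset.range (Amax + 1)).filter
    fun b => ∀ i, b i i = 0

theorem mem_arrivalBox {Amax : ℕ} {b : QMat N} :
    b ∈ arrivalBox N Amax ↔ (∀ i j, b i j ≤ Amax) ∧ ∀ i, b i i = 0 := by
  simp [arrivalBox]

theorem Policy.IsFeedback.stateStep_mem (hu : σ.IsFeedback u) {Amax : ℕ} {x : State N}
    (hx : x ∈ σ.reachable Amax) {b : QMat N} (hb : b ∈ arrivalBox N Amax) :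
    stateStep net.delay u x b ∈ σ.reachable Amax := by
  obtain ⟨k, a, ha, hd, rfl⟩ := hx
  rw [mem_arrivalBox] at hb
  refine ⟨k + 1, splice k a fun _ => b, fun t i j => ?_, fun t i => ?_, ?_⟩
  · unfold splice
    split_ifs
    exacts [ha t i j, hb.1 i j]
  · unfold splice
    split_ifs
    exacts [hd t i, hb.2 i]
  · have h : σ.state a k = σ.state (splice k a fun _ => b) k :=
      hu.dependsOn_state k fun s hs => (splice_of_lt hs _ _).symm
    rw [hu.state_succ, splice_of_le le_rfl, h]

section Traffic

variable {Ω : Type*} [MeasurableSpace Ω] {μ : Measure Ω} {A : ℕ → Ω → QMat N} {Amax : ℕ}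

/-- Probability that the arrivals of one slot are `b`. -/
noncomputable def arrivalProb (μ : Measure Ω) (A : ℕ → Ω → QMat N) (b : QMat N) : ℝ :=
  ∏ q : Fin N × Fin N, μ.real ((fun ω => A 0 ω q.1 q.2) ⁻¹' {b q.1 q.2})

theorem measureReal_arrival_eq (hA : IsTraffic μ A) (t : ℕ) (b : QMat N) :
    μ.real (A t ⁻¹' {b}) = arrivalProb μ A b := by
  have h := hA.indep.measure_inter_preimage_eq_mul ({t} ×ˢ Finset.univ)
    (sets := fun q => {b q.2.1 q.2.2}) fun _ _ => MeasurableSet.of_discrete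
  have hset : A t ⁻¹' {b} = ⋂ q ∈ (({t} : Finset ℕ) ×ˢ (Finset.univ : Finset (Fin N × Fin N))),
      (fun ω => A q.1 ω q.2.1 q.2.2) ⁻¹' {b q.2.1 q.2.2} := by
    ext ω
    simp only [Set.mem_iInter, Set.mem_preimage, Set.mem_singleton_iff, Finset.mem_product,
      Finset.mem_singleton, Finset.mem_univ, and_true]
    refine ⟨fun h q hq => by rw [hq, h], fun h => ?_⟩
    funext i j
    exact h (t, i, j) rfl
  rw [← hset] at h
  rw [measureReal_def, h, Finset.prod_product, Finset.prod_singleton, ENNReal.toReal_prod]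
  refine Finset.prod_congr rfl fun q _ => ?_
  rw [measureReal_def, (hA.ident t q.1 q.2).measure_mem_eq MeasurableSet.of_discrete]

theorem ae_mem_arrivalBox (hA : IsTraffic μ A) (hbdd : ∀ᵐ ω ∂μ, ∀ t i j, A t ω i j ≤ Amax) :
    ∀ᵐ ω ∂μ, ∀ t, A t ω ∈ arrivalBox N Amax := by
  filter_upwards [hbdd] with ω hω t
  exact mem_arrivalBox.2 ⟨hω t, hA.diag t ω⟩

variable [IsProbabilityMeasure μ]

theorem arrivalProb_zero_pos (hA : IsTraffic μ A) (hload : (net.loadSet (rate μ A)).Nonempty) :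
    0 < arrivalProb μ A 0 := by
  refine Finset.prod_pos fun q _ => ?_
  -- An integer with mean less than one vanishes with positive probability.
  by_contra! hle
  have h0 : μ ((fun ω => A 0 ω q.1 q.2) ⁻¹' {0}) = 0 := by
    have := le_antisymm hle measureReal_nonneg
    rw [measureReal_def, ENNReal.toReal_eq_zero_iff] at this
    exact this.resolve_right (measure_ne_top _ _)
  have h1 : ∀ᵐ ω ∂μ, (1 : ℝ) ≤ A 0 ω q.1 q.2 := by
    have : ∀ᵐ ω ∂μ, A 0 ω q.1 q.2 ≠ 0 := by
      rw [ae_iff]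
      convert h0 using 2
      ext ω
      simp
    filter_upwards [this] with ω hω
    exact_mod_cast Nat.one_le_iff_ne_zero.2 hω
  have h2 := integral_mono_ae (integrable_const (1 : ℝ)) (hA.integrable q.1 q.2) h1
  rw [integral_const, probReal_univ, one_smul] at h2
  exact absurd (rate_lt_one hload q.1 q.2) (not_lt.2 h2)

theorem Policy.IsFeedback.isRandomStep (hu : σ.IsFeedback u) (hA : IsTraffic μ A)
    (hbdd : ∀ᵐ ω ∂μ, ∀ t i j, A t ω i j ≤ Amax) :
    IsRandomStep (arrivalBox N Amax) (arrivalProb μ A) (stateStep net.delay u)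
      (σ.reachable Amax) where
  nonneg b _ := Finset.prod_nonneg fun _ _ => measureReal_nonneg
  sum_eq_one := by
    simp_rw [← measureReal_arrival_eq hA 0]
    rw [sum_measureReal_preimage_singleton _ fun b _ =>
      hA.measurable_apply 0 MeasurableSet.of_discrete]
    have h : A 0 ⁻¹' (arrivalBox N Amax : Set (QMat N)) ∈ ae μ := by
      filter_upwards [ae_mem_arrivalBox hA hbdd] with ω hω
      exact hω 0
    rw [measureReal_def, (mem_ae_iff_prob_eq_one
      (hA.measurable_apply 0 MeasurableSet.of_discrete)).1 h, ENNReal.toReal_one]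
  mem _ hx _ hb := hu.stateStep_mem hx hb

/-- The transition operator advances conditional means by one slot. -/
theorem condMean_transOp (hu : σ.IsFeedback u) (hA : IsTraffic μ A)
    (hbdd : ∀ᵐ ω ∂μ, ∀ t i j, A t ω i j ≤ Amax) (h : State N → ℝ) {k τ : ℕ} (hkτ : k ≤ τ)
    (a : ℕ → QMat N) :
    condMean μ A k a (fun b => transOp (arrivalBox N Amax) (arrivalProb μ A)
      (stateStep net.delay u) h (σ.state b τ)) =
    condMean μ A k a fun b => h (σ.state b (τ + 1)) := by
  classical
  have hdep : ∀ c, DependsOn (fun b => h (stateStep net.delay u (σ.state b τ) c)) (Set.Iio τ) :=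
    fun c => hu.dependsOn_comp_state τ fun x => h (stateStep net.delay u x c)
  have hint : ∀ c, Integrable (fun ω => h (stateStep net.delay u
      (σ.state (splice k a fun s => A s ω) τ) c)) μ := fun c =>
    hA.integrable_splice hbdd (hdep c) k a
  have hmeas : ∀ c, MeasurableSet (A τ ⁻¹' {c}) := fun c =>
    hA.measurable_apply τ MeasurableSet.of_discrete
  have hprod : ∀ c, ∫ ω, (h (stateStep net.delay u (σ.state (splice k a fun s => A s ω) τ) c) *
      (A τ ⁻¹' {c}).indicator (fun _ => (1 : ℝ)) ω) ∂μ =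
      (∫ ω, h (stateStep net.delay u (σ.state (splice k a fun s => A s ω) τ) c) ∂μ) *
        arrivalProb μ A c := by
    intro c
    have hi := (hA.indepFun_of_dependsOn ((hdep c).comp_splice k a)).comp (φ := id)
      (ψ := ({c} : Set (QMat N)).indicator fun _ => (1 : ℝ)) measurable_id Measurable.of_discrete
    have h1 := hi.integral_fun_mul_eq_mul_integral (hint c).aestronglyMeasurable
      ((Measurable.of_discrete (f := ({c} : Set (QMat N)).indicator fun _ => (1 : ℝ))).comp
        (hA.measurable_apply τ)).aestronglyMeasurable
    have h2 : ∫ ω, (A τ ⁻¹' {c}).indicator (fun _ => (1 : ℝ)) ω ∂μ = arrivalProb μ A c := by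
      rw [integral_indicator_const _ (hmeas c), smul_eq_mul, mul_one, measureReal_arrival_eq hA]
    rw [← h2]
    exact h1
  have hint2 : ∀ c, Integrable (fun ω => h (stateStep net.delay u
      (σ.state (splice k a fun s => A s ω) τ) c) *
      (A τ ⁻¹' {c}).indicator (fun _ => (1 : ℝ)) ω) μ := fun c => by
    have : (fun ω => h (stateStep net.delay u
      (σ.state (splice k a fun s => A s ω) τ) c) *
      (A τ ⁻¹' {c}).indicator (fun _ => (1 : ℝ)) ω) = (A τ ⁻¹' {c}).indicator fun ω =>
        h (stateStep net.delay u (σ.state (splice k a fun s => A s ω) τ) c) := by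
      funext ω
      by_cases hω : ω ∈ A τ ⁻¹' {c} <;> simp [hω]
    rw [this]
    exact (hint c).indicator (hmeas c)
  have hsplit : ∀ᵐ ω ∂μ, h (σ.state (splice k a fun s => A s ω) (τ + 1)) =
      ∑ c ∈ arrivalBox N Amax, h (stateStep net.delay u
        (σ.state (splice k a fun s => A s ω) τ) c) *
        (A τ ⁻¹' {c}).indicator (fun _ => (1 : ℝ)) ω := by
    filter_upwards [ae_mem_arrivalBox hA hbdd] with ω hω
    rw [Finset.sum_eq_single_of_mem (A τ ω) (hω τ), hu.state_succ, splice_of_le hkτ]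
    · simp
    · intro c _ hc
      simp [Set.indicator, Ne.symm hc]
  unfold condMean
  rw [integral_congr_ae hsplit, integral_finsetSum _ fun c _ => hint2 c]
  simp only [transOp_apply]
  rw [integral_finsetSum _ fun c _ => (hint c).const_mul _]
  refine Finset.sum_congr rfl fun c _ => ?_
  rw [hprod, integral_const_mul, mul_comm]

theorem transOp_pow_state (hu : σ.IsFeedback u) (hA : IsTraffic μ A)
    (hbdd : ∀ᵐ ω ∂μ, ∀ t i j, A t ω i j ≤ Amax) (h : State N → ℝ) (k t : ℕ) (a : ℕ → QMat N) :
    (transOp (arrivalBox N Amax) (arrivalProb μ A) (stateStep net.delay u) ^ t) h (σ.state a k) =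
      condMean μ A k a fun b => h (σ.state b (k + t)) := by
  induction t generalizing h with
  | zero =>
    rw [pow_zero, Module.End.one_apply, add_zero]
    exact (condMean_of_dependsOn (hu.dependsOn_comp_state k h)).symm
  | succ t ih =>
    rw [pow_succ, Module.End.mul_apply, ih, condMean_transOp hu hA hbdd h (by omega), add_assoc]

end Traffic

end Network

namespace Network

variable {N : ℕ} {net : Network N}

/-! ### Exponential moments -/

/-- Euclidean norm of the queue lengths. -/
noncomputable def queueNorm (L : QMat N) : ℝ := √(sqSum L)

theorem queueNorm_nonneg (L : QMat N) : 0 ≤ queueNorm L := Real.sqrt_nonneg _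

theorem sq_queueNorm (L : QMat N) : queueNorm L ^ 2 = sqSum L := Real.sq_sqrt (sqSum_nonneg L)

theorem queueNorm_eq_norm (L : QMat N) :
    queueNorm L = ‖WithLp.toLp 2 fun q : Fin N × Fin N => (L q.1 q.2 : ℝ)‖ := by
  rw [EuclideanSpace.norm_eq, queueNorm, sqSum, Fintype.sum_prod_type]
  simp

theorem abs_queueNorm_sub_le {L L' : QMat N} {c : ℝ} (hc : 0 ≤ c)
    (h : ∀ i j, |(L' i j : ℝ) - L i j| ≤ c) : |queueNorm L' - queueNorm L| ≤ N * c := by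
  rw [queueNorm_eq_norm, queueNorm_eq_norm]
  refine (abs_norm_sub_norm_le _ _).trans ?_
  rw [EuclideanSpace.norm_eq]
  refine Real.sqrt_le_iff.2 ⟨by positivity, ?_⟩
  calc _ ≤ ∑ _q : Fin N × Fin N, c ^ 2 := by
        refine Finset.sum_le_sum fun q _ => ?_
        rw [Real.norm_eq_abs]
        exact pow_le_pow_left₀ (abs_nonneg _) (h q.1 q.2) 2
    _ = (N * c) ^ 2 := by simp; ring

theorem le_queueNorm (L : QMat N) (i j : Fin N) : (L i j : ℝ) ≤ queueNorm L := by
  refine Real.le_sqrt_of_sq_le ?_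
  calc (L i j : ℝ) ^ 2 ≤ ∑ j, (L i j : ℝ) ^ 2 :=
        Finset.single_le_sum (f := fun j => (L i j : ℝ) ^ 2) (fun _ _ => sq_nonneg _)
          (Finset.mem_univ j)
    _ ≤ sqSum L := Finset.single_le_sum (f := fun i => ∑ j, (L i j : ℝ) ^ 2)
          (fun _ _ => Finset.sum_nonneg fun _ _ => sq_nonneg _) (Finset.mem_univ i)

theorem totalQueue_le_queueNorm (L : QMat N) : (totalQueue L : ℝ) ≤ N ^ 2 * queueNorm L := by
  unfold totalQueue
  push_cast
  calc _ ≤ ∑ _i : Fin N, ∑ _j : Fin N, queueNorm L :=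
        Finset.sum_le_sum fun i _ => Finset.sum_le_sum fun j _ => le_queueNorm L i j
    _ = _ := by simp; ring

theorem queueNorm_le_totalQueue (L : QMat N) : queueNorm L ≤ totalQueue L := by
  refine Real.sqrt_le_iff.2 ⟨Nat.cast_nonneg _, ?_⟩
  have h : ∑ i, ∑ j, L i j ^ 2 ≤ totalQueue L ^ 2 := by
    rw [sq]
    conv_rhs => rw [totalQueue]
    rw [Finset.sum_mul]
    refine Finset.sum_le_sum fun i _ => ?_
    rw [Finset.sum_mul]
    refine Finset.sum_le_sum fun j _ => ?_
    rw [sq]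
    exact Nat.mul_le_mul_left _ (le_totalQueue L i j)
  unfold sqSum
  exact_mod_cast h

variable {a : ℕ → QMat N} {Amax : ℕ}

theorem abs_queueNorm_queue_sub_le (ha : ∀ t i j, a t i j ≤ Amax) (S : ℕ → Schedule N)
    (k t : ℕ) : |queueNorm (net.queue a S (k + t)) - queueNorm (net.queue a S k)| ≤
      N * ((Amax + 1) * t) := by
  refine abs_queueNorm_sub_le (by positivity) fun i j => ?_
  have h1 : (net.queue a S (k + t) i j : ℝ) ≤ net.queue a S k i j + Amax * t := by
    have := queue_le_add (net := net) (S := S) ha (Nat.le_add_right k t) i j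
    rw [Nat.add_sub_cancel_left] at this
    exact_mod_cast this
  have h2 : (net.queue a S k i j : ℝ) ≤ net.queue a S (k + t) i j + t := by
    have := le_queue_add (net := net) (S := S) (a := a) (Nat.le_add_right k t) i j
    rw [Nat.add_sub_cancel_left] at this
    exact_mod_cast this
  have h3 : 0 ≤ (Amax : ℝ) * t := by positivity
  have h4 : (0 : ℝ) ≤ t := Nat.cast_nonneg t
  rw [abs_le]
  constructor <;> nlinarith

/-- Second-order bound on an exponential; the first-order term is estimated by the increment of the
square, `2 * q * (q' - q) ≤ q' ^ 2 - q ^ 2`, whose mean is under control. -/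
theorem exp_increment_le {q q' θ J : ℝ} (hq : 0 < q) (hθ : 0 < θ) (hJ : |q' - q| ≤ J)
    (hθJ : θ * J ≤ 1) : Real.exp (θ * q') ≤
      Real.exp (θ * q) * (1 + θ ^ 2 * J ^ 2 + θ * (q' ^ 2 - q ^ 2) / (2 * q)) := by
  have h1 : |θ * (q' - q)| ≤ θ * J := by
    rw [abs_mul, abs_of_pos hθ]
    gcongr
  have h2 := (abs_le.1 (Real.abs_exp_sub_one_sub_id_le (h1.trans hθJ))).2
  have h3 : (θ * (q' - q)) ^ 2 ≤ θ ^ 2 * J ^ 2 := by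
    rw [← mul_pow, ← sq_abs]
    gcongr
  have h4 : θ * (q' - q) ≤ θ * (q' ^ 2 - q ^ 2) / (2 * q) := by
    rw [le_div_iff₀ (by positivity)]
    nlinarith [sq_nonneg (q' - q)]
  have h5 : Real.exp (θ * q') = Real.exp (θ * q) * Real.exp (θ * (q' - q)) := by
    rw [← Real.exp_add]; ring_nf
  rw [h5]
  gcongr
  linarith

variable {Ω : Type*} [MeasurableSpace Ω] {μ : Measure Ω} [IsProbabilityMeasure μ]
  {A : ℕ → Ω → QMat N} {π : net.Policy} {g : ℝ → ℝ} {G : ℝ}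

/-- Drift of the sum of squares over a fixed number of slots, uniformly over all histories `a`. -/
theorem exists_sqSum_drift (hg : IsHysteresis g)
    (hπ : π.NearMaxWeight (π.adaptive g) Amax G) (hA : IsTraffic μ A)
    (hbdd : ∀ᵐ ω ∂μ, ∀ t i j, A t ω i j ≤ Amax) (hload : (net.loadSet (rate μ A)).Nonempty)
    (hcov : net.Covering) :
    ∃ n₀ : ℕ, 0 < n₀ ∧ ∃ c₁ c₂ : ℝ, 0 < c₁ ∧ 0 ≤ c₂ ∧ ∀ k a, (∀ t i j, a t i j ≤ Amax) →
      (∀ t i, a t i i = 0) →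
      condMean μ A k a (fun b => sqSum (net.queue b ((π.adaptive g).run b) (k + n₀))) ≤
        sqSum (net.queue a ((π.adaptive g).run a) k) -
          c₁ * queueNorm (net.queue a ((π.adaptive g).run a) k) + c₂ := by
  set T : ℝ := net.delay / (1 - net.load (rate μ A)) + 1 with hTdef
  obtain ⟨hT, hc⟩ := one_sub_sub_load_pos hload (show _ < T from lt_add_one _)
  set n := ⌈T⌉₊ with hn
  have hn0 : 0 < n := Nat.ceil_pos.2 hT
  have hc' : 0 < 1 - net.delay / (n : ℝ) - net.load (rate μ A) := by
    refine lt_of_lt_of_le hc ?_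
    have := Nat.le_ceil T
    gcongr
  set c := 1 - net.delay / (n : ℝ) - net.load (rate μ A)
  obtain ⟨Cg, hCg, hgle⟩ := hg.exists_le_affine (half_pos hc')
  -- Enough slots for the negative drift to outweigh the possible delay in the beginning.
  obtain ⟨n₀, hn₀⟩ := exists_nat_gt ((n + net.delay + 1) / (c / 2))
  rw [div_lt_iff₀ (by positivity)] at hn₀
  have hn₀pos : 0 < n₀ := by
    rcases Nat.eq_zero_or_pos n₀ with h | h
    · rw [h] at hn₀
      have : (0 : ℝ) ≤ n + net.delay + 1 := by positivity
      simp at hn₀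
      linarith
    · exact h
  set K := N ^ 2 with hK
  set C := G + hystInv g (G + K * (Amax + 1) * T) + K * Amax * T + K * Amax * net.delay +
        (N ^ 2 * Amax ^ 2 + K) / 2 with hC
  set σ := π.adaptive g with hσ
  set c₂ := 2 * (n₀ * (C + Cg) + c / 2 * (n₀ * (K * n₀)) +
    (n + net.delay) * (K * Amax * (n + net.delay))) with hc₂
  refine ⟨n₀, hn₀pos, 2 / (N + 1), |c₂|, by positivity, abs_nonneg _, fun k a ha hd => ?_⟩
  have h := condMean_sqSum_add_le (k := k) (n := n) (K := K) hg hπ hA hbdd hload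
    (fun S _ => schedSize_le_sq S) hT.le hn0
    (by have := Nat.ceil_lt_add_one hT.le; linarith) ha hd n₀
  rw [← hσ, ← hC] at h
  set L := net.queue a (σ.run a) k with hL
  set W := ∑ τ ∈ Finset.Ico k (k + n₀), condMean μ A k a
    (fun b => (net.maxWeight (net.queue b (σ.run b) τ) : ℝ)) with hW
  have h1 : ∑ τ ∈ Finset.Ico k (k + n₀), condMean μ A k a
      (fun b => g (net.maxWeight (net.queue b (σ.run b) τ))) ≤ c / 2 * W + n₀ * Cg := by
    have : ∀ τ ∈ Finset.Ico k (k + n₀), condMean μ A k a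
        (fun b => g (net.maxWeight (net.queue b (σ.run b) τ))) ≤
        c / 2 * condMean μ A k a (fun b => (net.maxWeight (net.queue b (σ.run b) τ) : ℝ)) + Cg := by
      intro τ _
      have hi := hA.integrable_splice hbdd
        (dependsOn_comp_queue σ τ fun L => (net.maxWeight L : ℝ)) k a
      have h2 := integral_mono (hA.integrable_splice hbdd
        (dependsOn_comp_queue σ τ fun L => g (net.maxWeight L)) k a)
        ((hi.const_mul (c / 2)).add (integrable_const Cg)) fun ω => hgle _ (Nat.cast_nonneg _)
      simp only [Pi.add_apply] at h2
      rw [integral_add (hi.const_mul (c / 2)) (integrable_const Cg), integral_const_mul] at h2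
      simpa [condMean] using h2
    refine (Finset.sum_le_sum this).trans (le_of_eq ?_)
    rw [Finset.sum_add_distrib, ← Finset.mul_sum, Finset.sum_const, Nat.card_Ico,
      add_tsub_cancel_left, nsmul_eq_mul]
  have h2 : n₀ * (net.maxWeight L - K * n₀ : ℝ) ≤ W := by
    have : ∀ τ ∈ Finset.Ico k (k + n₀), (net.maxWeight L - K * n₀ : ℝ) ≤ condMean μ A k a
        (fun b => (net.maxWeight (net.queue b (σ.run b) τ) : ℝ)) := by
      intro τ hτ
      rw [Finset.mem_Ico] at hτ
      have h3 := integral_mono (integrable_const (net.maxWeight L - K * n₀ : ℝ))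
        (hA.integrable_splice hbdd (dependsOn_comp_queue σ τ fun L => (net.maxWeight L : ℝ)) k a)
        fun ω => by
          set b : ℕ → QMat N := splice k a fun s => A s ω
          have h4 := maxWeight_le_add (net := net) (fun S _ => schedSize_le_sq S)
            (le_queue_add (net := net) (a := b) (S := σ.run b) hτ.1)
          have h5 : net.queue b (σ.run b) k = L :=
            Policy.queue_run_congr σ fun s hs => splice_of_lt hs _ _
          rw [h5] at h4
          have h6 : net.maxWeight L ≤ net.maxWeight (net.queue b (σ.run b) τ) + K * n₀ :=
            h4.trans (by gcongr; omega)
          simp only [tsub_le_iff_right]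
          exact_mod_cast h6
      simpa [condMean] using h3
    have h3 := Finset.card_nsmul_le_sum _ _ _ this
    rwa [Nat.card_Ico, add_tsub_cancel_left, nsmul_eq_mul] at h3
  have h3 : queueNorm L ≤ (N + 1) * net.maxWeight L := by
    refine (queueNorm_le_totalQueue L).trans ?_
    have := hcov.totalQueue_le (L := L) (queue_diag hd k)
    have h4 : totalQueue L ≤ (N + 1) * net.maxWeight L := by nlinarith
    exact_mod_cast h4
  have h4 : 2 / (N + 1) * queueNorm L ≤ 2 * net.maxWeight L := by
    rw [div_mul_eq_mul_div, div_le_iff₀ (by positivity)]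
    linarith
  have h5 : (0 : ℝ) ≤ net.maxWeight L := Nat.cast_nonneg _
  have h6 := mul_le_mul_of_nonneg_right hn₀.le h5
  have h7 := mul_le_mul_of_nonneg_left h2 (half_pos hc').le
  have h8 := le_abs_self c₂
  nlinarith

/-- Geometric drift of the exponentials of small multiples of the norm. -/
theorem exists_exp_drift (hg : IsHysteresis g)
    (hπ : π.NearMaxWeight (π.adaptive g) Amax G) (hA : IsTraffic μ A)
    (hbdd : ∀ᵐ ω ∂μ, ∀ t i j, A t ω i j ≤ Amax) (hload : (net.loadSet (rate μ A)).Nonempty)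
    (hcov : net.Covering) :
    ∃ n₀ : ℕ, 0 < n₀ ∧ ∃ θ₀ : ℝ, 0 < θ₀ ∧ ∀ θ, 0 < θ → θ ≤ θ₀ →
      ∃ κ b : ℝ, 0 ≤ κ ∧ κ < 1 ∧ 0 ≤ b ∧ ∀ k a, (∀ t i j, a t i j ≤ Amax) →
      (∀ t i, a t i i = 0) →
      condMean μ A k a
        (fun b => Real.exp (θ * queueNorm (net.queue b ((π.adaptive g).run b) (k + n₀)))) ≤
        κ * Real.exp (θ * queueNorm (net.queue a ((π.adaptive g).run a) k)) + b := by
  obtain ⟨n₀, hn₀, c₁, c₂, hc₁, hc₂, hdrift⟩ := exists_sqSum_drift hg hπ hA hbdd hload hcov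
  set J : ℝ := N * ((Amax + 1) * n₀) + 1 with hJ
  have hJ0 : 1 ≤ J := by
    have : (0 : ℝ) ≤ N * ((Amax + 1) * n₀) := by positivity
    linarith
  refine ⟨n₀, hn₀, min (1 / J) (min (c₁ / (8 * J ^ 2)) (1 / c₁)), by positivity,
    fun θ hθ hθle => ?_⟩
  rw [le_min_iff, le_min_iff, le_div_iff₀ (by positivity), le_div_iff₀ (by positivity),
    le_div_iff₀ hc₁] at hθle
  obtain ⟨hθ1, hθ2, hθ3⟩ := hθle
  set q₁ := 2 * c₂ / c₁ with hq₁
  have hq₁0 : 0 ≤ q₁ := by positivity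
  refine ⟨1 - θ * c₁ / 8, Real.exp (θ * (q₁ + J)), by linarith, by nlinarith [mul_pos hθ hc₁],
    (Real.exp_pos _).le, fun k a ha hd => ?_⟩
  have hV := hdrift k a ha hd
  set σ := π.adaptive g with hσ
  set q := queueNorm (net.queue a (σ.run a) k) with hq
  have hq0 : 0 ≤ q := queueNorm_nonneg _
  have hinc : ∀ᵐ ω ∂μ, |queueNorm (net.queue (splice k a fun s => A s ω)
      (σ.run (splice k a fun s => A s ω)) (k + n₀)) - q| ≤ J := by
    filter_upwards [ae_splice_le (k := k) hbdd ha] with ω hω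
    have h1 := abs_queueNorm_queue_sub_le (net := net) hω
      (σ.run (splice k a fun s => A s ω)) k n₀
    have h2 : net.queue (splice k a fun s => A s ω)
        (σ.run (splice k a fun s => A s ω)) k = net.queue a (σ.run a) k :=
      Policy.queue_run_congr σ fun s hs => splice_of_lt hs _ _
    rw [h2] at h1
    linarith
  have hint := hA.integrable_splice hbdd (dependsOn_comp_queue σ (k + n₀)
    fun L => Real.exp (θ * queueNorm L)) k a
  have hκ : 0 ≤ 1 - θ * c₁ / 8 := by linarith
  rcases le_or_gt q q₁ with hqle | hqgt
  · have h1 := integral_mono_ae hint (integrable_const (Real.exp (θ * (q₁ + J)))) (by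
      filter_upwards [hinc] with ω hω
      have := (abs_le.1 hω).2
      refine Real.exp_le_exp.2 ?_
      gcongr
      linarith)
    have h2 : 0 ≤ (1 - θ * c₁ / 8) * Real.exp (θ * q) := mul_nonneg hκ (Real.exp_pos _).le
    simp only [integral_const, probReal_univ, one_smul] at h1
    unfold condMean
    linarith
  · have hqpos : 0 < q := hq₁0.trans_lt hqgt
    set E := Real.exp (θ * q) with hE
    have hE0 : 0 < E := Real.exp_pos _
    have hintV := hA.integrable_splice hbdd (dependsOn_comp_queue σ (k + n₀) sqSum) k a
    have h1 := integral_mono_ae hint ((hintV.const_mul (E * θ / (2 * q))).add (integrable_const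
      (E * (1 + θ ^ 2 * J ^ 2 - θ * q ^ 2 / (2 * q))))) (by
      filter_upwards [hinc] with ω hω
      refine (exp_increment_le hqpos hθ hω hθ1).trans (le_of_eq ?_)
      rw [sq_queueNorm, Pi.add_apply]
      ring)
    simp only [Pi.add_apply] at h1
    rw [integral_add (hintV.const_mul _) (integrable_const _), integral_const_mul] at h1
    simp only [integral_const, probReal_univ, one_smul] at h1
    have h2 : E * θ / (2 * q) * condMean μ A k a
        (fun b => sqSum (net.queue b (σ.run b) (k + n₀))) ≤
        E * θ / (2 * q) * (q ^ 2 - c₁ * q + c₂) := by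
      refine mul_le_mul_of_nonneg_left ?_ (by positivity)
      rw [hq, sq_queueNorm, ← hq]
      exact hV
    have h3 : c₂ ≤ c₁ * q / 2 := by
      rw [hq₁, div_lt_iff₀ hc₁] at hqgt
      linarith
    have h4 : E * θ / (2 * q) * (q ^ 2 - c₁ * q + c₂) +
        E * (1 + θ ^ 2 * J ^ 2 - θ * q ^ 2 / (2 * q)) =
        E * (1 + θ ^ 2 * J ^ 2 - θ * c₁ / 2 + θ * (c₂ / (2 * q))) := by
      field_simp
      ring
    have h5 : θ * (c₂ / (2 * q)) ≤ θ * (c₁ / 4) := by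
      refine mul_le_mul_of_nonneg_left ?_ hθ.le
      rw [div_le_iff₀ (by positivity)]
      linarith
    have h6 : θ ^ 2 * J ^ 2 ≤ θ * c₁ / 8 := by nlinarith
    have h7 : E * (1 + θ ^ 2 * J ^ 2 - θ * c₁ / 2 + θ * (c₂ / (2 * q))) ≤
        E * (1 - θ * c₁ / 8) := by
      gcongr
      linarith
    have h8 := Real.exp_pos (θ * (q₁ + J))
    unfold condMean at h2 ⊢
    linarith

/-! ### Convergence of the mean total queue length -/

theorem exists_tendsto_mean_totalQueue (hdelay : 0 < net.delay) (hg : IsHysteresis g)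
    (hπ : π.NearMaxWeight (π.adaptive g) Amax G) (hA : IsTraffic μ A)
    (hbdd : ∀ᵐ ω ∂μ, ∀ t i j, A t ω i j ≤ Amax) (hload : (net.loadSet (rate μ A)).Nonempty)
    (hcov : net.Covering) (hmarkov : π.IsMarkov) :
    ∃ ℓ, Tendsto (fun t => (π.adaptive g).mean μ A t fun L => totalQueue L) atTop (𝓝 ℓ) := by
  obtain ⟨p, hu⟩ := hmarkov.exists_isFeedback g
  obtain ⟨n₀, hn₀, θ₀, hθ₀, hdrift⟩ := exists_exp_drift hg hπ hA hbdd hload hcov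
  set σ := π.adaptive g with hσ
  have hc := hu.isRandomStep hA hbdd
  set P := transOp (arrivalBox N Amax) (arrivalProb μ A)
    (stateStep net.delay (adaptiveFeedback g p)) with hP
  -- Geometric bounds for all means of `exp (θ q)`, with small `θ`.
  have hmom : ∀ θ, 0 < θ → θ ≤ θ₀ → ∃ κ b C : ℝ, 0 ≤ κ ∧ κ < 1 ∧ 0 ≤ b ∧ 1 ≤ C ∧
      ∀ n, ∀ x ∈ σ.reachable Amax, (P ^ n) (fun y => Real.exp (θ * queueNorm y.2.1)) x ≤
        C * (κ ^ (n / n₀) * Real.exp (θ * queueNorm x.2.1) + b) := by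
    intro θ hθ hθle
    obtain ⟨κ, b, hκ0, hκ1, hb, hle⟩ := hdrift θ hθ hθle
    have hγ : 1 ≤ Real.exp (θ * (N * ((Amax + 1) * (1 : ℕ)))) := Real.one_le_exp (by positivity)
    refine ⟨κ, b / (1 - κ), _, hκ0, hκ1, div_nonneg hb (by linarith), one_le_pow₀ hγ,
      fun n x hx => hc.transOp_pow_le_of_drift (fun _ _ => (Real.exp_pos _).le) hn₀ hκ0 hκ1 hγ
        ?_ hb ?_ n hx⟩
    · rintro _ ⟨k, a, ha, hd, rfl⟩
      rw [transOp_pow_state hu hA hbdd]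
      exact hle k a ha hd
    · rintro _ ⟨k, a, ha, hd, rfl⟩
      have h1 := transOp_pow_state hu hA hbdd
        (fun y => Real.exp (θ * queueNorm y.2.1)) k 1 a
      rw [pow_one] at h1
      rw [h1]
      have h2 := integral_mono_ae (hA.integrable_splice hbdd
        (hu.dependsOn_comp_state (k + 1) fun y => Real.exp (θ * queueNorm y.2.1)) k a)
        (integrable_const (Real.exp (θ * (N * ((Amax + 1) * (1 : ℕ)))) *
          Real.exp (θ * queueNorm (σ.state a k).2.1))) (by
        filter_upwards [ae_splice_le (k := k) hbdd ha] with ω hω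
        have h3 := (abs_le.1 (abs_queueNorm_queue_sub_le (net := net) hω
          (σ.run (splice k a fun s => A s ω)) k 1)).2
        have h4 : net.queue (splice k a fun s => A s ω)
            (σ.run (splice k a fun s => A s ω)) k = net.queue a (σ.run a) k :=
          Policy.queue_run_congr σ fun s hs => splice_of_lt hs _ _
        rw [h4] at h3
        rw [← Real.exp_add, ← mul_add]
        refine Real.exp_le_exp.2 (mul_le_mul_of_nonneg_left ?_ hθ.le)
        simp only [Policy.state]
        linarith)
      simpa [condMean] using h2
  obtain ⟨κ, b, C, hκ0, hκ1, hb, hC, hmom1⟩ := hmom (θ₀ / 2) (by positivity) (by linarith)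
  obtain ⟨κ', b', C', hκ0', hκ1', hb', hC', hmom2⟩ := hmom θ₀ hθ₀ le_rfl
  set Ψ : State N → ℝ := fun y => Real.exp (θ₀ / 2 * queueNorm y.2.1) with hΨ
  have hΨ1 : ∀ x, 1 ≤ Ψ x := fun x =>
    Real.one_le_exp (mul_nonneg (by positivity) (queueNorm_nonneg _))
  have hqΨ : ∀ x : State N, queueNorm x.2.1 ≤ 2 / θ₀ * Ψ x := by
    intro x
    have h1 := Real.add_one_le_exp (θ₀ / 2 * queueNorm x.2.1)
    have h2 : 2 / θ₀ * (θ₀ / 2 * queueNorm x.2.1) ≤ 2 / θ₀ * Ψ x := by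
      gcongr
      simp only [hΨ]
      linarith
    have h3 : 2 / θ₀ * (θ₀ / 2 * queueNorm x.2.1) = queueNorm x.2.1 := by field_simp
    linarith
  have hx₀ : σ.state 0 0 ∈ σ.reachable Amax := ⟨0, 0, by simp, by simp, rfl⟩
  obtain ⟨ℓ, hℓ⟩ := hc.exists_tendsto_transOp_pow (b₀ := 0) (Ψ := Ψ) (β := C * (1 + b))
    (γ := C * (1 + b)) (f := fun y => (totalQueue y.2.1 : ℝ)) (c := N ^ 2 * (2 / θ₀))
    (mem_arrivalBox.2 ⟨by simp, by simp⟩) (arrivalProb_zero_pos hA hload)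
    (fun x _ => exists_iterate_stateStep_fixed hdelay
      (fun S L => weight_lt_of_adaptiveFeedback_ne hg) x)
    (fun x _ => hΨ1 x)
    (by
      intro c
      have hfin : {L : QMat N | ∀ i, L i ∈ {l : Fin N → ℕ | ∀ j, l j ∈
          Set.Iic ⌊2 / θ₀ * c⌋₊}}.Finite :=
        Set.Finite.pi' fun _ => Set.Finite.pi' fun _ => Set.finite_Iic _
      refine (Set.finite_univ.prod (hfin.prod (Set.finite_Iic net.delay))).subset ?_
      rintro x ⟨⟨k, a, -, -, rfl⟩, hx⟩
      refine ⟨Set.mem_univ _, fun i j => Nat.le_floor ?_, remaining_le _ _⟩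
      refine (le_queueNorm _ i j).trans ((hqΨ _).trans ?_)
      gcongr)
    (by positivity)
    (by
      intro x hx
      have h1 : Tendsto (fun n : ℕ => κ ^ (n / n₀) * Ψ x) atTop (𝓝 0) := by
        have := ((tendsto_pow_atTop_nhds_zero_of_lt_one hκ0 hκ1).comp
          (Nat.tendsto_div_const_atTop hn₀.ne')).mul_const (Ψ x)
        simpa using this
      filter_upwards [h1.eventually_le_const zero_lt_one] with n hn
      refine (hmom1 n x hx).trans ?_
      gcongr)
    (by
      intro x hx n
      refine (hmom1 n x hx).trans ?_
      rw [mul_assoc]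
      have h1 : κ ^ (n / n₀) ≤ 1 := pow_le_one₀ hκ0 hκ1.le
      have h2 := hΨ1 x
      refine mul_le_mul_of_nonneg_left ?_ (by linarith)
      have h3 : κ ^ (n / n₀) * Ψ x ≤ 1 * Ψ x := by gcongr
      have h4 : b * 1 ≤ b * Ψ x := by gcongr
      simp only [hΨ] at h3 h4 ⊢
      linarith)
    (by
      intro x hx
      refine ⟨C' * (1 * Real.exp (θ₀ * queueNorm x.2.1) + b'), fun n => ?_⟩
      have h1 : (fun y : State N => Ψ y ^ 2) = fun y => Real.exp (θ₀ * queueNorm y.2.1) := by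
        funext y
        simp only [hΨ]
        rw [← Real.exp_nat_mul]
        congr 1
        push_cast
        ring
      rw [h1]
      refine (hmom2 n x hx).trans ?_
      have h1 : κ' ^ (n / n₀) ≤ 1 := pow_le_one₀ hκ0' hκ1'.le
      gcongr)
    (by
      intro x _
      rw [abs_of_nonneg (Nat.cast_nonneg _)]
      refine (totalQueue_le_queueNorm _).trans ?_
      rw [mul_assoc]
      gcongr
      exact hqΨ x)
    hx₀
  refine ⟨ℓ, hℓ.congr fun t => ?_⟩
  rw [transOp_pow_state hu hA hbdd, condMean_zero, zero_add]
  rfl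

end Network

/-! ### Stability, bound and limit -/

theorem theorem1 {N : ℕ} (net : Network N) (hdelay : 0 < net.delay)
    (g : ℝ → ℝ) (hg : IsHysteresis g)
    (π : net.Policy) (Amax : ℕ) (G : ℝ)
    (hπ : π.NearMaxWeight (π.adaptive g) Amax G)
    {Ω : Type*} [MeasurableSpace Ω] (μ : Measure Ω) [IsProbabilityMeasure μ]
    (A : ℕ → Ω → QMat N) (hA : IsTraffic μ A)
    (hbdd : ∀ t i j, ∀ᵐ ω ∂μ, A t ω i j ≤ Amax)
    (hadm : net.Admissible μ A) (hload : (net.loadSet (rate μ A)).Nonempty) :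
    (π.adaptive g).StronglyStabilizes μ A ∧
    (ConcaveOn ℝ (Set.Ici 0) g → net.Crossbar → net.Covering →
      ∃ Ltil : ℝ → ℝ,
        (∀ T, net.delay / (1 - net.load (rate μ A)) < T →
          0 ≤ Ltil T ∧
          Ltil T = fixRhs N net.delay g Amax G (net.load (rate μ A)) T (Ltil T) ∧
          ∀ y, 0 ≤ y → y = fixRhs N net.delay g Amax G (net.load (rate μ A)) T y →
            y = Ltil T) ∧
        (π.adaptive g).limsupAverage μ A ≤ ENNReal.ofReal
          (⨅ T : Set.Ioi ((net.delay : ℝ) / (1 - net.load (rate μ A))), Ltil T) ∧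
        (π.IsMarkov → ∃ ℓ : ℝ≥0∞,
          Tendsto (fun t => (π.adaptive g).meanQueue μ A t) atTop (𝓝 ℓ) ∧
          ℓ ≤ ENNReal.ofReal
            (⨅ T : Set.Ioi ((net.delay : ℝ) / (1 - net.load (rate μ A))), Ltil T))) := by
  have hbdd' : ∀ᵐ ω ∂μ, ∀ t i j, A t ω i j ≤ Amax :=
    ae_all_iff.2 fun t => ae_all_iff.2 fun i => ae_all_iff.2 fun j => hbdd t i j
  refine ⟨Network.stronglyStabilizes_adaptive hg hπ hA hbdd' hload, fun hconc hcross hcov => ?_⟩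
  have hex := fun T hT => Network.exists_fixRhs_fixedPoint (T := T) hdelay hg hconc hcross hcov hπ
    hA hbdd' hload hT
  choose! Ltil hL0 hfix huniq hlim using hex
  have hbound : (π.adaptive g).limsupAverage μ A ≤ ENNReal.ofReal
      (⨅ T : Set.Ioi ((net.delay : ℝ) / (1 - net.load (rate μ A))), Ltil T) := by
    rw [ENNReal.le_ofReal_iff_toReal_le]
    · exact le_ciInf fun T => ENNReal.toReal_le_of_le_ofReal (hL0 T T.2) (hlim T T.2)
    · exact (Network.stronglyStabilizes_adaptive hg hπ hA hbdd' hload).ne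
    · exact Real.iInf_nonneg fun T => hL0 T T.2
  refine ⟨Ltil, fun T hT => ⟨hL0 T hT, hfix T hT, huniq T hT⟩, hbound, fun hmarkov => ?_⟩
  obtain ⟨ℓ, hℓ⟩ := Network.exists_tendsto_mean_totalQueue hdelay hg hπ hA hbdd' hload hcov hmarkov
  -- The time averages have the same limit as the sequence.
  have hces : Tendsto (fun t : ℕ => (∑ τ ∈ Finset.range t,
      (π.adaptive g).meanQueue μ A τ) / (t : ℝ≥0∞)) atTop (𝓝 (ENNReal.ofReal ℓ)) := by
    refine (ENNReal.tendsto_ofReal hℓ.cesaro).congr' ?_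
    filter_upwards [eventually_gt_atTop 0] with t ht
    rw [Network.average_meanQueue_eq hA hbdd' _ ht, div_eq_inv_mul]
  refine ⟨ENNReal.ofReal ℓ, ?_, hces.limsup_eq.symm.trans_le hbound⟩
  simp_rw [Network.meanQueue_eq_ofReal hA hbdd']
  exact ENNReal.tendsto_ofReal hℓ
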